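/- Let $\omega>0$, let $J$ be a real, invertible, skew-symmetric $2\times2$ matrix, and let $q,w$ be $2\times 2$ matrices whose entries are real $\omega$-periodic distributions of order $0$ on $\mathbb R$ (that is, derivatives of real functions of locally bounded variation, identified with local signed measures), $q$ symmetric and $w$ non-negative. Write $\Delta_q(x),\Delta_w(x)$ for the jumps at $x$ of antiderivatives of $q,w$, and assume that $J\pm\frac12(\Delta_q(x)-\lambda\Delta_w(x))$ is invertible for all $\lambda,x\in\mathbb R$. Solutions of $Ju'+qu=\lambda wu$ are understood in the sense of distributions among the balanced functions $u:\mathbb R\to\mathbb C^2$ of locally bounded variation, i.e. those with $u=(u^++u^-)/2$. A fundamental matrix $U(\cdot,\lambda)$ is one whose columns form a basis of the solution space; a monodromy matrix $M(\lambda)$ is one with $U(x+\omega,\lambda)=U(x,\lambda)M(\lambda)$ for all $x\in\mathbb R$, for some fundamental matrix $U(\cdot,\lambda)$; and $D(\lambda)=\operatorname{tr}M(\lambda)$ is the Floquet discriminant. Let $\mathcal L_0$ be the space of balanced $u$ of locally bounded variation with $Ju'+qu=0$ and $wu=0$. Theorem. Suppose $\mathcal L_0=\{0\}$. Then: (0)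 $M(\lambda)$ exists for every $\lambda\in\mathbb R$; whenever a monodromy matrix exists, $D(\lambda)$ does not depend on the choice of it; and $D$ is real-valued on $\mathbb R$ and complex differentiable at every point of $\mathbb R$. (1) On every interval $I\subset\mathbb R$ on which $D^2<4$, the restriction of $D$ to $I$ is strictly monotone. (2) If $\lambda\in\mathbb C$ is such that $M(\lambda)$ exists and $D(\lambda)^2=4$, then $D'(\lambda)=0$ if and only if $M(\lambda)=\mathrm{id}$ or $M(\lambda)=-\mathrm{id}$ (for any choice of monodromy matrix $M(\lambda)$). (3) If $\lambda\in\mathbb R$ and $D(\lambda)=2$, then $\lambda$ is not a strict local minimum of $D|_{\mathbb R}$; if $\lambda\in\mathbb R$ and $D(\lambda)=-2$, then $\lambda$ is not a strict local maximum of $D|_{\mathbb R}$. -/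

import Mathlib

open MeasureTheory Set Filter Topology

/-- A test function: smooth with compact support. -/
def IsTestFunction {E : Type*} [NormedAddCommGroup E] [NormedSpace ℝ E] (φ : ℝ → E) : Prop :=
  ContDiff ℝ (⊤ : ℕ∞) φ ∧ HasCompactSupport φ

/-- A real distribution of order `0` on the line, identified with the real Radon (local, signed)
measure `dR`, where `R` is an antiderivative of locally bounded variation. The local measure is
given by its unique Jordan decomposition `dR = pos - neg` into mutually singular, locally finite
positive Borel measures. -/
structure OrderZeroDistribution where
  pos : Measure ℝ
  neg : Measure ℝ
  locallyFinite_pos : IsLocallyFiniteMeasure pos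
  locallyFinite_neg : IsLocallyFiniteMeasure neg
  mutuallySingular : pos ⟂ₘ neg

namespace OrderZeroDistribution

/-- `r.pair f = ∫ f dR`. For a test function `φ` this is the value `r(φ)` of the distribution, and
for a locally bounded Borel function `f`, `r.pair (f * φ)` is the value at `φ` of the product `r f`. -/
noncomputable def pair {E : Type*} [NormedAddCommGroup E] [NormedSpace ℝ E]
    (r : OrderZeroDistribution) (f : ℝ → E) : E :=
  (∫ x, f x ∂r.pos) - ∫ x, f x ∂r.neg

/-- The jump `Δ_r(x) = R⁺(x) - R⁻(x)` of an antiderivative `R` of `r`, i.e. the mass of `{x}`. -/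
noncomputable def jump (r : OrderZeroDistribution) (x : ℝ) : ℝ :=
  r.pos.real {x} - r.neg.real {x}

/-- `ω` is a period of the distribution `r`. -/
def HasPeriod (r : OrderZeroDistribution) (ω : ℝ) : Prop :=
  ∀ φ : ℝ → ℝ, IsTestFunction φ → r.pair φ = r.pair (fun x => φ (x + ω))

end OrderZeroDistribution

namespace PeriodicSystem

/-- A `2 × 2` matrix of real distributions of order `0`. -/
abbrev Coeff := Matrix (Fin 2) (Fin 2) OrderZeroDistribution

/-- The matrix `r` of distributions is non-negative: `r(φ)` is (symmetric and) positive
semi-definite for every non-negative test function `φ`. -/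
def IsNonneg (r : Coeff) : Prop :=
  ∀ φ : ℝ → ℝ, IsTestFunction φ → (∀ x, 0 ≤ φ x) →
    (r.map fun s => s.pair φ).PosSemidef

/-- The matrix `Δ_r(x)`. -/
noncomputable def jump (r : Coeff) (x : ℝ) : Matrix (Fin 2) (Fin 2) ℝ :=
  r.map fun s => s.jump x

/-- The standing hypotheses on the real `ω`-periodic `2 × 2` system `J u' + q u = l w u`. -/
structure IsAdmissible (ω : ℝ) (J : Matrix (Fin 2) (Fin 2) ℝ) (q w : Coeff) : Prop where
  period_pos : 0 < ω
  skew : J.transpose = -J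
  invertible : IsUnit J
  q_symm : q.transpose = q
  w_nonneg : IsNonneg w
  q_periodic : ∀ i j, (q i j).HasPeriod ω
  w_periodic : ∀ i j, (w i j).HasPeriod ω
  isUnit_plus : ∀ l x : ℝ, IsUnit (J + (1 / 2 : ℝ) • (jump q x - l • jump w x))
  isUnit_minus : ∀ l x : ℝ, IsUnit (J - (1 / 2 : ℝ) • (jump q x - l • jump w x))

/-- `u` is of locally bounded variation and balanced, i.e. `u = (u⁺ + u⁻) / 2`. -/
def IsBalancedBV (u : ℝ → Fin 2 → ℂ) : Prop :=
  LocallyBoundedVariationOn u univ ∧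
    ∀ x, u x = (1 / 2 : ℂ) • (Function.rightLim u x + Function.leftLim u x)

/-- The `i`-th entry of the vector distribution `r u`, evaluated at `φ`. -/
noncomputable def mulApply (r : Coeff) (u : ℝ → Fin 2 → ℂ) (φ : ℝ → ℂ) (i : Fin 2) : ℂ :=
  ∑ j, (r i j).pair fun x => u x j * φ x

/-- The `i`-th entry of the vector distribution `J u'`, evaluated at `φ`. -/
noncomputable def derivApply (J : Matrix (Fin 2) (Fin 2) ℝ) (u : ℝ → Fin 2 → ℂ) (φ : ℝ → ℂ)
    (i : Fin 2) : ℂ :=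
  ∑ j, (J i j : ℂ) * -∫ x, u x j * deriv φ x

/-- `u` is a balanced solution of locally bounded variation of `J u' + q u = l w u`, the equation
being understood in the sense of distributions. -/
def IsSolution (J : Matrix (Fin 2) (Fin 2) ℝ) (q w : Coeff) (l : ℂ) (u : ℝ → Fin 2 → ℂ) : Prop :=
  IsBalancedBV u ∧ ∀ φ : ℝ → ℂ, IsTestFunction φ → ∀ i,
    derivApply J u φ i + mulApply q u φ i = l * mulApply w u φ i

/-- The space `ℒ₀` of all balanced `u` with `J u' + q u = 0` and `w u = 0`. -/
def L0 (J : Matrix (Fin 2) (Fin 2) ℝ) (q w : Coeff) : Set (ℝ → Fin 2 → ℂ) :=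
  {u | IsBalancedBV u ∧ ∀ φ : ℝ → ℂ, IsTestFunction φ → ∀ i,
    derivApply J u φ i + mulApply q u φ i = 0 ∧ mulApply w u φ i = 0}

/-- `U` is a fundamental matrix: its columns form a basis of the space of solutions of
`J u' + q u = l w u`. -/
def IsFundamentalMatrix (J : Matrix (Fin 2) (Fin 2) ℝ) (q w : Coeff) (l : ℂ)
    (U : ℝ → Matrix (Fin 2) (Fin 2) ℂ) : Prop :=
  (∀ c : Fin 2 → ℂ, IsSolution J q w l fun x => (U x).mulVec c) ∧
    ∀ u, IsSolution J q w l u → ∃! c : Fin 2 → ℂ, u = fun x => (U x).mulVec c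

/-- `M` is a monodromy matrix of `J u' + q u = l w u`: `U(x + ω) = U(x) M` for some fundamental
matrix `U`. -/
def IsMonodromyMatrix (ω : ℝ) (J : Matrix (Fin 2) (Fin 2) ℝ) (q w : Coeff) (l : ℂ)
    (M : Matrix (Fin 2) (Fin 2) ℂ) : Prop :=
  ∃ U : ℝ → Matrix (Fin 2) (Fin 2) ℂ, IsFundamentalMatrix J q w l U ∧ ∀ x, U (x + ω) = U x * M

open Classical in
/-- The Floquet discriminant `D(l) = tr M(l)`, with `M(l)` any monodromy matrix (all of them are
similar); the value is irrelevant where there is no monodromy matrix. -/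
noncomputable def discriminant (ω : ℝ) (J : Matrix (Fin 2) (Fin 2) ℝ) (q w : Coeff) (l : ℂ) : ℂ :=
  if h : ∃ M, IsMonodromyMatrix ω J q w l M then h.choose.trace else 0

end PeriodicSystem

/-! Skew-symmetry gives J = c·((0,-1),(1,0)). Relative to a locally finite measure μ dominating all
entries of q and w, with bounded symmetric densities Q and W, the equation reads u' = A u μ with A =
J⁻¹(λW - Q). Symmetry makes A trace-free, so the Wronskian of the left limits of two solutions is
constant. For parameters λ and λ' its increment over [a,b) is (λ-λ')/c times the bilinear `energy` ∫
uᵀWu' dμ: this is Lagrange's identity. For real λ, and for complex λ near a given real point, the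
balanced value at an atom can be solved for from the left limit. A Volterra series then yields
exactly one solution with prescribed left limit at 0 (`exists_isSolution`, `eq_of_leftLim_eq`), and
the resulting monodromy matrix M has determinant 1.

Lagrange's identity and Cramer's rule express a solution at λ through those at λ₀, with coefficients
(λ-λ₀)/c times energies (`leftLim_sol_sub`). The difference quotient of D is therefore exactly a
combination of energies, and their continuity gives c·D' = -m₁₂g₁ + (m₁₁-m₂₂)g₂ + m₂₁g₃, where G =
((g₁,g₂),(g₂,g₃)) is the Gram matrix of the energy over one period (`hasDerivAt_discriminant`). At
real λ, M and G are real and G is positive semidefinite. The hypothesis on ℒ₀ enters through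
`mem_L0`: a solution with no energy on any period cell lies in ℒ₀, hence vanishes.

The rest is linear algebra of M and G. If D² < 4, the form paired with G in c·D' has discriminant D²
- 4 < 0, so D' = 0 forces G = 0 and every solution vanishes, which is absurd. If D = 2σ with σ = ±1,
the columns of M - σ are annihilated by M - σ and their energies are multiples of D'. A nonzero
solution with multiplier σ has positive energy, so D' = 0 exactly when M = σ. If M(λ₀) = σ, then G
is positive definite, and det M(λ) = 1 turns into σD(λ) = 2 - ((λ-λ₀)/c)²·E(λ) with E(λ) → det G >
0, so σD < 2 nearby. A strict local minimum of σD with value 2 would force D' = 0, hence M = σ, a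
contradiction.

At non-real λ unique solvability may fail, since only real λ are covered by the invertibility
hypothesis. In (2) the existence of a monodromy matrix takes its place: `leftLim_eq_zero` and
`det_eq_one` recover det M = 1, and Lagrange's identity for u and its conjugate shows that a
multiplier ±1 forces λ to be real. -/

open scoped Matrix

/-! ### Factorial decay of iterated integrals against a measure -/

section Volterra

open scoped ENNReal

/-- Integrating over the triangle `t < s` in either order. -/
theorem lintegral_mul_measure_Ioi_eq (ν : Measure ℝ) [SFinite ν] {f : ℝ → ℝ≥0∞}
    (hf : Measurable f) :
    ∫⁻ t, f t * ν (Ioi t) ∂ν = ∫⁻ s, ∫⁻ t in Iio s, f t ∂ν ∂ν := by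
  have hset : MeasurableSet {p : ℝ × ℝ | p.1 < p.2} := measurableSet_lt measurable_fst measurable_snd
  have hm : Measurable (({p : ℝ × ℝ | p.1 < p.2}).indicator fun p => f p.1) :=
    (hf.comp measurable_fst).indicator hset
  have h := lintegral_lintegral_swap (μ := ν) (ν := ν)
    (f := fun t s => ({p : ℝ × ℝ | p.1 < p.2}).indicator (fun p => f p.1) (t, s)) hm.aemeasurable
  have e1 : ∀ t, ∫⁻ s, ({p : ℝ × ℝ | p.1 < p.2}).indicator (fun p => f p.1) (t, s) ∂ν
      = f t * ν (Ioi t) := by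
    intro t
    rw [← lintegral_indicator_const measurableSet_Ioi]
    rfl
  have e2 : ∀ s, ∫⁻ t, ({p : ℝ × ℝ | p.1 < p.2}).indicator (fun p => f p.1) (t, s) ∂ν
      = ∫⁻ t in Iio s, f t ∂ν := by
    intro s
    rw [← lintegral_indicator measurableSet_Iio]
    rfl
  simpa only [e1, e2] using h

/-- The iterated integrals `aₙ₊₁(x) = ∫_{t < x} aₙ(t) dμ(t)`, `a₀ = 1`. -/
noncomputable def iterVolterra (μ : Measure ℝ) : ℕ → ℝ → ℝ≥0∞
  | 0 => fun _ => 1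
  | n + 1 => fun x => ∫⁻ t in Iio x, iterVolterra μ n t ∂μ

theorem iterVolterra_measurable (μ : Measure ℝ) (n : ℕ) : Measurable (iterVolterra μ n) := by
  cases n with
  | zero => exact measurable_const
  | succ n =>
    exact Monotone.measurable fun x y h => lintegral_mono_set (Iio_subset_Iio h)

/-- By Fubini, aₙ₊₂(x) is the integral of aₙ(t) μ((t,x)) over t < x, while induction bounds
(n+1)aₙ₊₁(t) by aₙ(t) μ((-∞,t)). The two masses add up to at most μ((-∞,x)). The atom at t is
dropped, which is why atoms do not spoil the factorial. -/
theorem succ_mul_iterVolterra_le (μ : Measure ℝ) [SFinite μ] (n : ℕ) (x : ℝ) :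
    (n + 1) * iterVolterra μ (n + 1) x ≤ iterVolterra μ n x * μ (Iio x) := by
  induction n generalizing x with
  | zero => simp [iterVolterra]
  | succ n ih =>
    have hm := iterVolterra_measurable μ n
    have hsw := lintegral_mul_measure_Ioi_eq (μ.restrict (Iio x)) hm
    have e1 : ∫⁻ s, ∫⁻ t in Iio s, iterVolterra μ n t ∂(μ.restrict (Iio x)) ∂(μ.restrict (Iio x))
        = iterVolterra μ (n + 2) x := by
      refine setLIntegral_congr_fun measurableSet_Iio fun s hs => ?_
      simp only [mem_Iio] at hs
      simp only [iterVolterra]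
      rw [Measure.restrict_restrict measurableSet_Iio, Iio_inter_Iio, min_eq_left hs.le]
    rw [e1] at hsw
    calc ((n + 1 : ℕ) + 1) * iterVolterra μ (n + 1 + 1) x
        = (∫⁻ t in Iio x, (n + 1) * iterVolterra μ (n + 1) t ∂μ) + iterVolterra μ (n + 2) x := by
          rw [lintegral_const_mul _ (iterVolterra_measurable μ (n + 1))]
          change _ = (n + 1) * iterVolterra μ (n + 2) x + _
          push_cast
          ring
      _ ≤ (∫⁻ t in Iio x, iterVolterra μ n t * μ (Iio t) ∂μ)
          + ∫⁻ t in Iio x, iterVolterra μ n t * (μ.restrict (Iio x)) (Ioi t) ∂μ := by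
          rw [hsw]
          exact add_le_add_left (lintegral_mono fun t => ih t) _
      _ ≤ ∫⁻ t in Iio x, iterVolterra μ n t * μ (Iio t)
          + iterVolterra μ n t * (μ.restrict (Iio x)) (Ioi t) ∂μ := le_lintegral_add _ _
      _ ≤ ∫⁻ t in Iio x, iterVolterra μ n t * μ (Iio x) ∂μ := by
          refine setLIntegral_mono' measurableSet_Iio fun t ht => ?_
          rw [← mul_add, Measure.restrict_apply measurableSet_Ioi]
          gcongr
          rw [← measure_union _ (measurableSet_Ioi.inter measurableSet_Iio)]
          · refine measure_mono (union_subset (Iio_subset_Iio (le_of_lt ht)) inter_subset_right)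
          · rw [Set.disjoint_left]
            intro s hs hs'
            exact lt_asymm (mem_Iio.1 hs) (mem_Ioi.1 hs'.1)
      _ = iterVolterra μ (n + 1) x * μ (Iio x) := lintegral_mul_const _ hm

theorem factorial_mul_iterVolterra_le (μ : Measure ℝ) [SFinite μ] (n : ℕ) (x : ℝ) :
    (n.factorial : ℝ≥0∞) * iterVolterra μ n x ≤ μ (Iio x) ^ n := by
  induction n with
  | zero => simp [iterVolterra]
  | succ n ih =>
    calc ((n + 1).factorial : ℝ≥0∞) * iterVolterra μ (n + 1) x
        = n.factorial * ((n + 1) * iterVolterra μ (n + 1) x) := by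
          rw [Nat.factorial_succ]; push_cast; ring
      _ ≤ n.factorial * (iterVolterra μ n x * μ (Iio x)) := by
          exact mul_le_mul_right (succ_mul_iterVolterra_le μ n x) _
      _ = (n.factorial * iterVolterra μ n x) * μ (Iio x) := by ring
      _ ≤ μ (Iio x) ^ n * μ (Iio x) := by gcongr
      _ = _ := (pow_succ _ _).symm

theorem iterVolterra_toReal_le (μ : Measure ℝ) [IsFiniteMeasure μ] (n : ℕ) (x : ℝ) :
    iterVolterra μ n x ≤ ENNReal.ofReal (μ.real univ ^ n / n.factorial) := by
  have h := factorial_mul_iterVolterra_le μ n x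
  have hf : (n.factorial : ℝ≥0∞) ≠ 0 := by exact_mod_cast n.factorial_ne_zero
  have h2 : iterVolterra μ n x ≤ μ univ ^ n / n.factorial := by
    rw [ENNReal.le_div_iff_mul_le (Or.inl hf) (Or.inl (ENNReal.natCast_ne_top _)), mul_comm]
    exact h.trans (by gcongr; exact subset_univ _)
  refine h2.trans_eq ?_
  rw [ENNReal.ofReal_div_of_pos (by positivity), ENNReal.ofReal_pow measureReal_nonneg,
    ofReal_measureReal, ENNReal.ofReal_natCast]

end Volterra

/-! ### Volterra equations solved by the Picard series -/

section Picard

variable {E : Type*} [NormedAddCommGroup E] [NormedSpace ℝ E]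

theorem stronglyMeasurable_integral_Iio (μ : Measure ℝ) [SFinite μ] {g : ℝ → E}
    (hg : StronglyMeasurable g) : StronglyMeasurable fun x => ∫ t in Iio x, g t ∂μ := by
  have hset : MeasurableSet {p : ℝ × ℝ | p.2 < p.1} := measurableSet_lt measurable_snd measurable_fst
  have hm : StronglyMeasurable (Function.uncurry fun x t : ℝ =>
      ({p : ℝ × ℝ | p.2 < p.1}).indicator (fun p => g p.2) (x, t)) :=
    (hg.comp_measurable measurable_snd).indicator hset
  have h := hm.integral_prod_right (ν := μ)
  convert h using 2 with x
  rw [← integral_indicator measurableSet_Iio]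
  rfl

/-- The terms of the Picard series of `u(x) = c + ∫_{t < x} T(t) u(t) dμ(t)`. -/
noncomputable def picardTerm (μ : Measure ℝ) (T : ℝ → E →L[ℝ] E) (c : E) : ℕ → ℝ → E
  | 0 => fun _ => c
  | n + 1 => fun x => ∫ t in Iio x, T t (picardTerm μ T c n t) ∂μ

variable {μ : Measure ℝ} {T : ℝ → E →L[ℝ] E} {c : E} {C : NNReal}

theorem enorm_picardTerm_le (hT : ∀ t z, ‖T t z‖ ≤ C * ‖z‖) (n : ℕ) (x : ℝ) :
    ‖picardTerm μ T c n x‖ₑ ≤ ‖c‖ₑ * (C : ENNReal) ^ n * iterVolterra μ n x := by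
  induction n generalizing x with
  | zero => simp [picardTerm, iterVolterra]
  | succ n ih =>
    have hT' : ∀ t z, ‖T t z‖ₑ ≤ (C : ENNReal) * ‖z‖ₑ := fun t z => by
      have := hT t z
      simp only [enorm_eq_nnnorm]
      exact_mod_cast this
    calc ‖picardTerm μ T c (n + 1) x‖ₑ
        ≤ ∫⁻ t in Iio x, ‖T t (picardTerm μ T c n t)‖ₑ ∂μ := enorm_integral_le_lintegral_enorm _
      _ ≤ ∫⁻ t in Iio x, (‖c‖ₑ * (C : ENNReal) ^ (n + 1)) * iterVolterra μ n t ∂μ := by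
          refine lintegral_mono fun t => (hT' _ _).trans ?_
          calc (C : ENNReal) * ‖picardTerm μ T c n t‖ₑ
              ≤ C * (‖c‖ₑ * (C : ENNReal) ^ n * iterVolterra μ n t) := mul_le_mul_right (ih t) _
            _ = _ := by ring
      _ = _ := lintegral_const_mul _ (iterVolterra_measurable μ n)

theorem norm_picardTerm_le [IsFiniteMeasure μ] (hT : ∀ t z, ‖T t z‖ ≤ C * ‖z‖) (n : ℕ) (x : ℝ) :
    ‖picardTerm μ T c n x‖ ≤ ‖c‖ * ((C * μ.real univ) ^ n / n.factorial) := by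
  have h := (enorm_picardTerm_le (c := c) hT n x).trans
    (mul_le_mul_right (iterVolterra_toReal_le μ n x) _)
  have e : ‖c‖ₑ * (C : ENNReal) ^ n * ENNReal.ofReal (μ.real univ ^ n / n.factorial)
      = ENNReal.ofReal (‖c‖ * ((C * μ.real univ) ^ n / n.factorial)) := by
    rw [← ofReal_norm, ← ENNReal.ofReal_coe_nnreal, ← ENNReal.ofReal_pow NNReal.zero_le_coe,
      ← ENNReal.ofReal_mul (norm_nonneg _), ← ENNReal.ofReal_mul (by positivity)]
    congr 1
    rw [mul_pow]
    ring
  rw [e, ← ofReal_norm] at h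
  exact (ENNReal.ofReal_le_ofReal_iff (by positivity)).1 h

/-- Linear Volterra integral equations with respect to a finite measure on the line have bounded
measurable solutions. -/
theorem exists_volterra_solution [CompleteSpace E] [IsFiniteMeasure μ]
    (hT : ∀ t z, ‖T t z‖ ≤ C * ‖z‖)
    (hTm : ∀ g : ℝ → E, StronglyMeasurable g → StronglyMeasurable fun t => T t (g t)) (c : E) :
    ∃ v : ℝ → E, StronglyMeasurable v ∧ (∃ K, ∀ x, ‖v x‖ ≤ K) ∧
      ∀ x, v x = c + ∫ t in Iio x, T t (v t) ∂μ := by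
  set b : ℕ → ℝ := fun n => ‖c‖ * ((C * μ.real univ) ^ n / n.factorial) with hb
  have hbs : Summable b := (Real.summable_pow_div_factorial _).mul_left _
  have hle : ∀ n x, ‖picardTerm μ T c n x‖ ≤ b n := fun n x => norm_picardTerm_le hT n x
  have hm : ∀ n, StronglyMeasurable (picardTerm μ T c n) := by
    intro n
    induction n with
    | zero => exact stronglyMeasurable_const
    | succ n ih => exact stronglyMeasurable_integral_Iio μ (hTm _ ih)
  have hsum : ∀ x, Summable fun n => picardTerm μ T c n x := fun x =>
    Summable.of_norm_bounded hbs fun n => hle n x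
  refine ⟨fun x => ∑' n, picardTerm μ T c n x, ?_, ⟨∑' n, b n, fun x => ?_⟩, fun x => ?_⟩
  · exact stronglyMeasurable_of_tendsto (f := fun (s : Finset ℕ) x => ∑ n ∈ s, picardTerm μ T c n x)
      atTop (fun s => Finset.stronglyMeasurable_fun_sum s fun n _ => hm n)
      (tendsto_pi_nhds.2 fun x => (hsum x).hasSum)
  · exact tsum_of_norm_bounded hbs.hasSum fun n => hle n x
  · have hint : ∀ n, Integrable (fun t => T t (picardTerm μ T c n t)) (μ.restrict (Iio x)) :=
      fun n => Integrable.of_bound (hTm _ (hm n)).aestronglyMeasurable (C * b n)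
        (ae_of_all _ fun t => (hT _ _).trans (by gcongr; exact hle n t))
    have hs : Summable fun n => ∫ t in Iio x, ‖T t (picardTerm μ T c n t)‖ ∂μ := by
      refine Summable.of_nonneg_of_le (fun n => integral_nonneg fun t => norm_nonneg _) (fun n => ?_)
        ((hbs.mul_left (C : ℝ)).mul_right ((μ.restrict (Iio x)).real univ))
      calc ∫ t in Iio x, ‖T t (picardTerm μ T c n t)‖ ∂μ ≤ ∫ t in Iio x, C * b n ∂μ :=
            integral_mono (hint n).norm (integrable_const _)
              fun t => (hT _ _).trans (by gcongr; exact hle n t)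
        _ = _ := by rw [integral_const, smul_eq_mul, mul_comm]
    have h1 := hasSum_integral_of_summable_integral_norm hint hs
    have h2 : ∀ t, T t (∑' n, picardTerm μ T c n t) = ∑' n, T t (picardTerm μ T c n t) :=
      fun t => (T t).map_tsum (hsum t)
    simp only [h2]
    rw [← h1.tsum_eq, (hsum x).tsum_eq_zero_add]
    rfl

end Picard

/-! ### Product rule for integrals against a measure with atoms -/

section ProductRule

/-- Integrating a product over the triangle `t < s` in either order. -/
theorem integral_mul_integral_Ioi_eq (μ ν : Measure ℝ) [SFinite μ] [SFinite ν] {g h : ℝ → ℂ}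
    (hg : Integrable g μ) (hh : Integrable h ν) :
    Integrable (fun t => g t * ∫ s in Ioi t, h s ∂ν) μ ∧
    Integrable (fun s => (∫ t in Iio s, g t ∂μ) * h s) ν ∧
    ∫ t, g t * ∫ s in Ioi t, h s ∂ν ∂μ = ∫ s, (∫ t in Iio s, g t ∂μ) * h s ∂ν := by
  have hset : MeasurableSet {p : ℝ × ℝ | p.1 < p.2} := measurableSet_lt measurable_fst measurable_snd
  have hi : Integrable (Function.uncurry fun t s : ℝ =>
      ({p : ℝ × ℝ | p.1 < p.2}).indicator (fun p => g p.1 * h p.2) (t, s)) (μ.prod ν) :=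
    (hg.mul_prod hh).indicator hset
  have e1 : ∀ t, ∫ s, ({p : ℝ × ℝ | p.1 < p.2}).indicator (fun p => g p.1 * h p.2) (t, s) ∂ν
      = g t * ∫ s in Ioi t, h s ∂ν := by
    intro t
    rw [← integral_const_mul, ← integral_indicator measurableSet_Ioi]
    rfl
  have e2 : ∀ s, ∫ t, ({p : ℝ × ℝ | p.1 < p.2}).indicator (fun p => g p.1 * h p.2) (t, s) ∂μ
      = (∫ t in Iio s, g t ∂μ) * h s := by
    intro s
    rw [← integral_mul_const, ← integral_indicator measurableSet_Iio]
    rfl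
  refine ⟨?_, ?_, ?_⟩
  · simpa only [Function.uncurry_apply_pair, e1] using hi.integral_prod_left
  · simpa only [Function.uncurry_apply_pair, e2] using hi.integral_prod_right
  · simpa only [e1, e2] using integral_integral_swap hi

theorem integral_eq_Iio_add_singleton_add_Ioi (ν : Measure ℝ) {h : ℝ → ℂ}
    (hh : Integrable h ν) (t : ℝ) :
    ∫ s, h s ∂ν = (∫ s in Iio t, h s ∂ν) + ν.real {t} * h t + ∫ s in Ioi t, h s ∂ν := by
  have h1 : Iic t = Iio t ∪ {t} := by ext; simp [le_iff_lt_or_eq]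
  rw [← intervalIntegral.integral_Iic_add_Ioi (b := t) hh.integrableOn hh.integrableOn, h1,
    setIntegral_union (by simp) (measurableSet_singleton t) hh.integrableOn hh.integrableOn,
    integral_singleton, Complex.real_smul]

/-- The product rule `∫dF ∫dG = ∫ (dF) G + F (dG)` with balanced values of `F` and `G` at atoms. -/
theorem integral_mul_integral_eq (ν : Measure ℝ) [SFinite ν] {g h : ℝ → ℂ}
    (hg : Integrable g ν) (hh : Integrable h ν) :
    (∫ t, g t ∂ν) * (∫ t, h t ∂ν) =
      ∫ t, (g t * ((∫ s in Iio t, h s ∂ν) + ν.real {t} / 2 * h t)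
        + ((∫ s in Iio t, g s ∂ν) + ν.real {t} / 2 * g t) * h t) ∂ν := by
  obtain ⟨i1, i2, e1⟩ := integral_mul_integral_Ioi_eq ν ν hg hh
  -- The two half-atoms add up to one full atom, which completes the integral of h over (-∞,t) to
  -- its total minus the integral over (t,∞). Fubini then cancels the two remaining triangle
  -- integrals.
  have key : ∀ t, g t * ((∫ s in Iio t, h s ∂ν) + ν.real {t} / 2 * h t)
        + ((∫ s in Iio t, g s ∂ν) + ν.real {t} / 2 * g t) * h t
      = (g t * ∫ s, h s ∂ν) - (g t * ∫ s in Ioi t, h s ∂ν) + (∫ s in Iio t, g s ∂ν) * h t := by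
    intro t
    rw [integral_eq_Iio_add_singleton_add_Ioi ν hh t]
    ring
  simp only [key]
  rw [integral_add (f := fun t => (g t * ∫ s, h s ∂ν) - (g t * ∫ s in Ioi t, h s ∂ν))
      ((hg.mul_const _).sub i1) i2, integral_sub (hg.mul_const _) i1, e1,
    integral_mul_const]
  ring

end ProductRule

/-! ### Smooth step functions and left limits -/

section StepTest

open Real (smoothTransition)

theorem deriv_smoothTransition_eq_zero {s : ℝ} (hs : s ∉ Icc (0 : ℝ) 1) :
    deriv smoothTransition s = 0 := by
  rw [mem_Icc, not_and_or, not_le, not_le] at hs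
  rcases hs with hs | hs
  · have : smoothTransition =ᶠ[𝓝 s] fun _ => 0 := by
      filter_upwards [Iio_mem_nhds hs] with t ht
      exact smoothTransition.zero_of_nonpos (le_of_lt ht)
    rw [this.deriv_eq, deriv_const]
  · have : smoothTransition =ᶠ[𝓝 s] fun _ => 1 := by
      filter_upwards [Ioi_mem_nhds hs] with t ht
      exact smoothTransition.one_of_one_le (le_of_lt ht)
    rw [this.deriv_eq, deriv_const]

theorem contDiff_smoothTransition_top : ContDiff ℝ (⊤ : ℕ∞) smoothTransition :=
  smoothTransition.contDiff

theorem differentiable_smoothTransition : Differentiable ℝ smoothTransition :=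
  contDiff_smoothTransition_top.differentiable (by simp)

theorem continuous_deriv_smoothTransition : Continuous (deriv smoothTransition) :=
  contDiff_smoothTransition_top.continuous_deriv (by simp)

theorem integral_deriv_smoothTransition : ∫ s, deriv smoothTransition s = 1 := by
  have h1 : ∫ s, deriv smoothTransition s = ∫ s in Icc 0 1, deriv smoothTransition s :=
    (setIntegral_eq_integral_of_forall_compl_eq_zero
      fun s hs => deriv_smoothTransition_eq_zero hs).symm
  rw [h1, integral_Icc_eq_integral_Ioc, ← intervalIntegral.integral_of_le zero_le_one,
    intervalIntegral.integral_deriv_eq_sub (fun s _ => differentiable_smoothTransition s)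
      (continuous_deriv_smoothTransition.intervalIntegrable _ _)]
  simp

/-- A smooth approximation of the indicator function of `[x, y)`. -/
noncomputable def stepTest (n : ℕ) (x y t : ℝ) : ℝ :=
  smoothTransition ((n + 1) * (t - x) + 1) - smoothTransition ((n + 1) * (t - y) + 1)

theorem contDiff_stepTest (n : ℕ) (x y : ℝ) : ContDiff ℝ (⊤ : ℕ∞) (stepTest n x y) := by
  unfold stepTest
  exact (contDiff_smoothTransition_top.comp (by fun_prop)).sub
    (contDiff_smoothTransition_top.comp (by fun_prop))

theorem stepTest_nonneg (n : ℕ) {x y : ℝ} (h : x ≤ y) (t : ℝ) : 0 ≤ stepTest n x y t :=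
  sub_nonneg.2 (smoothTransition.monotone (by gcongr))

theorem stepTest_le_one (n : ℕ) (x y t : ℝ) : stepTest n x y t ≤ 1 := by
  unfold stepTest
  linarith [smoothTransition.le_one ((n + 1) * (t - x) + 1),
    smoothTransition.nonneg ((n + 1) * (t - y) + 1)]

theorem stepTest_eq_zero (n : ℕ) {x y t : ℝ} (h : x ≤ y) (ht : t ∉ Icc (x - 1) y) :
    stepTest n x y t = 0 := by
  have hn : (0 : ℝ) ≤ n := n.cast_nonneg
  rw [mem_Icc, not_and_or, not_le, not_le] at ht
  unfold stepTest
  rcases ht with ht | ht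
  · rw [smoothTransition.zero_of_nonpos (by nlinarith),
      smoothTransition.zero_of_nonpos (by nlinarith), sub_zero]
  · rw [smoothTransition.one_of_one_le (by nlinarith),
      smoothTransition.one_of_one_le (by nlinarith), sub_self]

theorem isTestFunction_stepTest (n : ℕ) {x y : ℝ} (h : x ≤ y) : IsTestFunction (stepTest n x y) :=
  ⟨contDiff_stepTest n x y, HasCompactSupport.intro isCompact_Icc fun _ ht => stepTest_eq_zero n h ht⟩

theorem isTestFunction_ofReal {φ : ℝ → ℝ} (h : IsTestFunction φ) :
    IsTestFunction fun t => (φ t : ℂ) :=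
  ⟨Complex.ofRealCLM.contDiff.comp h.1, h.2.comp_left Complex.ofReal_zero⟩

/-- The transition takes place on [x - 1/(n+1), x] and is complete at x itself. This one-sided
choice makes half-open intervals [x,y) and left limits appear throughout. -/
theorem tendsto_smoothTransition_step (x t : ℝ) :
    Tendsto (fun n : ℕ => smoothTransition ((n + 1) * (t - x) + 1)) atTop
      (𝓝 (if x ≤ t then 1 else 0)) := by
  split_ifs with h
  · refine tendsto_const_nhds.congr fun n => (smoothTransition.one_of_one_le ?_).symm
    have : (0 : ℝ) ≤ (n + 1) * (t - x) := mul_nonneg (by positivity) (by linarith)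
    linarith
  · push Not at h
    have h1 : Tendsto (fun n : ℕ => ((n : ℝ) + 1) * (x - t)) atTop atTop :=
      (tendsto_atTop_add_const_right _ _ tendsto_natCast_atTop_atTop).atTop_mul_const (by linarith)
    refine tendsto_const_nhds.congr' ?_
    filter_upwards [h1.eventually_ge_atTop 1] with n hn
    exact (smoothTransition.zero_of_nonpos (by linarith)).symm

theorem tendsto_stepTest {x y : ℝ} (h : x ≤ y) (t : ℝ) :
    Tendsto (fun n => stepTest n x y t) atTop (𝓝 ((Ico x y).indicator 1 t)) := by
  have := (tendsto_smoothTransition_step x t).sub (tendsto_smoothTransition_step y t)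
  convert this using 1
  congr 1
  by_cases h1 : x ≤ t <;> by_cases h2 : y ≤ t <;> simp [indicator, h1, h2]
  linarith

theorem tendsto_integral_stepTest (μ : Measure ℝ) {x y : ℝ} (h : x ≤ y) {f : ℝ → ℂ}
    (hf : IntegrableOn f (Icc (x - 1) y) μ) :
    Tendsto (fun n => ∫ t, f t * (stepTest n x y t : ℂ) ∂μ) atTop (𝓝 (∫ t in Ico x y, f t ∂μ)) := by
  have e1 : ∀ n, ∫ t, f t * (stepTest n x y t : ℂ) ∂μ
      = ∫ t in Icc (x - 1) y, f t * (stepTest n x y t : ℂ) ∂μ := fun n =>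
    (setIntegral_eq_integral_of_forall_compl_eq_zero fun t ht => by
      rw [stepTest_eq_zero n h ht]; simp).symm
  have e2 : ∫ t in Ico x y, f t ∂μ
      = ∫ t in Icc (x - 1) y, f t * ((Ico x y).indicator 1 t : ℝ) ∂μ := by
    conv_lhs => rw [← inter_eq_right.2 (show Ico x y ⊆ Icc (x - 1) y from
      fun t ht => ⟨by linarith [ht.1], ht.2.le⟩), ← setIntegral_indicator measurableSet_Ico]
    refine integral_congr_ae (ae_of_all _ fun t => ?_)
    by_cases ht : t ∈ Ico x y <;> simp [ht]
  simp only [e1, e2]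
  refine tendsto_integral_of_dominated_convergence (fun t => ‖f t‖) (fun n => ?_) hf.norm
    (fun n => ae_of_all _ fun t => ?_) (ae_of_all _ fun t => ?_)
  · exact hf.1.mul (Complex.continuous_ofReal.comp
      (contDiff_stepTest n x y).continuous).aestronglyMeasurable
  · rw [norm_mul, Complex.norm_real, Real.norm_of_nonneg (stepTest_nonneg n h t)]
    exact mul_le_of_le_one_right (norm_nonneg _) (stepTest_le_one n x y t)
  · exact tendsto_const_nhds.mul
      ((Complex.continuous_ofReal.tendsto _).comp (tendsto_stepTest h t))

theorem integral_mul_scaled_deriv_eq (g : ℝ → ℂ) (n : ℕ) (x : ℝ) :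
    ∫ t, g t * (((n + 1) * deriv smoothTransition ((n + 1) * (t - x) + 1) : ℝ) : ℂ)
      = ∫ s, g (x + (s - 1) / (n + 1)) * ((deriv smoothTransition s : ℝ) : ℂ) := by
  have hn : (0 : ℝ) < n + 1 := by positivity
  set G : ℝ → ℂ := fun s => g (x + (s - 1) / (n + 1)) * ((deriv smoothTransition s : ℝ) : ℂ) with hG
  have e : ∀ t, g t * (((n + 1) * deriv smoothTransition ((n + 1) * (t - x) + 1) : ℝ) : ℂ)
      = ((n : ℂ) + 1) * G ((n + 1) * (t - x) + 1) := by
    intro t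
    have : x + ((n + 1) * (t - x) + 1 - 1) / ((n : ℝ) + 1) = t := by field_simp; ring
    simp only [hG, this]
    push_cast
    ring
  simp only [e]
  rw [integral_const_mul, integral_sub_right_eq_self (fun t => G ((n + 1) * t + 1)) x,
    Measure.integral_comp_mul_left (fun t => G (t + 1)), integral_add_right_eq_self G 1,
    abs_of_pos (inv_pos.2 hn), Complex.real_smul, ← mul_assoc]
  push_cast
  rw [mul_inv_cancel₀, one_mul]
  exact_mod_cast hn.ne'

/-- After rescaling, g is evaluated at x + (s-1)/(n+1) against a fixed density supported in 0 ≤ s ≤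
1. For s < 1 these points tend to x strictly from the left, and s = 1 is a null set, so the value of
g at x plays no role. -/
theorem tendsto_integral_mul_scaled_deriv {g : ℝ → ℂ} (hg : Measurable g) {x K : ℝ} {L : ℂ}
    (hK : ∀ t ∈ Icc (x - 1) x, ‖g t‖ ≤ K) (hL : Tendsto g (𝓝[<] x) (𝓝 L)) :
    Tendsto (fun n : ℕ =>
        ∫ t, g t * (((n + 1) * deriv smoothTransition ((n + 1) * (t - x) + 1) : ℝ) : ℂ))
      atTop (𝓝 L) := by
  have hcd := continuous_deriv_smoothTransition
  simp only [integral_mul_scaled_deriv_eq]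
  have hlim : L = ∫ s, L * ((deriv smoothTransition s : ℝ) : ℂ) := by
    rw [integral_const_mul, integral_complex_ofReal, integral_deriv_smoothTransition]; simp
  rw [hlim]
  refine tendsto_integral_of_dominated_convergence (fun s => K * ‖deriv smoothTransition s‖)
    (fun n => ?_) ?_ (fun n => ae_of_all _ fun s => ?_) ?_
  · exact ((hg.comp (by fun_prop)).mul
      (Complex.continuous_ofReal.measurable.comp hcd.measurable)).aestronglyMeasurable
  · refine ((hcd.integrable_of_hasCompactSupport ?_).norm).const_mul K
    exact HasCompactSupport.intro isCompact_Icc fun s hs => deriv_smoothTransition_eq_zero hs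
  · by_cases hs : s ∈ Icc (0 : ℝ) 1
    · rw [norm_mul, Complex.norm_real]
      refine mul_le_mul_of_nonneg_right (hK _ ⟨?_, ?_⟩) (norm_nonneg _)
      · have : -1 ≤ (s - 1) / ((n : ℝ) + 1) := by
          rw [le_div_iff₀ (by positivity)]
          nlinarith [hs.1, (n.cast_nonneg : (0 : ℝ) ≤ n)]
        linarith
      · have : (s - 1) / ((n : ℝ) + 1) ≤ 0 :=
          div_nonpos_of_nonpos_of_nonneg (by linarith [hs.2]) (by positivity)
        linarith
    · simp [deriv_smoothTransition_eq_zero hs]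
  · have h1 : ∀ᵐ s : ℝ, s ≠ 1 := by simp [ae_iff, measure_singleton]
    filter_upwards [h1] with s hs
    rcases lt_or_gt_of_ne hs with hs | hs
    · refine Tendsto.mul_const _ (hL.comp (tendsto_nhdsWithin_iff.2 ⟨?_, Eventually.of_forall fun n => ?_⟩))
      · have : Tendsto (fun n : ℕ => (s - 1) / ((n : ℝ) + 1)) atTop (𝓝 0) :=
          tendsto_const_nhds.div_atTop
            (tendsto_atTop_add_const_right _ _ tendsto_natCast_atTop_atTop)
        simpa using this.const_add x
      · have : (s - 1) / ((n : ℝ) + 1) < 0 := div_neg_of_neg_of_pos (by linarith) (by positivity)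
        simp only [mem_Iio]
        linarith
    · simp [deriv_smoothTransition_eq_zero (s := s) (fun h => by linarith [h.2])]

theorem deriv_stepTest (n : ℕ) (x y t : ℝ) :
    deriv (fun t => (stepTest n x y t : ℂ)) t
      = (((n + 1) * deriv smoothTransition ((n + 1) * (t - x) + 1) : ℝ) : ℂ)
        - (((n + 1) * deriv smoothTransition ((n + 1) * (t - y) + 1) : ℝ) : ℂ) := by
  have h : ∀ z, HasDerivAt (fun t => smoothTransition ((n + 1) * (t - z) + 1))
      ((n + 1) * deriv smoothTransition ((n + 1) * (t - z) + 1)) t := by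
    intro z
    have h1 : HasDerivAt (fun t : ℝ => (n + 1) * (t - z) + 1) ((n : ℝ) + 1) t := by
      simpa using (((hasDerivAt_id t).sub_const z).const_mul ((n : ℝ) + 1)).add_const 1
    have h2 := (differentiable_smoothTransition ((n + 1) * (t - z) + 1)).hasDerivAt.comp t h1
    rw [mul_comm] at h2
    exact h2
  have := ((h x).sub (h y)).ofReal_comp.deriv
  rw [← Complex.ofReal_sub]
  exact this

theorem integrable_mul_scaled_deriv {g : ℝ → ℂ} (hg : Measurable g) {x K : ℝ}
    (hK : ∀ t ∈ Icc (x - 1) x, ‖g t‖ ≤ K) (n : ℕ) :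
    Integrable fun t => g t * (((n + 1) * deriv smoothTransition ((n + 1) * (t - x) + 1) : ℝ) : ℂ) := by
  have hcd := continuous_deriv_smoothTransition
  have hc : Continuous fun t : ℝ =>
      (((n + 1) * deriv smoothTransition ((n + 1) * (t - x) + 1) : ℝ) : ℂ) := by fun_prop
  have hz : ∀ t ∉ Icc (x - 1) x,
      (((n + 1) * deriv smoothTransition ((n + 1) * (t - x) + 1) : ℝ) : ℂ) = 0 := by
    intro t ht
    have hn : (0 : ℝ) ≤ n := n.cast_nonneg
    rw [deriv_smoothTransition_eq_zero, mul_zero, Complex.ofReal_zero]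
    rintro ⟨h1, h2⟩
    refine ht ⟨?_, ?_⟩
    · by_contra! h
      nlinarith
    · by_contra! h
      nlinarith
  have hi : Integrable fun t : ℝ =>
      (((n + 1) * deriv smoothTransition ((n + 1) * (t - x) + 1) : ℝ) : ℂ) :=
    hc.integrable_of_hasCompactSupport (HasCompactSupport.intro isCompact_Icc hz)
  refine (hi.norm.const_mul K).mono' (hg.mul hc.measurable).aestronglyMeasurable
    (ae_of_all _ fun t => ?_)
  rw [norm_mul]
  by_cases ht : t ∈ Icc (x - 1) x
  · exact mul_le_mul_of_nonneg_right (hK t ht) (norm_nonneg _)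
  · simp [hz t ht]

/-- The pairing of a distributional derivative with the step functions gives increments of
left limits. -/
theorem tendsto_neg_integral_mul_deriv_stepTest {g : ℝ → ℂ} (hg : Measurable g)
    (hK : ∀ a b, ∃ K, ∀ t ∈ Icc a b, ‖g t‖ ≤ K) {x y : ℝ} {Lx Ly : ℂ}
    (hx : Tendsto g (𝓝[<] x) (𝓝 Lx)) (hy : Tendsto g (𝓝[<] y) (𝓝 Ly)) :
    Tendsto (fun n => -∫ t, g t * deriv (fun t => (stepTest n x y t : ℂ)) t) atTop
      (𝓝 (Ly - Lx)) := by
  obtain ⟨Kx, hKx⟩ := hK (x - 1) x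
  obtain ⟨Ky, hKy⟩ := hK (y - 1) y
  refine ((tendsto_integral_mul_scaled_deriv hg hKy hy).sub
    (tendsto_integral_mul_scaled_deriv hg hKx hx)).congr fun n => ?_
  have e : ∀ t, g t * deriv (fun t => (stepTest n x y t : ℂ)) t
      = g t * (((n + 1) * deriv smoothTransition ((n + 1) * (t - x) + 1) : ℝ) : ℂ)
        - g t * (((n + 1) * deriv smoothTransition ((n + 1) * (t - y) + 1) : ℝ) : ℂ) := fun t => by
    rw [deriv_stepTest, mul_sub]
  simp_rw [e]
  rw [integral_sub (integrable_mul_scaled_deriv hg hKx n) (integrable_mul_scaled_deriv hg hKy n)]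
  ring

end StepTest

/-! ### The integrated equation on an interval -/

/-- Measurable bounded trace-free coefficients. -/
structure IsTracelessCoeff (A : ℝ → Matrix (Fin 2) (Fin 2) ℂ) : Prop where
  meas : ∀ i j, Measurable fun t => A t i j
  bdd : ∃ C, ∀ t i j, ‖A t i j‖ ≤ C
  trace : ∀ t, A t 0 0 + A t 1 1 = 0

/-- `u` is a solution of `u' = A μ u` on `[a, b)` in integrated form; `v` is the left-continuous
version of the balanced function `u`. -/
structure IntSolOn (μ : Measure ℝ) (A : ℝ → Matrix (Fin 2) (Fin 2) ℂ) (a b : ℝ)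
    (u v : ℝ → Fin 2 → ℂ) : Prop where
  meas : Measurable u
  bdd : ∃ K, ∀ t ∈ Ico a b, ‖u t‖ ≤ K
  eq : ∀ x y, a ≤ x → x ≤ y → y ≤ b → ∀ i, v y i - v x i = ∫ t in Ico x y, (A t *ᵥ u t) i ∂μ
  bal : ∀ x ∈ Ico a b, ∀ i, u x i = v x i + μ.real {x} / 2 * (A x *ᵥ u x) i

/-- The Wronskian. -/
def wronskian (v w : Fin 2 → ℂ) : ℂ := v 0 * w 1 - v 1 * w 0

variable {μ : Measure ℝ} {A A' : ℝ → Matrix (Fin 2) (Fin 2) ℂ} {a b : ℝ}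
  {u v u' v' : ℝ → Fin 2 → ℂ}

theorem measurable_mulVec (hA : ∀ i j, Measurable fun t => A t i j) (hu : Measurable u) (i : Fin 2) :
    Measurable fun t => (A t *ᵥ u t) i := by
  simp only [Matrix.mulVec, dotProduct]
  exact Finset.measurable_sum _ fun j _ => (hA i j).mul (measurable_pi_iff.1 hu j)

theorem norm_mulVec_le {M : Matrix (Fin 2) (Fin 2) ℂ} {C : ℝ} (hC : ∀ i j, ‖M i j‖ ≤ C)
    (z : Fin 2 → ℂ) (i : Fin 2) : ‖(M *ᵥ z) i‖ ≤ 2 * C * ‖z‖ := by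
  simp only [Matrix.mulVec, dotProduct, Fin.sum_univ_two]
  have h0 := mul_le_mul (hC i 0) (norm_le_pi_norm z 0) (norm_nonneg _) ((norm_nonneg _).trans (hC i 0))
  have h1 := mul_le_mul (hC i 1) (norm_le_pi_norm z 1) (norm_nonneg _) ((norm_nonneg _).trans (hC i 1))
  have := norm_add_le (M i 0 * z 0) (M i 1 * z 1)
  rw [norm_mul, norm_mul] at this
  linarith

namespace IntSolOn

theorem integrableOn [IsLocallyFiniteMeasure μ] (hA : IsTracelessCoeff A)
    (h : IntSolOn μ A a b u v) (i : Fin 2) :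
    IntegrableOn (fun t => (A t *ᵥ u t) i) (Ico a b) μ := by
  obtain ⟨C, hC⟩ := hA.bdd
  obtain ⟨K, hK⟩ := h.bdd
  have hfin : IsFiniteMeasure (μ.restrict (Ico a b)) :=
    ⟨by rw [Measure.restrict_apply_univ]; exact measure_Ico_lt_top⟩
  refine Integrable.of_bound (measurable_mulVec hA.meas h.meas i).aestronglyMeasurable (2 * C * K) ?_
  refine (ae_restrict_iff' measurableSet_Ico).2 (ae_of_all _ fun t ht => ?_)
  have hC0 : 0 ≤ C := (norm_nonneg _).trans (hC t 0 0)
  exact (norm_mulVec_le (hC t) _ _).trans (by gcongr; exact hK t ht)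

theorem mono (h : IntSolOn μ A a b u v) {a' b' : ℝ} (ha : a ≤ a') (hb : b' ≤ b) :
    IntSolOn μ A a' b' u v where
  meas := h.meas
  bdd := let ⟨K, hK⟩ := h.bdd; ⟨K, fun t ht => hK t ⟨ha.trans ht.1, ht.2.trans_le hb⟩⟩
  eq x y hx hxy hy := h.eq x y (ha.trans hx) hxy (hy.trans hb)
  bal x hx := h.bal x ⟨ha.trans hx.1, hx.2.trans_le hb⟩

theorem congr (h : IntSolOn μ A a b u v) (hm : Measurable u') (hu : ∀ t ∈ Ico a b, u' t = u t)
    (hv : ∀ t ∈ Icc a b, v' t = v t) : IntSolOn μ A a b u' v' where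
  meas := hm
  bdd := let ⟨K, hK⟩ := h.bdd; ⟨K, fun t ht => by rw [hu t ht]; exact hK t ht⟩
  eq x y hx hxy hy i := by
    rw [hv x ⟨hx, hxy.trans hy⟩, hv y ⟨hx.trans hxy, hy⟩, h.eq x y hx hxy hy]
    refine setIntegral_congr_fun measurableSet_Ico fun t ht => ?_
    rw [hu t ⟨hx.trans ht.1, ht.2.trans_le hy⟩]
  bal x hx i := by rw [hu x hx, hv x ⟨hx.1, hx.2.le⟩]; exact h.bal x hx i

theorem lin [IsLocallyFiniteMeasure μ] (hA : IsTracelessCoeff A) (h : IntSolOn μ A a b u v)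
    (h' : IntSolOn μ A a b u' v') (α β : ℂ) :
    IntSolOn μ A a b (fun t => α • u t + β • u' t) (fun t => α • v t + β • v' t) where
  meas := (h.meas.const_smul α).add (h'.meas.const_smul β)
  bdd := by
    obtain ⟨K, hK⟩ := h.bdd
    obtain ⟨K', hK'⟩ := h'.bdd
    refine ⟨‖α‖ * K + ‖β‖ * K', fun t ht => (norm_add_le _ _).trans ?_⟩
    rw [norm_smul, norm_smul]
    gcongr
    · exact hK t ht
    · exact hK' t ht
  eq x y hx hxy hy i := by
    have i1 := (h.integrableOn hA i).mono_set (Ico_subset_Ico hx hy)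
    have i2 := (h'.integrableOn hA i).mono_set (Ico_subset_Ico hx hy)
    simp only [Matrix.mulVec_add, Matrix.mulVec_smul, Pi.add_apply, Pi.smul_apply, smul_eq_mul]
    rw [integral_add (i1.const_mul α) (i2.const_mul β), integral_const_mul, integral_const_mul,
      ← h.eq x y hx hxy hy, ← h'.eq x y hx hxy hy]
    ring
  bal x hx i := by
    simp only [Matrix.mulVec_add, Matrix.mulVec_smul, Pi.add_apply, Pi.smul_apply, smul_eq_mul]
    linear_combination α * h.bal x hx i + β * h'.bal x hx i

/-- The half-atoms in the product rule are exactly the corrections `bal` that turn the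
left-continuous v into the balanced u, so the Leibniz rule holds for increments of v with u in the
integrand. -/
theorem mul_sub_mul_eq [IsLocallyFiniteMeasure μ] (hA : IsTracelessCoeff A)
    (hA' : IsTracelessCoeff A') (hab : a ≤ b) (h : IntSolOn μ A a b u v)
    (h' : IntSolOn μ A' a b u' v') (i j : Fin 2) :
    IntegrableOn (fun t => (A t *ᵥ u t) i * u' t j + u t i * (A' t *ᵥ u' t) j) (Ico a b) μ ∧
    v b i * v' b j - v a i * v' a j
      = ∫ t in Ico a b, ((A t *ᵥ u t) i * u' t j + u t i * (A' t *ᵥ u' t) j) ∂μ := by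
  have i1 := h.integrableOn hA i
  have i2 := h'.integrableOn hA' j
  obtain ⟨K, hK⟩ := h.bdd
  obtain ⟨K', hK'⟩ := h'.bdd
  have j1 : IntegrableOn (fun t => (A t *ᵥ u t) i * u' t j) (Ico a b) μ :=
    i1.mul_bdd (c := K') (measurable_pi_iff.1 h'.meas j).aestronglyMeasurable
      ((ae_restrict_iff' measurableSet_Ico).2 (ae_of_all _ fun t ht =>
        (norm_le_pi_norm _ j).trans (hK' t ht)))
  have j2 : IntegrableOn (fun t => u t i * (A' t *ᵥ u' t) j) (Ico a b) μ :=
    i2.bdd_mul (c := K) (measurable_pi_iff.1 h.meas i).aestronglyMeasurable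
      ((ae_restrict_iff' measurableSet_Ico).2 (ae_of_all _ fun t ht =>
        (norm_le_pi_norm _ i).trans (hK t ht)))
  refine ⟨j1.add j2, ?_⟩
  have key := integral_mul_integral_eq (μ.restrict (Ico a b)) i1 i2
  rw [← h.eq a b le_rfl hab le_rfl, ← h'.eq a b le_rfl hab le_rfl] at key
  have e : ∫ t in Ico a b, ((A t *ᵥ u t) i * ((∫ s in Iio t, (A' s *ᵥ u' s) j
          ∂(μ.restrict (Ico a b))) + (μ.restrict (Ico a b)).real {t} / 2 * (A' t *ᵥ u' t) j)
        + ((∫ s in Iio t, (A s *ᵥ u s) i ∂(μ.restrict (Ico a b)))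
          + (μ.restrict (Ico a b)).real {t} / 2 * (A t *ᵥ u t) i) * (A' t *ᵥ u' t) j) ∂μ
      = ∫ t in Ico a b, (((A t *ᵥ u t) i * u' t j + u t i * (A' t *ᵥ u' t) j)
        - ((A t *ᵥ u t) i * v' a j + v a i * (A' t *ᵥ u' t) j)) ∂μ := by
    refine setIntegral_congr_fun measurableSet_Ico fun t ht => ?_
    have er : (μ.restrict (Ico a b)).restrict (Iio t) = μ.restrict (Ico a t) := by
      rw [Measure.restrict_restrict measurableSet_Iio]
      congr 1
      ext s
      simp only [mem_inter_iff, mem_Iio, mem_Ico]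
      exact ⟨fun hs => ⟨hs.2.1, hs.1⟩, fun hs => ⟨hs.2, hs.1, hs.2.trans ht.2⟩⟩
    have es : (μ.restrict (Ico a b)).real {t} = μ.real {t} := by
      rw [measureReal_restrict_apply (measurableSet_singleton t),
        inter_eq_left.2 (singleton_subset_iff.2 ht)]
    simp only [er, es]
    rw [← h.eq a t le_rfl ht.1 ht.2.le, ← h'.eq a t le_rfl ht.1 ht.2.le]
    linear_combination -(A t *ᵥ u t) i * h'.bal t ht j - h.bal t ht i * (A' t *ᵥ u' t) j
  rw [e, integral_sub (f := fun t => (A t *ᵥ u t) i * u' t j + u t i * (A' t *ᵥ u' t) j)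
      (g := fun t => (A t *ᵥ u t) i * v' a j + v a i * (A' t *ᵥ u' t) j) (j1.add j2) ((i1.mul_const _).add (i2.const_mul _)),
    integral_add (i1.mul_const _) (i2.const_mul _), integral_mul_const, integral_const_mul,
    ← h.eq a b le_rfl hab le_rfl, ← h'.eq a b le_rfl hab le_rfl] at key
  linear_combination key

theorem wronskian_sub_wronskian [IsLocallyFiniteMeasure μ] (hA : IsTracelessCoeff A)
    (hA' : IsTracelessCoeff A') (hab : a ≤ b) (h : IntSolOn μ A a b u v)
    (h' : IntSolOn μ A' a b u' v') :
    wronskian (v b) (v' b) - wronskian (v a) (v' a)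
      = ∫ t in Ico a b, (wronskian (A t *ᵥ u t) (u' t) + wronskian (u t) (A' t *ᵥ u' t)) ∂μ := by
  obtain ⟨i1, e1⟩ := h.mul_sub_mul_eq hA hA' hab h' 0 1
  obtain ⟨i2, e2⟩ := h.mul_sub_mul_eq hA hA' hab h' 1 0
  have e : ∀ t, wronskian (A t *ᵥ u t) (u' t) + wronskian (u t) (A' t *ᵥ u' t)
      = ((A t *ᵥ u t) 0 * u' t 1 + u t 0 * (A' t *ᵥ u' t) 1)
        - ((A t *ᵥ u t) 1 * u' t 0 + u t 1 * (A' t *ᵥ u' t) 0) := fun t => by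
    simp only [wronskian]; ring
  simp only [e]
  rw [integral_sub i1 i2, ← e1, ← e2]
  simp only [wronskian]
  ring

/-- The integrand of the increment is tr A times the Wronskian of u and u', and the trace vanishes.
-/
theorem wronskian_eq [IsLocallyFiniteMeasure μ] (hA : IsTracelessCoeff A)
    (h : IntSolOn μ A a b u v) (h' : IntSolOn μ A a b u' v') {x y : ℝ} (hx : x ∈ Icc a b)
    (hy : y ∈ Icc a b) : wronskian (v x) (v' x) = wronskian (v y) (v' y) := by
  wlog hxy : x ≤ y generalizing x y
  · exact (this hy hx (le_of_not_ge hxy)).symm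
  have := (h.mono hx.1 hy.2).wronskian_sub_wronskian hA hA hxy (h'.mono hx.1 hy.2)
  have e : ∀ t, wronskian (A t *ᵥ u t) (u' t) + wronskian (u t) (A t *ᵥ u' t) = 0 := fun t => by
    simp only [wronskian, Matrix.mulVec, dotProduct, Fin.sum_univ_two]
    linear_combination (u t 0 * u' t 1 - u t 1 * u' t 0) * hA.trace t
  simp only [e, integral_zero] at this
  linear_combination -this

end IntSolOn

/-- Local existence from the left end point. -/
theorem exists_intSolOn [IsLocallyFiniteMeasure μ] (hA : IsTracelessCoeff A)
    {R : ℝ → Matrix (Fin 2) (Fin 2) ℂ} (hRm : ∀ i j, Measurable fun t => R t i j)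
    {C : ℝ} (hRb : ∀ t ∈ Ico a b, ∀ i j, ‖R t i j‖ ≤ C)
    (hR : ∀ t ∈ Ico a b, (1 - ((μ.real {t} / 2 : ℝ) : ℂ) • A t) * R t = 1) (c : Fin 2 → ℂ) :
    ∃ u v, IntSolOn μ A a b u v ∧ v a = c := by
  obtain ⟨CA, hCA⟩ := hA.bdd
  have hCA0 : 0 ≤ CA := (norm_nonneg _).trans (hCA 0 0 0)
  set C' := max C 0
  have hRb' : ∀ t ∈ Ico a b, ∀ i j, ‖R t i j‖ ≤ C' := fun t ht i j =>
    (hRb t ht i j).trans (le_max_left _ _)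
  have hfin : IsFiniteMeasure (μ.restrict (Ico a b)) :=
    ⟨by rw [Measure.restrict_apply_univ]; exact measure_Ico_lt_top⟩
  classical
  set S : ℝ → Matrix (Fin 2) (Fin 2) ℂ := fun t => if t ∈ Ico a b then R t else 0 with hS
  have hSm : ∀ i j, Measurable fun t => S t i j := by
    intro i j
    have : (fun t => S t i j) = fun t => if t ∈ Ico a b then R t i j else 0 := by
      funext t; simp only [hS]; split_ifs <;> rfl
    rw [this]
    exact Measurable.ite measurableSet_Ico (hRm i j) measurable_const
  have hSb : ∀ t i j, ‖S t i j‖ ≤ C' := by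
    intro t i j
    simp only [hS]
    split_ifs with ht
    · exact hRb' t ht i j
    · simp [C']
  have hSR : ∀ t ∈ Ico a b, S t = R t := fun t ht => if_pos ht
  -- Solving the balance condition for u gives u = Rv, so v satisfies a Volterra equation with
  -- kernel AR over t < x. The cut-off S keeps the kernel bounded on the whole line.
  set T : ℝ → (Fin 2 → ℂ) →L[ℝ] (Fin 2 → ℂ) := fun t =>
    ((Matrix.toLin' (A t * S t)).restrictScalars ℝ).toContinuousLinearMap with hT
  have hTa : ∀ t z, T t z = A t *ᵥ (S t *ᵥ z) := fun t z => by
    simp [hT]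
  have hSn : ∀ t z, ‖S t *ᵥ z‖ ≤ 2 * C' * ‖z‖ := fun t z =>
    (pi_norm_le_iff_of_nonneg (by positivity)).2 fun i => norm_mulVec_le (hSb t) z i
  obtain ⟨v, hvm, ⟨K, hK⟩, hv⟩ := exists_volterra_solution (μ := μ.restrict (Ico a b)) (T := T)
    (C := Real.toNNReal (2 * CA * (2 * C')))
    (fun t z => by
      rw [Real.coe_toNNReal _ (by positivity), hTa]
      refine (pi_norm_le_iff_of_nonneg (by positivity)).2 fun i =>
        (norm_mulVec_le (hCA t) _ i).trans ?_
      rw [mul_assoc (2 * CA)]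
      gcongr
      exact hSn t z)
    (fun g hg => by
      simp only [hTa]
      refine (measurable_pi_iff.2 fun i => ?_).stronglyMeasurable
      refine measurable_mulVec hA.meas (u := fun t => S t *ᵥ g t) ?_ i
      exact measurable_pi_iff.2 fun i => measurable_mulVec hSm hg.measurable i) c
  have hsub : ∀ x y, a ≤ x → x ≤ y → y ≤ b → ∀ i,
      v y i - v x i = ∫ t in Ico x y, (A t *ᵥ (S t *ᵥ v t)) i ∂μ := by
    intro x y hx hxy hy i
    have hm : ∀ i, Measurable fun t => (A t *ᵥ (S t *ᵥ v t)) i := fun i =>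
      measurable_mulVec hA.meas (u := fun t => S t *ᵥ v t)
        (measurable_pi_iff.2 fun i => measurable_mulVec hSm hvm.measurable i) i
    have hint : ∀ i, Integrable (fun t => (A t *ᵥ (S t *ᵥ v t)) i) (μ.restrict (Ico a b)) := by
      intro i
      refine Integrable.of_bound (hm i).aestronglyMeasurable (2 * CA * (2 * C' * K))
        (ae_of_all _ fun t => (norm_mulVec_le (hCA t) _ i).trans ?_)
      gcongr
      exact (hSn t _).trans (by gcongr; exact hK t)
    have hvi : ∀ z, v z i = c i + ∫ t in Iio z, (A t *ᵥ (S t *ᵥ v t)) i ∂(μ.restrict (Ico a b)) := by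
      intro z
      conv_lhs => rw [hv z]
      simp only [hTa, Pi.add_apply]
      rw [eval_integral fun i => (hint i).integrableOn]
    have hd : Iio y = Iio x ∪ Ico x y := (Iio_union_Ico_eq_Iio hxy).symm
    rw [hvi y, hvi x, hd, setIntegral_union _ measurableSet_Ico (hint i).integrableOn
      (hint i).integrableOn, Measure.restrict_restrict measurableSet_Ico,
      inter_eq_left.2 (Ico_subset_Ico hx hy)]
    · ring
    · rw [Set.disjoint_left]
      intro s hs hs'
      exact absurd hs'.1 (not_le.2 hs)
  refine ⟨fun t => S t *ᵥ v t, v, ⟨?_, ⟨2 * C' * K, fun t _ => ?_⟩, hsub, fun t ht i => ?_⟩, ?_⟩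
  · exact measurable_pi_iff.2 fun i => measurable_mulVec hSm hvm.measurable i
  · exact (hSn t _).trans (by gcongr; exact hK t)
  · have h1 : (1 - ((μ.real {t} / 2 : ℝ) : ℂ) • A t) *ᵥ (R t *ᵥ v t) = v t := by
      rw [Matrix.mulVec_mulVec, hR t ht, Matrix.one_mulVec]
    have h2 := congrFun h1 i
    rw [Matrix.sub_mulVec, Matrix.one_mulVec, Matrix.smul_mulVec] at h2
    simp only [Pi.sub_apply, Pi.smul_apply, smul_eq_mul] at h2
    rw [hSR t ht]
    push_cast at h2
    linear_combination h2
  · rw [hv a, Measure.restrict_restrict measurableSet_Iio]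
    have : Iio a ∩ Ico a b = ∅ := by
      ext s
      simp only [mem_inter_iff, mem_Iio, mem_Ico, mem_empty_iff_false, iff_false]
      intro hs
      linarith [hs.1, hs.2.1]
    simp [this]

/-! ### One-sided limits and bounded variation of integrated solutions -/

theorem tendsto_measureReal_Ico_left (μ : Measure ℝ) [IsLocallyFiniteMeasure μ] (x : ℝ) :
    Tendsto (fun y => μ.real (Ico y x)) (𝓝[<] x) (𝓝 0) := by
  have h := tendsto_measure_biInter_gt (μ := μ) (s := fun r : ℝ => Ico (x - r) x) (a := 0)
    (fun r _ => measurableSet_Ico.nullMeasurableSet)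
    (fun i j _ hij => Ico_subset_Ico_left (by linarith)) ⟨1, one_pos, measure_Ico_lt_top.ne⟩
  have he : ⋂ r > (0 : ℝ), Ico (x - r) x = ∅ := by
    ext y
    simp only [gt_iff_lt, mem_iInter, mem_Ico, mem_empty_iff_false, iff_false]
    intro hy
    have h1 := (hy 1 one_pos).2
    have := (hy ((x - y) / 2) (by linarith)).1
    linarith
  rw [he, measure_empty] at h
  have h2 : Tendsto (fun y => x - y) (𝓝[<] x) (𝓝[>] 0) := by
    refine tendsto_nhdsWithin_iff.2 ⟨?_, ?_⟩
    · have : Tendsto (fun y => x - y) (𝓝 x) (𝓝 (x - x)) := tendsto_const_nhds.sub tendsto_id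
      rw [sub_self] at this
      exact this.mono_left nhdsWithin_le_nhds
    · filter_upwards [self_mem_nhdsWithin] with y hy
      exact sub_pos.2 (mem_Iio.1 hy)
  have h3 := (ENNReal.tendsto_toReal ENNReal.zero_ne_top).comp (h.comp h2)
  refine h3.congr fun y => ?_
  simp [Measure.real]

theorem tendsto_measureReal_Ioc_right (μ : Measure ℝ) [IsLocallyFiniteMeasure μ] (x : ℝ) :
    Tendsto (fun y => μ.real (Ioc x y)) (𝓝[>] x) (𝓝 0) := by
  have h := tendsto_measure_biInter_gt (μ := μ) (s := fun r : ℝ => Ioc x r) (a := x)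
    (fun r _ => measurableSet_Ioc.nullMeasurableSet)
    (fun i j _ hij => Ioc_subset_Ioc_right hij)
    ⟨x + 1, by simp, measure_Ioc_lt_top.ne⟩
  have he : ⋂ r > x, Ioc x r = ∅ := by
    ext y
    simp only [gt_iff_lt, mem_iInter, mem_Ioc, mem_empty_iff_false, iff_false]
    intro hy
    have h1 := (hy (x + 1) (by linarith)).1
    have := (hy ((x + y) / 2) (by linarith)).2
    linarith
  rw [he, measure_empty] at h
  exact (ENNReal.tendsto_toReal ENNReal.zero_ne_top).comp h

theorem eVariationOn_le_of_edist_le {E F : Type*} [PseudoEMetricSpace E] [PseudoEMetricSpace F]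
    {f : ℝ → E} {g : ℝ → F} {s : Set ℝ}
    (h : ∀ x ∈ s, ∀ y ∈ s, x ≤ y → edist (f x) (f y) ≤ edist (g x) (g y)) :
    eVariationOn f s ≤ eVariationOn g s := by
  refine iSup_mono fun p => Finset.sum_le_sum fun i _ => ?_
  rw [edist_comm, edist_comm (g _)]
  exact h _ (p.2.2.2 i) _ (p.2.2.2 (i + 1)) (p.2.2.1 (Nat.le_succ i))

/-- Global solutions of `u' = A μ u` in integrated form. -/
def IntSol (μ : Measure ℝ) (A : ℝ → Matrix (Fin 2) (Fin 2) ℂ) (u v : ℝ → Fin 2 → ℂ) : Prop :=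
  ∀ a b, IntSolOn μ A a b u v

variable {μ : Measure ℝ} [IsLocallyFiniteMeasure μ] {A A' : ℝ → Matrix (Fin 2) (Fin 2) ℂ} {a b : ℝ}
  {u v u' v' : ℝ → Fin 2 → ℂ}

omit [IsLocallyFiniteMeasure μ] in
theorem setIntegral_Ico_eq_add_Ioo {x y : ℝ} (hxy : x < y) {f : ℝ → ℂ}
    (hf : IntegrableOn f (Ico x y) μ) :
    ∫ t in Ico x y, f t ∂μ = μ.real {x} * f x + ∫ t in Ioo x y, f t ∂μ := by
  have hd : Ico x y = {x} ∪ Ioo x y := by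
    ext t
    simp only [mem_Ico, mem_union, mem_singleton_iff, mem_Ioo]
    grind
  rw [hd] at hf ⊢
  rw [setIntegral_union (by simp) measurableSet_Ioo (hf.mono_set subset_union_left)
    (hf.mono_set subset_union_right), integral_singleton, Complex.real_smul]

theorem measureReal_Ico_eq_add_Ioo {x y : ℝ} (hxy : x < y) :
    μ.real (Ico x y) = μ.real {x} + μ.real (Ioo x y) := by
  rw [← measureReal_union (by simp) measurableSet_Ioo
    isCompact_singleton.measure_lt_top.ne measure_Ioo_lt_top.ne]
  congr 1
  ext t
  simp only [mem_Ico, mem_union, mem_singleton_iff, mem_Ioo]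
  grind

theorem measureReal_Ioc_eq_add_Ioo {x y : ℝ} (hxy : x < y) :
    μ.real (Ioc x y) = μ.real (Ioo x y) + μ.real {y} := by
  rw [← measureReal_union (by simp) (measurableSet_singleton y) measure_Ioo_lt_top.ne
    isCompact_singleton.measure_lt_top.ne]
  congr 1
  ext t
  simp only [mem_Ioc, mem_union, mem_singleton_iff, mem_Ioo]
  grind

namespace IntSol

omit [IsLocallyFiniteMeasure μ] in
theorem exists_bound (hA : IsTracelessCoeff A) (h : IntSol μ A u v) (a b : ℝ) :
    ∃ K, 0 ≤ K ∧ ∀ t ∈ Ico a b, ∀ i, ‖(A t *ᵥ u t) i‖ ≤ K := by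
  obtain ⟨C, hC⟩ := hA.bdd
  obtain ⟨K, hK⟩ := (h a b).bdd
  have hC0 : 0 ≤ C := (norm_nonneg _).trans (hC 0 0 0)
  refine ⟨2 * C * max K 0, by positivity, fun t ht i => (norm_mulVec_le (hC t) _ _).trans ?_⟩
  gcongr
  exact (hK t ht).trans (le_max_left _ _)

omit [IsLocallyFiniteMeasure μ] in
theorem sub_left_bound (h : IntSol μ A u v) {K : ℝ} {x : ℝ}
    (hK : ∀ i, ‖(A x *ᵥ u x) i‖ ≤ K) (i : Fin 2) : ‖u x i - v x i‖ ≤ K * (μ.real {x} / 2) := by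
  have := (h x (x + 1)).bal x ⟨le_rfl, by linarith⟩ i
  rw [this, add_sub_cancel_left, norm_mul, mul_comm]
  refine mul_le_mul (hK i) (le_of_eq ?_) (norm_nonneg _) ((norm_nonneg _).trans (hK i))
  have : (0 : ℝ) ≤ μ.real {x} / 2 := by positivity
  rw [← Real.norm_of_nonneg this, ← Complex.norm_real]
  push_cast
  rfl

/-- By the balance condition 2u(x) - v(x) equals v(x) plus the full atomic contribution at x. It is
the prospective right limit, and only the open interval remains. -/
theorem jump_eq (hA : IsTracelessCoeff A) (h : IntSol μ A u v) {x y : ℝ} (hxy : x < y) (i : Fin 2) :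
    v y i - (2 * u x i - v x i) = ∫ t in Ioo x y, (A t *ᵥ u t) i ∂μ := by
  have e1 := (h x y).eq x y le_rfl hxy.le le_rfl i
  rw [setIntegral_Ico_eq_add_Ioo hxy ((h x y).integrableOn hA i)] at e1
  linear_combination e1 - 2 * (h x y).bal x ⟨le_rfl, hxy⟩ i

theorem tendsto_left (hA : IsTracelessCoeff A) (h : IntSol μ A u v) (x : ℝ) :
    Tendsto u (𝓝[<] x) (𝓝 (v x)) := by
  obtain ⟨K, hK0, hK⟩ := h.exists_bound hA (x - 1) x
  rw [tendsto_pi_nhds]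
  intro i
  rw [tendsto_iff_norm_sub_tendsto_zero]
  have hlim : Tendsto (fun y => 2 * K * μ.real (Ico y x)) (𝓝[<] x) (𝓝 0) := by
    simpa using (tendsto_measureReal_Ico_left μ x).const_mul (2 * K)
  refine squeeze_zero' (Eventually.of_forall fun y => norm_nonneg _) ?_ hlim
  filter_upwards [Ioo_mem_nhdsLT (show x - 1 < x by linarith)] with y hy
  have h1 := h.sub_left_bound (hK y ⟨hy.1.le, hy.2⟩) i
  have h2 : ‖v x i - v y i‖ ≤ K * μ.real (Ico y x) := by
    rw [(h y x).eq y x le_rfl hy.2.le le_rfl]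
    exact norm_setIntegral_le_of_norm_le_const measure_Ico_lt_top
      fun t ht => hK t ⟨hy.1.le.trans ht.1, ht.2⟩ i
  have h3 : μ.real {y} ≤ μ.real (Ico y x) :=
    measureReal_mono (singleton_subset_iff.2 ⟨le_rfl, hy.2⟩) measure_Ico_lt_top.ne
  calc ‖u y i - v x i‖ = ‖(u y i - v y i) - (v x i - v y i)‖ := by congr 1; ring
    _ ≤ ‖u y i - v y i‖ + ‖v x i - v y i‖ := norm_sub_le _ _
    _ ≤ K * (μ.real {y} / 2) + K * μ.real (Ico y x) := add_le_add h1 h2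
    _ ≤ K * (μ.real (Ico y x)) + K * μ.real (Ico y x) := by
        gcongr
        linarith [measureReal_nonneg (μ := μ) (s := {y})]
    _ = _ := by ring

theorem tendsto_right (hA : IsTracelessCoeff A) (h : IntSol μ A u v) (x : ℝ) :
    Tendsto u (𝓝[>] x) (𝓝 ((2 : ℂ) • u x - v x)) := by
  obtain ⟨K, hK0, hK⟩ := h.exists_bound hA x (x + 1)
  rw [tendsto_pi_nhds]
  intro i
  rw [tendsto_iff_norm_sub_tendsto_zero]
  have hlim : Tendsto (fun y => K * μ.real (Ioc x y)) (𝓝[>] x) (𝓝 0) := by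
    simpa using (tendsto_measureReal_Ioc_right μ x).const_mul K
  refine squeeze_zero' (Eventually.of_forall fun y => norm_nonneg _) ?_ hlim
  filter_upwards [Ioo_mem_nhdsGT (show x < x + 1 by linarith)] with y hy
  have h1 := h.sub_left_bound (hK y ⟨hy.1.le, hy.2⟩) i
  have h2 : ‖v y i - (2 * u x i - v x i)‖ ≤ K * μ.real (Ioo x y) := by
    rw [h.jump_eq hA hy.1]
    exact norm_setIntegral_le_of_norm_le_const measure_Ioo_lt_top
      fun t ht => hK t ⟨ht.1.le, ht.2.trans hy.2⟩ i
  calc ‖u y i - ((2 : ℂ) • u x - v x) i‖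
      = ‖(u y i - v y i) + (v y i - (2 * u x i - v x i))‖ := by
        congr 1; simp only [Pi.sub_apply, Pi.smul_apply, smul_eq_mul]; ring
    _ ≤ K * (μ.real {y} / 2) + K * μ.real (Ioo x y) := (norm_add_le _ _).trans (add_le_add h1 h2)
    _ ≤ K * (μ.real {y}) + K * μ.real (Ioo x y) := by
        gcongr
        linarith [measureReal_nonneg (μ := μ) (s := {y})]
    _ = _ := by rw [measureReal_Ioc_eq_add_Ioo hy.1]; ring

theorem leftLim_eq (hA : IsTracelessCoeff A) (h : IntSol μ A u v) (x : ℝ) :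
    Function.leftLim u x = v x := leftLim_eq_of_tendsto (h.tendsto_left hA x)

theorem rightLim_eq (hA : IsTracelessCoeff A) (h : IntSol μ A u v) (x : ℝ) :
    Function.rightLim u x = (2 : ℂ) • u x - v x := rightLim_eq_of_tendsto (h.tendsto_right hA x)

theorem norm_sub_le (hA : IsTracelessCoeff A) (h : IntSol μ A u v) {x y K : ℝ} (hxy : x < y)
    (hK : ∀ t ∈ Icc x y, ∀ i, ‖(A t *ᵥ u t) i‖ ≤ K) (i : Fin 2) :
    ‖u y i - u x i‖ ≤ K * (μ.real {y} / 2 + μ.real (Ioo x y) + μ.real {x} / 2) := by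
  have h1 := h.sub_left_bound (hK y ⟨hxy.le, le_rfl⟩) i
  have h2 : ‖v y i - (2 * u x i - v x i)‖ ≤ K * μ.real (Ioo x y) := by
    rw [h.jump_eq hA hxy]
    exact norm_setIntegral_le_of_norm_le_const measure_Ioo_lt_top
      fun t ht => hK t ⟨ht.1.le, ht.2.le⟩ i
  have h3 := h.sub_left_bound (hK x ⟨le_rfl, hxy.le⟩) i
  calc ‖u y i - u x i‖
      = ‖(u y i - v y i) + (v y i - (2 * u x i - v x i)) + (u x i - v x i)‖ := by congr 1; ring
    _ ≤ _ := norm_add₃_le.trans (add_le_add (add_le_add h1 h2) h3)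
    _ = _ := by ring

theorem locallyBoundedVariationOn (hA : IsTracelessCoeff A) (h : IntSol μ A u v) :
    LocallyBoundedVariationOn u univ := by
  intro a b _ _
  rw [univ_inter]
  obtain ⟨K, hK0, hK⟩ := h.exists_bound hA a (b + 1)
  -- Averaging the masses of [a,y) and [a,y] gives a monotone function whose increments count both
  -- end-point atoms with weight one half, matching the bound of `norm_sub_le` exactly.
  set G : ℝ → ℝ := fun y => K * ((μ.real (Ico a y) + μ.real (Icc a y)) / 2) with hG
  have hGm : Monotone G := fun x y hxy => by
    simp only [hG]
    gcongr
    · exact measure_Ico_lt_top.ne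
    · exact measure_Icc_lt_top.ne
  have hd : ∀ x ∈ Icc a b, ∀ y ∈ Icc a b, x < y →
      G y - G x = K * (μ.real {y} / 2 + μ.real (Ioo x y) + μ.real {x} / 2) := by
    intro x hx y hy hxy
    have e1 : μ.real (Ico a y) = μ.real (Ico a x) + μ.real (Ico x y) := by
      rw [← measureReal_union _ measurableSet_Ico measure_Ico_lt_top.ne measure_Ico_lt_top.ne,
        Ico_union_Ico_eq_Ico hx.1 hxy.le]
      rw [Set.disjoint_left]
      exact fun t ht ht' => absurd ht.2 (not_lt.2 ht'.1)
    have e2 : μ.real (Icc a y) = μ.real (Icc a x) + μ.real (Ioc x y) := by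
      rw [← measureReal_union _ measurableSet_Ioc measure_Icc_lt_top.ne measure_Ioc_lt_top.ne,
        Icc_union_Ioc_eq_Icc hx.1 hxy.le]
      rw [Set.disjoint_left]
      exact fun t ht ht' => absurd ht.2 (not_le.2 ht'.1)
    simp only [hG]
    rw [e1, e2, measureReal_Ico_eq_add_Ioo hxy, measureReal_Ioc_eq_add_Ioo hxy]
    ring
  have hle : eVariationOn u (Icc a b) ≤ eVariationOn G (Icc a b) := by
    refine eVariationOn_le_of_edist_le fun x hx y hy hxy => ?_
    rcases hxy.eq_or_lt with rfl | hxy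
    · simp
    rw [edist_dist, edist_dist, dist_comm, dist_comm (G x), dist_eq_norm, Real.dist_eq]
    refine ENNReal.ofReal_le_ofReal ?_
    rw [abs_of_nonneg (sub_nonneg.2 (hGm hxy.le))]
    refine (pi_norm_le_iff_of_nonneg (sub_nonneg.2 (hGm hxy.le))).2 fun i => ?_
    rw [hd x hx y hy hxy]
    exact h.norm_sub_le hA hxy
      (fun t ht => hK t ⟨hx.1.trans ht.1, ht.2.trans_lt (hy.2.trans_lt (by linarith))⟩) i
  have hfin := (hGm.monotoneOn univ).locallyBoundedVariationOn a b (mem_univ _) (mem_univ _)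
  rw [univ_inter] at hfin
  exact ne_top_of_le_ne_top hfin hle

theorem isBalancedBV (hA : IsTracelessCoeff A) (h : IntSol μ A u v) :
    PeriodicSystem.IsBalancedBV u := by
  refine ⟨h.locallyBoundedVariationOn hA, fun x => ?_⟩
  rw [h.leftLim_eq hA, h.rightLim_eq hA]
  ext i
  simp only [Pi.smul_apply, Pi.add_apply, Pi.sub_apply, smul_eq_mul]
  ring

theorem lin (hA : IsTracelessCoeff A) (h : IntSol μ A u v) (h' : IntSol μ A u' v') (α β : ℂ) :
    IntSol μ A (fun t => α • u t + β • u' t) (fun t => α • v t + β • v' t) :=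
  fun a b => (h a b).lin hA (h' a b) α β

end IntSol

/-! ### Global existence and uniqueness -/

section Global

theorem wronskian_cramer (p q c : Fin 2 → ℂ) :
    wronskian c q • p + wronskian p c • q = wronskian p q • c := by
  ext i
  fin_cases i <;> simp [wronskian] <;> ring

variable (hA : IsTracelessCoeff A)
  (hex : ∀ a b : ℝ, ∀ c, ∃ u v, IntSolOn μ A a b u v ∧ v a = c)
  (hinj : ∀ (t : ℝ) (z : Fin 2 → ℂ), (∀ i, z i = μ.real {t} / 2 * (A t *ᵥ z) i) → z = 0)

include hA hex in
-- No backward solving is needed: two solutions started at the left end point with Wronskian 1 still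
-- have Wronskian 1 at t₀, so Cramer's rule produces any prescribed value there.
theorem exists_intSolOn_at {t₀ : ℝ} (ht : t₀ ∈ Icc a b) (c : Fin 2 → ℂ) :
    ∃ u v, IntSolOn μ A a b u v ∧ v t₀ = c := by
  have haI : a ∈ Icc a b := ⟨le_rfl, ht.1.trans ht.2⟩
  obtain ⟨u0, v0, h0, e0⟩ := hex a b ![1, 0]
  obtain ⟨u1, v1, h1, e1⟩ := hex a b ![0, 1]
  have hw : wronskian (v0 t₀) (v1 t₀) = 1 := by
    rw [h0.wronskian_eq hA h1 ht haI, e0, e1]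
    simp [wronskian]
  refine ⟨_, _, h0.lin hA h1 (wronskian c (v1 t₀)) (wronskian (v0 t₀) c), ?_⟩
  rw [wronskian_cramer, hw, one_smul]

include hA hex in
-- Uniqueness follows from existence. The Wronskians with the solutions whose values at x are the
-- unit vectors are constant, vanish at t₀, and read off the components of v at x.
theorem IntSolOn.left_eq_zero (h : IntSolOn μ A a b u v) {t₀ : ℝ} (ht : t₀ ∈ Icc a b)
    (h0 : v t₀ = 0) {x : ℝ} (hx : x ∈ Icc a b) : v x = 0 := by
  obtain ⟨p, p', hp, ep⟩ := exists_intSolOn_at hA hex hx ![1, 0]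
  obtain ⟨q, q', hq, eq⟩ := exists_intSolOn_at hA hex hx ![0, 1]
  have h1 := h.wronskian_eq hA hp hx ht
  have h2 := h.wronskian_eq hA hq hx ht
  rw [h0, ep] at h1
  rw [h0, eq] at h2
  ext i
  fin_cases i
  · simpa [wronskian] using h2
  · simpa [wronskian] using h1

omit [IsLocallyFiniteMeasure μ] in
include hinj in
theorem IntSolOn.eq_zero_of_left (h : IntSolOn μ A a b u v) {x : ℝ} (hx : x ∈ Ico a b)
    (h0 : v x = 0) : u x = 0 := by
  refine hinj x _ fun i => ?_
  have := h.bal x hx i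
  rwa [h0, Pi.zero_apply, zero_add] at this

include hA hex hinj in
theorem IntSolOn.eqOn (h : IntSolOn μ A a b u v) (h' : IntSolOn μ A a b u' v') {t₀ : ℝ}
    (ht : t₀ ∈ Icc a b) (h0 : v t₀ = v' t₀) :
    (∀ x ∈ Ico a b, u x = u' x) ∧ ∀ x ∈ Icc a b, v x = v' x := by
  have hd := h.lin hA h' 1 (-1)
  have hz : ∀ x ∈ Icc a b, (1 : ℂ) • v x + (-1 : ℂ) • v' x = 0 := fun x hx =>
    hd.left_eq_zero hA hex ht (by simp [h0]) hx
  refine ⟨fun x hx => ?_, fun x hx => ?_⟩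
  · have := hd.eq_zero_of_left hinj hx (hz x ⟨hx.1, hx.2.le⟩)
    rw [one_smul, neg_one_smul, ← sub_eq_add_neg] at this
    exact sub_eq_zero.1 this
  · have := hz x hx
    rw [one_smul, neg_one_smul, ← sub_eq_add_neg] at this
    exact sub_eq_zero.1 this

include hA hex hinj in
theorem IntSol.eq_of_left (h : IntSol μ A u v) (h' : IntSol μ A u' v') {t₀ : ℝ}
    (h0 : v t₀ = v' t₀) : u = u' := by
  funext x
  have hx : x ∈ Ico (min x t₀) (max x t₀ + 1) :=
    ⟨min_le_left _ _, by linarith [le_max_left x t₀]⟩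
  have ht : t₀ ∈ Icc (min x t₀) (max x t₀ + 1) :=
    ⟨min_le_right _ _, by linarith [le_max_right x t₀]⟩
  exact ((h _ _).eqOn hA hex hinj (h' _ _) ht h0).1 x hx

include hA hex hinj in
theorem exists_intSol (c : Fin 2 → ℂ) : ∃ u v, IntSol μ A u v ∧ v 0 = c := by
  have h0 : ∀ n : ℕ, (0 : ℝ) ∈ Icc (-(n : ℝ)) n := fun n => ⟨by simp, by simp⟩
  choose U V hUV hV using fun n : ℕ => exists_intSolOn_at hA hex (h0 n) c
  have hcomp : ∀ m n : ℕ, m ≤ n → (∀ x ∈ Ico (-(m : ℝ)) m, U n x = U m x) ∧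
      ∀ x ∈ Icc (-(m : ℝ)) m, V n x = V m x := by
    intro m n hmn
    have hmn' : (m : ℝ) ≤ n := by exact_mod_cast hmn
    exact ((hUV n).mono (by linarith) hmn').eqOn hA hex hinj (hUV m) (h0 m) (by rw [hV, hV])
  -- N(x) selects an interval [-N,N] containing x in its interior. By uniqueness the choice of a
  -- larger interval is immaterial, and N being measurable with countably many values keeps the
  -- glued function measurable.
  set N : ℝ → ℕ := fun x => ⌈|x|⌉₊ + 1 with hN
  have hNx : ∀ x, |x| < N x := fun x => by
    simp only [hN]
    push_cast
    linarith [Nat.le_ceil |x|]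
  have hNm : Measurable N := (Nat.measurable_ceil.comp measurable_id.abs).add_const 1
  have hU : ∀ n : ℕ, ∀ x ∈ Ico (-(n : ℝ)) n, U (N x) x = U n x := by
    intro n x hx
    rcases le_total n (N x) with h | h
    · exact (hcomp n _ h).1 x hx
    · exact ((hcomp _ n h).1 x ⟨(abs_lt.1 (hNx x)).1.le, (abs_lt.1 (hNx x)).2⟩).symm
  have hV' : ∀ n : ℕ, ∀ x ∈ Icc (-(n : ℝ)) n, V (N x) x = V n x := by
    intro n x hx
    rcases le_total n (N x) with h | h
    · exact (hcomp n _ h).2 x hx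
    · exact ((hcomp _ n h).2 x ⟨(abs_lt.1 (hNx x)).1.le, (abs_lt.1 (hNx x)).2.le⟩).symm
  have hm : Measurable fun x => U (N x) x := by
    have : Measurable fun p : ℕ × ℝ => U p.1 p.2 :=
      measurable_from_prod_countable_right fun n => (hUV n).meas
    exact this.comp (hNm.prodMk measurable_id)
  refine ⟨fun x => U (N x) x, fun x => V (N x) x, fun a b => ?_, hV _⟩
  obtain ⟨n, hn⟩ := exists_nat_ge (max |a| |b|)
  have ha : -(n : ℝ) ≤ a := by linarith [neg_abs_le a, le_max_left |a| |b|]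
  have hb : b ≤ n := by linarith [le_abs_self b, le_max_right |a| |b|]
  exact ((hUV n).congr hm (hU n) (hV' n)).mono ha hb

end Global

/-! ### Jordan decompositions, periodicity and bounded densities -/

/-- α is carried by a set on which β vanishes, and there α ≤ α + δ = β + γ = γ. This is the
minimality of the Jordan decomposition. -/
theorem MeasureTheory.Measure.MutuallySingular.le_of_add_eq_add {α β γ δ : Measure ℝ} (h : α ⟂ₘ β)
    (he : α + δ = β + γ) : α ≤ γ := by
  obtain ⟨S, hS, hα, hβ⟩ := h
  refine Measure.le_iff.2 fun s hs => ?_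
  calc α s ≤ α (s ∩ S) + α (s \ S) := measure_le_inter_add_sdiff α s S
    _ = α (s \ S) := by rw [measure_mono_null inter_subset_right hα, zero_add]
    _ ≤ (α + δ) (s \ S) := by rw [Measure.add_apply]; exact le_self_add
    _ = γ (s \ S) := by
        rw [he, Measure.add_apply, measure_mono_null (fun x hx => hx.2) hβ, zero_add]
    _ ≤ γ s := measure_mono sdiff_subset

/-- A bounded function all of whose integrals over half-open intervals are non-negative is
non-negative almost everywhere. -/
theorem ae_nonneg_of_setIntegral_Ico_nonneg {μ : Measure ℝ} [IsLocallyFiniteMeasure μ] {f : ℝ → ℝ}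
    (hf : LocallyIntegrable f μ) (h : ∀ x y, x ≤ y → 0 ≤ ∫ t in Ico x y, f t ∂μ) :
    ∀ᵐ t ∂μ, 0 ≤ f t := by
  have hIcc : ∀ x y, x ≤ y → 0 ≤ ∫ t in Icc x y, f t ∂μ := by
    intro x y hxy
    have hanti : Antitone fun n : ℕ => Ico x (y + 1 / ((n : ℝ) + 1)) := fun m n hmn =>
      Ico_subset_Ico_right (by gcongr)
    have hI : ⋂ n : ℕ, Ico x (y + 1 / ((n : ℝ) + 1)) = Icc x y := by
      ext t
      simp only [mem_iInter, mem_Ico, mem_Icc]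
      refine ⟨fun ht => ⟨(ht 0).1, le_of_forall_pos_le_add fun ε hε => ?_⟩,
        fun ht n => ⟨ht.1, ht.2.trans_lt (by simp; positivity)⟩⟩
      obtain ⟨n, hn⟩ := exists_nat_one_div_lt hε
      linarith [(ht n).2]
    have hlim := tendsto_setIntegral_of_antitone (μ := μ) (f := f)
      (fun n : ℕ => measurableSet_Ico (a := x) (b := y + 1 / ((n : ℝ) + 1))) hanti
      ⟨0, (hf.integrableOn_isCompact isCompact_Icc).mono_set Ico_subset_Icc_self⟩
    rw [hI] at hlim
    refine ge_of_tendsto' hlim fun n => h _ _ ?_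
    have : (0 : ℝ) ≤ 1 / ((n : ℝ) + 1) := by positivity
    linarith
  -- Almost everywhere f is the limit of its averages over closed balls, which on the line are
  -- closed intervals. This is why the hypothesis was first moved from half-open to closed
  -- intervals.
  filter_upwards [(Besicovitch.vitaliFamily μ).ae_tendsto_average hf] with x hx
  have h2 := hx.comp (Besicovitch.tendsto_filterAt μ x)
  refine ge_of_tendsto h2 ?_
  filter_upwards [self_mem_nhdsWithin] with r hr
  rw [Function.comp_apply, setAverage_eq, Real.closedBall_eq_Icc]
  rw [mem_Ioi] at hr
  exact smul_nonneg (by positivity) (hIcc _ _ (by linarith))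

namespace OrderZeroDistribution

instance (r : OrderZeroDistribution) : IsLocallyFiniteMeasure r.pos := r.locallyFinite_pos

instance (r : OrderZeroDistribution) : IsLocallyFiniteMeasure r.neg := r.locallyFinite_neg

variable {r : OrderZeroDistribution} {ω : ℝ}

theorem pair_ofReal (r : OrderZeroDistribution) (φ : ℝ → ℝ) :
    r.pair (fun x => (φ x : ℂ)) = ((r.pair φ : ℝ) : ℂ) := by
  simp only [pair, integral_complex_ofReal, Complex.ofReal_sub]

theorem tendsto_integral_stepTest_measureReal (μ : Measure ℝ) [IsLocallyFiniteMeasure μ] {x y : ℝ}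
    (hxy : x ≤ y) :
    Tendsto (fun n => ∫ t, stepTest n x y t ∂μ) atTop (𝓝 (μ.real (Ico x y))) := by
  have h := tendsto_integral_stepTest μ hxy (f := fun _ => 1) (integrableOn_const (by
    exact measure_Icc_lt_top.ne))
  simp only [one_mul, integral_complex_ofReal] at h
  have h2 := (Complex.continuous_re.tendsto _).comp h
  simpa [Function.comp_def] using h2

/-- Testing with step functions shows only that the signed measure pos - neg is invariant under
translation. Translation preserves mutual singularity, so uniqueness of the Jordan decomposition
gives the invariance of each part separately. -/
theorem HasPeriod.map_eq (h : r.HasPeriod ω) :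
    r.pos.map (fun x => x - ω) = r.pos ∧ r.neg.map (fun x => x - ω) = r.neg := by
  have hm : Measurable fun x : ℝ => x - ω := measurable_id.sub_const ω
  have hpre : ∀ x y : ℝ, (fun x : ℝ => x - ω) ⁻¹' Ico x y = Ico (x + ω) (y + ω) := fun x y => by
    ext t; simp only [mem_preimage, mem_Ico]; constructor <;> rintro ⟨h1, h2⟩ <;> constructor <;>
      linarith
  have hreal : ∀ x y : ℝ, x ≤ y → r.pos.real (Ico x y) - r.neg.real (Ico x y)
      = r.pos.real (Ico (x + ω) (y + ω)) - r.neg.real (Ico (x + ω) (y + ω)) := by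
    intro x y hxy
    have h1 := (tendsto_integral_stepTest_measureReal r.pos hxy).sub
      (tendsto_integral_stepTest_measureReal r.neg hxy)
    have h2 := (tendsto_integral_stepTest_measureReal r.pos (add_le_add_left hxy ω)).sub
      (tendsto_integral_stepTest_measureReal r.neg (add_le_add_left hxy ω))
    refine tendsto_nhds_unique h1 (h2.congr fun n => ?_)
    have := h _ (isTestFunction_stepTest n (add_le_add_left hxy ω))
    have e : ∀ t, stepTest n (x + ω) (y + ω) (t + ω) = stepTest n x y t := fun t => by
      simp only [stepTest, add_sub_add_right_eq_sub]
    simp only [pair, e] at this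
    exact this
  -- The negative parts are moved across, so that two positive, locally finite measures are compared
  -- on half-open intervals.
  have he : r.pos + r.neg.map (fun x => x - ω) = r.neg + r.pos.map (fun x => x - ω) := by
    refine Measure.ext_of_Ico' _ _ (fun a b _ => ?_) (fun a b hab => ?_)
    · rw [Measure.add_apply, Measure.map_apply hm measurableSet_Ico, hpre]
      exact (ENNReal.add_lt_top.2 ⟨measure_Ico_lt_top, measure_Ico_lt_top⟩).ne
    · rw [Measure.add_apply, Measure.add_apply, Measure.map_apply hm measurableSet_Ico,
        Measure.map_apply hm measurableSet_Ico, hpre,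
        ← ENNReal.toReal_eq_toReal_iff'
          (ENNReal.add_lt_top.2 ⟨measure_Ico_lt_top, measure_Ico_lt_top⟩).ne
          (ENNReal.add_lt_top.2 ⟨measure_Ico_lt_top, measure_Ico_lt_top⟩).ne,
        ENNReal.toReal_add measure_Ico_lt_top.ne measure_Ico_lt_top.ne,
        ENNReal.toReal_add measure_Ico_lt_top.ne measure_Ico_lt_top.ne]
      have := hreal a b hab.le
      simp only [Measure.real] at this
      linarith
  have hs : r.pos.map (fun x => x - ω) ⟂ₘ r.neg.map (fun x => x - ω) := by
    obtain ⟨S, hS, h1, h2⟩ := r.mutuallySingular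
    have hp : Measurable fun x : ℝ => x + ω := measurable_id.add_const ω
    refine ⟨(fun x => x + ω) ⁻¹' S, hp hS, ?_, ?_⟩
    · rw [Measure.map_apply hm (hp hS), ← preimage_comp]
      simpa [Function.comp_def] using h1
    · rw [Measure.map_apply hm (hp hS).compl, ← preimage_compl, ← preimage_comp]
      simpa [Function.comp_def] using h2
  refine ⟨le_antisymm (hs.le_of_add_eq_add (δ := r.neg) ?_)
      (r.mutuallySingular.le_of_add_eq_add he),
    le_antisymm (hs.symm.le_of_add_eq_add (δ := r.pos) ?_)
      (r.mutuallySingular.symm.le_of_add_eq_add he.symm)⟩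
  · rw [add_comm, ← he, add_comm]
  · rw [add_comm, he, add_comm]

/-- Periodicity extends from test functions to all functions. -/
theorem HasPeriod.pair_comp_add (h : r.HasPeriod ω) (f : ℝ → ℂ) :
    r.pair (fun x => f (x + ω)) = r.pair f := by
  have he : MeasurableEmbedding fun x : ℝ => x - ω := by
    simpa only [sub_eq_add_neg] using measurableEmbedding_addRight (-ω)
  have key : ∀ μ : Measure ℝ, μ.map (fun x => x - ω) = μ → ∫ x, f (x + ω) ∂μ = ∫ x, f x ∂μ := by
    intro μ hμ
    conv_lhs => rw [← hμ, he.integral_map]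
    simp
  simp only [pair, key _ h.map_eq.1, key _ h.map_eq.2]

/-- A bounded density of a distribution of order `0` with respect to a dominating measure. -/
noncomputable def density (r : OrderZeroDistribution) (μ : Measure ℝ) (x : ℝ) : ℝ :=
  min (r.pos.rnDeriv μ x).toReal 1 - min (r.neg.rnDeriv μ x).toReal 1

theorem measurable_density (r : OrderZeroDistribution) (μ : Measure ℝ) :
    Measurable (r.density μ) :=
  ((Measure.measurable_rnDeriv _ _).ennreal_toReal.min measurable_const).sub
    ((Measure.measurable_rnDeriv _ _).ennreal_toReal.min measurable_const)

theorem abs_density_le (r : OrderZeroDistribution) (μ : Measure ℝ) (x : ℝ) :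
    |r.density μ x| ≤ 1 := by
  have h : ∀ a : ENNReal, 0 ≤ min a.toReal 1 ∧ min a.toReal 1 ≤ 1 := fun a =>
    ⟨le_min ENNReal.toReal_nonneg zero_le_one, min_le_right _ _⟩
  have h1 := h (r.pos.rnDeriv μ x)
  have h2 := h (r.neg.rnDeriv μ x)
  rw [density, abs_le]
  constructor <;> linarith

/-- Domination ν ≤ μ bounds the derivative by 1 almost everywhere. The truncation changes no
integral but makes the bound hold at every point. -/
theorem integral_eq_min_rnDeriv {μ ν : Measure ℝ} [SigmaFinite μ] [SigmaFinite ν] (h : ν ≤ μ)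
    (f : ℝ → ℂ) : ∫ x, f x ∂ν = ∫ x, (min (ν.rnDeriv μ x).toReal 1 : ℝ) * f x ∂μ := by
  rw [← integral_rnDeriv_smul (Measure.absolutelyContinuous_of_le h)]
  refine integral_congr_ae ?_
  filter_upwards [Measure.rnDeriv_le_one_of_le h] with x hx
  have : (ν.rnDeriv μ x).toReal ≤ 1 := ENNReal.toReal_le_of_le_ofReal zero_le_one (by simpa using hx)
  rw [min_eq_left this, Complex.real_smul]

theorem integrable_min_rnDeriv_mul {μ : Measure ℝ} (ν : Measure ℝ) {f : ℝ → ℂ} (hf : Integrable f μ) :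
    Integrable (fun x => ((min (ν.rnDeriv μ x).toReal 1 : ℝ) : ℂ) * f x) μ := by
  refine hf.bdd_mul (c := 1) (Complex.measurable_ofReal.comp
    ((Measure.measurable_rnDeriv _ _).ennreal_toReal.min measurable_const)).aestronglyMeasurable
    (ae_of_all _ fun x => ?_)
  rw [Complex.norm_real, Real.norm_of_nonneg (le_min ENNReal.toReal_nonneg zero_le_one)]
  exact min_le_right _ _

theorem pair_eq_integral_density {μ : Measure ℝ} [SigmaFinite μ] (hp : r.pos ≤ μ) (hn : r.neg ≤ μ)
    {f : ℝ → ℂ} (hf : Integrable f μ) : r.pair f = ∫ x, (r.density μ x : ℂ) * f x ∂μ := by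
  rw [pair, integral_eq_min_rnDeriv hp, integral_eq_min_rnDeriv hn,
    ← integral_sub (integrable_min_rnDeriv_mul _ hf) (integrable_min_rnDeriv_mul _ hf)]
  simp only [density, Complex.ofReal_sub, sub_mul]

end OrderZeroDistribution

/-! ### Densities of the coefficient matrices -/

namespace PeriodicSystem

/-- `R` is a bounded density of the matrix `r` of distributions with respect to `μ`. -/
structure IsDensity (μ : Measure ℝ) (R : ℝ → Matrix (Fin 2) (Fin 2) ℝ) (r : Coeff) : Prop where
  meas : ∀ i j, Measurable fun t => R t i j
  bdd : ∀ t i j, |R t i j| ≤ 1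
  pair : ∀ i j (f : ℝ → ℂ), Integrable f μ → (r i j).pair f = ∫ t, (R t i j : ℂ) * f t ∂μ

theorem pair_indicator_singleton (r : OrderZeroDistribution) (x : ℝ) :
    r.pair (indicator {x} fun _ => (1 : ℂ)) = r.jump x := by
  have h : ∀ ν : Measure ℝ, ∫ t, indicator {x} (fun _ => (1 : ℂ)) t ∂ν = ν.real {x} := fun ν => by
    rw [integral_indicator (measurableSet_singleton x), setIntegral_const]
    simp
  simp only [OrderZeroDistribution.pair, OrderZeroDistribution.jump, h, Complex.ofReal_sub]

theorem IsDensity.jump_eq {μ : Measure ℝ} [IsLocallyFiniteMeasure μ]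
    {R : ℝ → Matrix (Fin 2) (Fin 2) ℝ} {r : Coeff} (h : IsDensity μ R r) (x : ℝ) (i j : Fin 2) :
    jump r x i j = R x i j * μ.real {x} := by
  have h1 := h.pair i j (indicator {x} fun _ => 1)
    ((integrable_indicator_iff (measurableSet_singleton x)).2
      (integrableOn_const isCompact_singleton.measure_lt_top.ne))
  rw [pair_indicator_singleton] at h1
  have h2 : ∀ t, (R t i j : ℂ) * indicator {x} (fun _ => (1 : ℂ)) t
      = indicator {x} (fun t => (R t i j : ℂ)) t := fun t => by
    by_cases ht : t ∈ ({x} : Set ℝ) <;> simp [ht]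
  simp only [h2] at h1
  rw [integral_indicator (measurableSet_singleton x), integral_singleton, Complex.real_smul,
    ← Complex.ofReal_mul] at h1
  have := Complex.ofReal_injective h1
  rw [mul_comm] at this
  exact this

/-- The sum of all the variation measures of the entries of `q` and `w`. -/
noncomputable def totalMeasure (q w : Coeff) : Measure ℝ :=
  ∑ i, ∑ j, ((q i j).pos + (q i j).neg + ((w i j).pos + (w i j).neg))

theorem totalMeasure_apply (q w : Coeff) (s : Set ℝ) : totalMeasure q w s =
    ∑ i, ∑ j, ((q i j).pos s + (q i j).neg s + ((w i j).pos s + (w i j).neg s)) := by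
  simp only [totalMeasure, Measure.finsetSum_apply, Measure.add_apply]

instance (q w : Coeff) : IsLocallyFiniteMeasure (totalMeasure q w) := by
  have : IsFiniteMeasureOnCompacts (totalMeasure q w) := ⟨fun K hK => by
    rw [totalMeasure_apply]
    refine ENNReal.sum_lt_top.2 fun i _ => ENNReal.sum_lt_top.2 fun j _ => ?_
    exact ENNReal.add_lt_top.2 ⟨ENNReal.add_lt_top.2 ⟨hK.measure_lt_top, hK.measure_lt_top⟩,
      ENNReal.add_lt_top.2 ⟨hK.measure_lt_top, hK.measure_lt_top⟩⟩⟩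
  infer_instance

theorem entry_le_totalMeasure (q w : Coeff) (i j : Fin 2) :
    (q i j).pos ≤ totalMeasure q w ∧ (q i j).neg ≤ totalMeasure q w ∧
    (w i j).pos ≤ totalMeasure q w ∧ (w i j).neg ≤ totalMeasure q w := by
  have h : ∀ s, (q i j).pos s + (q i j).neg s + ((w i j).pos s + (w i j).neg s)
      ≤ totalMeasure q w s := fun s => by
    rw [totalMeasure_apply]
    exact (Finset.single_le_sum_of_canonicallyOrdered (f := fun j => (q i j).pos s + (q i j).neg s
      + ((w i j).pos s + (w i j).neg s)) (Finset.mem_univ j)).trans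
      (Finset.single_le_sum_of_canonicallyOrdered (f := fun i => ∑ j, ((q i j).pos s + (q i j).neg s
      + ((w i j).pos s + (w i j).neg s))) (Finset.mem_univ i))
  refine ⟨?_, ?_, ?_, ?_⟩ <;> refine Measure.le_iff.2 fun s _ => le_trans ?_ (h s)
  · rw [add_assoc]; exact le_self_add
  · rw [add_comm (((q i j).pos s)), add_assoc]; exact le_self_add
  · rw [add_comm, add_assoc]; exact le_self_add
  · rw [add_comm, add_comm ((w i j).pos s), add_assoc]; exact le_self_add

theorem isDensity_density {μ : Measure ℝ} [SigmaFinite μ] {r : Coeff}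
    (h : ∀ i j, (r i j).pos ≤ μ ∧ (r i j).neg ≤ μ) :
    IsDensity μ (fun t => Matrix.of fun i j => (r i j).density μ t) r where
  meas i j := (r i j).measurable_density μ
  bdd t i j := (r i j).abs_density_le μ t
  pair i j _ hf := OrderZeroDistribution.pair_eq_integral_density (h i j).1 (h i j).2 hf

/-- Concrete positive semidefiniteness of a real `2 × 2` matrix. -/
structure IsPSD (M : Matrix (Fin 2) (Fin 2) ℝ) : Prop where
  symm : M 1 0 = M 0 1
  nonneg_zero : 0 ≤ M 0 0
  nonneg_one : 0 ≤ M 1 1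
  sq_le : M 0 1 ^ 2 ≤ M 0 0 * M 1 1

/-- Rational vectors suffice by density, and they are countable. Hence almost-everywhere
inequalities, one for each vector, can be intersected and still give semidefiniteness. -/
theorem isPSD_of_rat {M : Matrix (Fin 2) (Fin 2) ℝ} (hs : M 1 0 = M 0 1)
    (h : ∀ p r : ℚ, 0 ≤ (p : ℝ) ^ 2 * M 0 0 + 2 * p * r * M 0 1 + (r : ℝ) ^ 2 * M 1 1) : IsPSD M := by
  refine ⟨hs, by simpa using h 1 0, by simpa using h 0 1, ?_⟩
  have hx : ∀ x : ℝ, 0 ≤ M 0 0 * (x * x) + 2 * M 0 1 * x + M 1 1 := fun x =>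
    Rat.denseRange_cast.induction_on (p := fun x : ℝ => 0 ≤ M 0 0 * (x * x) + 2 * M 0 1 * x + M 1 1)
      x (isClosed_le continuous_const (by fun_prop)) fun p => by
      have := h p 1
      push_cast at this
      linarith
  have := discrim_le_zero hx
  rw [discrim] at this
  linarith

/-- Since M is real and symmetric, the form splits into its values at the real and imaginary parts,
both nonnegative and hence zero. Completing the square after multiplication by M₀₀ or M₁₁ then shows
that each real vector is annihilated. -/
theorem IsPSD.mulVec_eq_zero {M : Matrix (Fin 2) (Fin 2) ℝ} (h : IsPSD M) {z : Fin 2 → ℂ}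
    (hz : ∑ i, ∑ j, (M i j : ℂ) * (starRingEnd ℂ (z i) * z j) = 0) (i : Fin 2) :
    ∑ j, (M i j : ℂ) * z j = 0 := by
  obtain ⟨hs, h0, h1, hd⟩ := h
  have sqz : ∀ s : ℝ, s ^ 2 ≤ 0 → s = 0 := fun s hs =>
    (pow_eq_zero_iff two_ne_zero).1 (le_antisymm hs (sq_nonneg s))
  have key : ∀ x y : ℝ, 0 ≤ M 0 0 * x ^ 2 + 2 * M 0 1 * x * y + M 1 1 * y ^ 2 ∧
      (M 0 0 * x ^ 2 + 2 * M 0 1 * x * y + M 1 1 * y ^ 2 = 0 →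
        M 0 0 * x + M 0 1 * y = 0 ∧ M 0 1 * x + M 1 1 * y = 0) := by
    intro x y
    have e1 : M 0 0 * (M 0 0 * x ^ 2 + 2 * M 0 1 * x * y + M 1 1 * y ^ 2)
      = (M 0 0 * x + M 0 1 * y) ^ 2 + (M 0 0 * M 1 1 - M 0 1 ^ 2) * y ^ 2 := by ring
    have e2 : M 1 1 * (M 0 0 * x ^ 2 + 2 * M 0 1 * x * y + M 1 1 * y ^ 2)
      = (M 0 1 * x + M 1 1 * y) ^ 2 + (M 0 0 * M 1 1 - M 0 1 ^ 2) * x ^ 2 := by ring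
    have p1 : 0 ≤ (M 0 0 * M 1 1 - M 0 1 ^ 2) * y ^ 2 := mul_nonneg (by linarith) (sq_nonneg _)
    have p2 : 0 ≤ (M 0 0 * M 1 1 - M 0 1 ^ 2) * x ^ 2 := mul_nonneg (by linarith) (sq_nonneg _)
    constructor
    · rcases h0.eq_or_lt with h0' | h0'
      · have : M 0 1 = 0 := sqz _ (by rw [← h0', zero_mul] at hd; exact hd)
        rw [← h0', this]
        have := mul_nonneg h1 (sq_nonneg y)
        linarith
      · refine nonneg_of_mul_nonneg_right ?_ h0'
        rw [e1]
        positivity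
    · intro hq
      rw [hq, mul_zero] at e1 e2
      constructor
      · exact sqz _ (by linarith)
      · exact sqz _ (by linarith)
  have hre := congrArg Complex.re hz
  simp only [Fin.sum_univ_two, hs, Complex.add_re, Complex.mul_re, Complex.ofReal_re,
    Complex.ofReal_im, Complex.conj_re, Complex.conj_im, Complex.zero_re, zero_mul, sub_zero] at hre
  obtain ⟨kr, kr'⟩ := key (z 0).re (z 1).re
  obtain ⟨ki, ki'⟩ := key (z 0).im (z 1).im
  obtain ⟨r0, r1⟩ := kr' (by nlinarith)
  obtain ⟨i0, i1⟩ := ki' (by nlinarith)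
  fin_cases i
  · apply Complex.ext <;> simp [Fin.sum_univ_two, r0, i0]
  · apply Complex.ext <;> simp [Fin.sum_univ_two, hs, r1, i1]

theorem integrable_mul_stepTest {μ : Measure ℝ} [IsLocallyFiniteMeasure μ] {x y : ℝ} (hxy : x ≤ y)
    (n : ℕ) : Integrable (fun t => (stepTest n x y t : ℂ)) μ :=
  (Complex.continuous_ofReal.comp (contDiff_stepTest n x y).continuous).integrable_of_hasCompactSupport
    (isTestFunction_ofReal (isTestFunction_stepTest n hxy)).2

theorem IsDensity.locallyIntegrable {μ : Measure ℝ} [IsLocallyFiniteMeasure μ]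
    {R : ℝ → Matrix (Fin 2) (Fin 2) ℝ} {r : Coeff} (h : IsDensity μ R r) (i j : Fin 2) :
    LocallyIntegrable (fun t => R t i j) μ :=
  (locallyIntegrable_const (1 : ℝ)).mono (h.meas i j).aestronglyMeasurable
    (ae_of_all _ fun t => by simpa using h.bdd t i j)

theorem IsDensity.tendsto_pair_stepTest {μ : Measure ℝ} [IsLocallyFiniteMeasure μ]
    {R : ℝ → Matrix (Fin 2) (Fin 2) ℝ} {r : Coeff} (h : IsDensity μ R r) {x y : ℝ} (hxy : x ≤ y)
    (i j : Fin 2) :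
    Tendsto (fun n => (r i j).pair (stepTest n x y)) atTop (𝓝 (∫ t in Ico x y, R t i j ∂μ)) := by
  have h1 := tendsto_integral_stepTest μ hxy (f := fun t => (R t i j : ℂ))
    ((h.locallyIntegrable i j).integrableOn_isCompact isCompact_Icc).ofReal
  rw [integral_complex_ofReal] at h1
  have h2 := (Complex.continuous_re.tendsto _).comp h1
  refine h2.congr fun n => ?_
  simp only [Function.comp_apply]
  rw [← h.pair i j _ (integrable_mul_stepTest hxy n), OrderZeroDistribution.pair_ofReal,
    Complex.ofReal_re]

/-- Nonnegativity against step functions passes to integrals of each quadratic form over [x,y),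
hence to the density almost everywhere. The exceptional null set depends on the vector, so rational
vectors are used. -/
theorem IsDensity.ae_isPSD {μ : Measure ℝ} [IsLocallyFiniteMeasure μ]
    {R : ℝ → Matrix (Fin 2) (Fin 2) ℝ} {r : Coeff} (h : IsDensity μ R r) (hr : IsNonneg r) :
    ∀ᵐ t ∂μ, IsPSD (R t) := by
  have hli := h.locallyIntegrable
  have hion : ∀ i j x y, IntegrableOn (fun t => R t i j) (Ico x y) μ := fun i j x y =>
    ((hli i j).integrableOn_isCompact isCompact_Icc).mono_set Ico_subset_Icc_self
  have hsymm : ∀ x y, x ≤ y → ∫ t in Ico x y, R t 1 0 ∂μ = ∫ t in Ico x y, R t 0 1 ∂μ := by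
    intro x y hxy
    refine tendsto_nhds_unique (h.tendsto_pair_stepTest hxy 1 0)
      ((h.tendsto_pair_stepTest hxy 0 1).congr fun n => ?_)
    have := (hr _ (isTestFunction_stepTest n hxy) (stepTest_nonneg n hxy)).isHermitian.apply 0 1
    simpa using this.symm
  have hs : ∀ᵐ t ∂μ, R t 1 0 = R t 0 1 := by
    have h1 := ae_nonneg_of_setIntegral_Ico_nonneg ((hli 1 0).sub (hli 0 1)) fun x y hxy => by
      simp only [Pi.sub_apply]
      rw [integral_sub (hion _ _ _ _) (hion _ _ _ _), hsymm x y hxy, sub_self]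
    have h2 := ae_nonneg_of_setIntegral_Ico_nonneg ((hli 0 1).sub (hli 1 0)) fun x y hxy => by
      simp only [Pi.sub_apply]
      rw [integral_sub (hion _ _ _ _) (hion _ _ _ _), hsymm x y hxy, sub_self]
    filter_upwards [h1, h2] with t t1 t2
    simp only [Pi.sub_apply] at t1 t2
    linarith
  have hp : ∀ p s : ℝ, ∀ᵐ t ∂μ, 0 ≤ p ^ 2 * R t 0 0 + p * s * (R t 0 1 + R t 1 0) + s ^ 2 * R t 1 1 := by
    intro p s
    have hl : LocallyIntegrable
        (fun t => p ^ 2 * R t 0 0 + p * s * (R t 0 1 + R t 1 0) + s ^ 2 * R t 1 1) μ :=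
      (((hli 0 0).smul (p ^ 2)).add (((hli 0 1).add (hli 1 0)).smul (p * s))).add
        ((hli 1 1).smul (s ^ 2))
    refine ae_nonneg_of_setIntegral_Ico_nonneg hl fun x y hxy => ?_
    have e : ∫ t in Ico x y, (p ^ 2 * R t 0 0 + p * s * (R t 0 1 + R t 1 0) + s ^ 2 * R t 1 1) ∂μ
        = p ^ 2 * (∫ t in Ico x y, R t 0 0 ∂μ)
          + p * s * ((∫ t in Ico x y, R t 0 1 ∂μ) + ∫ t in Ico x y, R t 1 0 ∂μ)
          + s ^ 2 * ∫ t in Ico x y, R t 1 1 ∂μ := by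
      have i1 := (hion 0 0 x y).const_mul (p ^ 2)
      have i2 : Integrable (fun t => R t 0 1 + R t 1 0) (μ.restrict (Ico x y)) :=
        (hion 0 1 x y).add (hion 1 0 x y)
      have i3 := (hion 1 1 x y).const_mul (s ^ 2)
      have i12 : Integrable (fun t => p ^ 2 * R t 0 0 + p * s * (R t 0 1 + R t 1 0))
          (μ.restrict (Ico x y)) := i1.add (i2.const_mul (p * s))
      rw [integral_add i12 i3, integral_add i1 (i2.const_mul (p * s)),
        integral_const_mul, integral_const_mul, integral_const_mul,
        integral_add (hion 0 1 x y) (hion 1 0 x y)]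
    rw [e]
    have hlim := ((((h.tendsto_pair_stepTest hxy 0 0).const_mul (p ^ 2)).add
      (((h.tendsto_pair_stepTest hxy 0 1).add
        (h.tendsto_pair_stepTest hxy 1 0)).const_mul (p * s))).add
      ((h.tendsto_pair_stepTest hxy 1 1).const_mul (s ^ 2)))
    refine ge_of_tendsto' hlim fun n => ?_
    have := (hr _ (isTestFunction_stepTest n hxy) (stepTest_nonneg n hxy)).dotProduct_mulVec_nonneg
      ![p, s]
    simp only [dotProduct, Matrix.mulVec, Fin.sum_univ_two, Matrix.map_apply, Pi.star_apply,
      star_trivial, Matrix.cons_val_zero, Matrix.cons_val_one] at this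
    linarith
  have hq : ∀ᵐ t ∂μ, ∀ p s : ℚ,
      0 ≤ (p : ℝ) ^ 2 * R t 0 0 + p * s * (R t 0 1 + R t 1 0) + (s : ℝ) ^ 2 * R t 1 1 :=
    ae_all_iff.2 fun p => ae_all_iff.2 fun s => hp p s
  filter_upwards [hs, hq] with t ts tq
  refine isPSD_of_rat ts fun p s => ?_
  have := tq p s
  rw [ts] at this
  linarith

theorem measurableSet_isPSD {R : ℝ → Matrix (Fin 2) (Fin 2) ℝ}
    (h : ∀ i j, Measurable fun t => R t i j) : MeasurableSet {t | IsPSD (R t)} := by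
  have e : {t | IsPSD (R t)} = {t | R t 1 0 = R t 0 1} ∩ {t | 0 ≤ R t 0 0} ∩ {t | 0 ≤ R t 1 1}
      ∩ {t | R t 0 1 ^ 2 ≤ R t 0 0 * R t 1 1} := by
    ext t
    exact ⟨fun ht => ⟨⟨⟨ht.symm, ht.nonneg_zero⟩, ht.nonneg_one⟩, ht.sq_le⟩,
      fun ht => ⟨ht.1.1.1, ht.1.1.2, ht.1.2, ht.2⟩⟩
  rw [e]
  exact (((measurableSet_eq_fun (h 1 0) (h 0 1)).inter
    (measurableSet_le measurable_const (h 0 0))).inter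
    (measurableSet_le measurable_const (h 1 1))).inter
    (measurableSet_le ((h 0 1).pow_const 2) ((h 0 0).mul (h 1 1)))

/-- The coefficients of a periodic system have bounded densities with respect to a common locally
finite measure; they may be taken symmetric, and positive semidefinite for `w`, at every point. -/
theorem IsAdmissible.exists_density {ω : ℝ} {J : Matrix (Fin 2) (Fin 2) ℝ} {q w : Coeff}
    (hyp : IsAdmissible ω J q w) :
    ∃ (μ : Measure ℝ) (Q W : ℝ → Matrix (Fin 2) (Fin 2) ℝ), IsLocallyFiniteMeasure μ ∧
      IsDensity μ Q q ∧ IsDensity μ W w ∧ (∀ t, Q t 1 0 = Q t 0 1) ∧ ∀ t, IsPSD (W t) := by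
  classical
  set μ := totalMeasure q w with hμ
  set W₀ : ℝ → Matrix (Fin 2) (Fin 2) ℝ := fun t => Matrix.of fun i j => (w i j).density μ t with hW₀
  have hdw : IsDensity μ W₀ w := isDensity_density fun i j =>
    ⟨(entry_le_totalMeasure q w i j).2.2.1, (entry_le_totalMeasure q w i j).2.2.2⟩
  have hae := hdw.ae_isPSD hyp.w_nonneg
  have hset := measurableSet_isPSD hdw.meas
  have hzero : IsPSD 0 := ⟨rfl, le_rfl, le_rfl, by simp⟩
  -- W is set to zero on the null set where its density fails to be semidefinite. No pairing
  -- changes, and semidefiniteness holds at every point, atoms included.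
  refine ⟨μ, fun t => Matrix.of fun i j => (q i j).density μ t,
    fun t => if IsPSD (W₀ t) then W₀ t else 0, by rw [hμ]; infer_instance,
    isDensity_density fun i j => ⟨(entry_le_totalMeasure q w i j).1,
      (entry_le_totalMeasure q w i j).2.1⟩, ⟨fun i j => ?_, fun t i j => ?_, fun i j f hf => ?_⟩,
    fun t => ?_, fun t => ?_⟩
  · have : (fun t => (if IsPSD (W₀ t) then W₀ t else 0) i j)
        = fun t => if IsPSD (W₀ t) then W₀ t i j else 0 := by
      funext t; split_ifs <;> rfl
    rw [this]
    exact Measurable.ite hset (hdw.meas i j) measurable_const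
  · split_ifs
    · exact hdw.bdd t i j
    · simp
  · rw [hdw.pair i j f hf]
    refine integral_congr_ae ?_
    filter_upwards [hae] with t ht
    rw [if_pos ht]
  · have := congrFun (congrFun hyp.q_symm 0) 1
    simp only [Matrix.transpose_apply] at this
    simp only [Matrix.of_apply, this]
  · dsimp only
    split_ifs with ht
    · exact ht
    · exact hzero

end PeriodicSystem

/-! ### Regularity of functions of locally bounded variation -/

/-- A function that is bounded on bounded intervals. -/
def IsLocallyBdd (u : ℝ → Fin 2 → ℂ) : Prop := ∀ a b, ∃ K, ∀ t ∈ Icc a b, ‖u t‖ ≤ K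

theorem ContinuousLinearMap.comp_locallyBoundedVariationOn {E : Type*} [NormedAddCommGroup E]
    [NormedSpace ℝ E] (L : E →L[ℝ] ℝ) {u : ℝ → E} (hu : LocallyBoundedVariationOn u univ) :
    LocallyBoundedVariationOn (fun t => L (u t)) univ :=
  L.lipschitz.comp_locallyBoundedVariationOn hu

theorem LocallyBoundedVariationOn.measurable_of_pi {u : ℝ → Fin 2 → ℂ}
    (hu : LocallyBoundedVariationOn u univ) : Measurable u := by
  have hreal : ∀ f : ℝ → ℝ, LocallyBoundedVariationOn f univ → Measurable f := by
    intro f hf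
    obtain ⟨p, q, hp, hq, rfl⟩ := hf.exists_monotoneOn_sub_monotoneOn
    exact (monotoneOn_univ.1 hp).measurable.sub (monotoneOn_univ.1 hq).measurable
  refine measurable_pi_iff.2 fun i => ?_
  have h1 := hreal _ ((Complex.reCLM.comp
    (ContinuousLinearMap.proj (R := ℝ) (φ := fun _ : Fin 2 => ℂ) i)).comp_locallyBoundedVariationOn hu)
  have h2 := hreal _ ((Complex.imCLM.comp
    (ContinuousLinearMap.proj (R := ℝ) (φ := fun _ : Fin 2 => ℂ) i)).comp_locallyBoundedVariationOn hu)
  have e : (fun t => u t i) = fun t => ((u t i).re : ℂ) + (u t i).im * Complex.I := by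
    funext t; exact (Complex.re_add_im _).symm
  rw [e]
  exact (Complex.measurable_ofReal.comp h1).add ((Complex.measurable_ofReal.comp h2).mul_const _)

theorem LocallyBoundedVariationOn.isLocallyBdd {u : ℝ → Fin 2 → ℂ}
    (hu : LocallyBoundedVariationOn u univ) : IsLocallyBdd u := by
  intro a b
  rcases lt_or_ge b a with hab | hab
  · exact ⟨0, fun t ht => absurd (ht.1.trans ht.2) (not_le.2 hab)⟩
  have h := hu a b (mem_univ _) (mem_univ _)
  rw [univ_inter] at h
  refine ⟨‖u a‖ + (eVariationOn u (Icc a b)).toReal, fun t ht => ?_⟩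
  have := h.dist_le ht (left_mem_Icc.2 hab)
  rw [dist_eq_norm] at this
  linarith [norm_sub_norm_le (u t) (u a)]

theorem LocallyBoundedVariationOn.tendsto_leftLim' {u : ℝ → Fin 2 → ℂ}
    (hu : LocallyBoundedVariationOn u univ) (x : ℝ) :
    Tendsto u (𝓝[<] x) (𝓝 (Function.leftLim u x)) := by
  refine tendsto_leftLim_of_tendsto ?_
  have h := hu (x - 1) x (mem_univ _) (mem_univ _)
  rw [univ_inter] at h
  obtain ⟨l, hl⟩ := h.exists_tendsto_left x
  refine ⟨l, ?_⟩
  have e : 𝓝[Icc (x - 1) x ∩ Iio x] x = 𝓝[<] x := by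
    have : Icc (x - 1) x ∩ Iio x = Ico (x - 1) x := by
      ext t; simp only [mem_inter_iff, mem_Icc, mem_Iio, mem_Ico]; grind
    rw [this, nhdsWithin_Ico_eq_nhdsLT (by linarith)]
  rwa [e] at hl

theorem LocallyBoundedVariationOn.tendsto_rightLim' {u : ℝ → Fin 2 → ℂ}
    (hu : LocallyBoundedVariationOn u univ) (x : ℝ) :
    Tendsto u (𝓝[>] x) (𝓝 (Function.rightLim u x)) := by
  refine tendsto_rightLim_of_tendsto ?_
  have h := hu x (x + 1) (mem_univ _) (mem_univ _)
  rw [univ_inter] at h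
  obtain ⟨l, hl⟩ := h.exists_tendsto_right x
  refine ⟨l, ?_⟩
  have e : 𝓝[Icc x (x + 1) ∩ Ioi x] x = 𝓝[>] x := by
    have : Icc x (x + 1) ∩ Ioi x = Ioc x (x + 1) := by
      ext t; simp only [mem_inter_iff, mem_Icc, mem_Ioi, mem_Ioc]; grind
    rw [this, nhdsWithin_Ioc_eq_nhdsGT (by linarith)]
  rwa [e] at hl

theorem IsLocallyBdd.integrableOn {μ : Measure ℝ} [IsLocallyFiniteMeasure μ] {u : ℝ → Fin 2 → ℂ}
    (h : IsLocallyBdd u) (hm : Measurable u) (j : Fin 2) (a b : ℝ) :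
    IntegrableOn (fun t => u t j) (Icc a b) μ := by
  obtain ⟨K, hK⟩ := h a b
  have hfin : IsFiniteMeasure (μ.restrict (Icc a b)) :=
    ⟨by rw [Measure.restrict_apply_univ]; exact measure_Icc_lt_top⟩
  exact Integrable.of_bound (measurable_pi_iff.1 hm j).aestronglyMeasurable K
    ((ae_restrict_iff' measurableSet_Icc).2 (ae_of_all _ fun t ht =>
      (norm_le_pi_norm _ j).trans (hK t ht)))

theorem IsLocallyBdd.integrable_mul {μ : Measure ℝ} [IsLocallyFiniteMeasure μ] {u : ℝ → Fin 2 → ℂ}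
    (h : IsLocallyBdd u) (hm : Measurable u) (j : Fin 2) {φ : ℝ → ℂ} (hφ : Continuous φ)
    (hc : HasCompactSupport φ) : Integrable (fun t => u t j * φ t) μ := by
  obtain ⟨R, hR⟩ := hc.isCompact.isBounded.subset_closedBall 0
  rw [Real.closedBall_eq_Icc] at hR
  obtain ⟨C, hC⟩ := hc.exists_bound_of_continuous hφ
  have hz : ∀ t ∉ Icc (0 - R) (0 + R), u t j * φ t = 0 := fun t ht => by
    rw [image_eq_zero_of_notMem_tsupport fun h' => ht (hR h'), mul_zero]
  rw [← integrableOn_iff_integrable_of_support_subset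
    (Function.support_subset_iff'.2 hz)]
  exact (h.integrableOn hm j _ _).mul_bdd (c := C) hφ.aestronglyMeasurable (ae_of_all _ hC)

theorem countable_setOf_measure_singleton_pos (μ : Measure ℝ) [SFinite μ] :
    {x : ℝ | 0 < μ {x}}.Countable :=
  Measure.countable_meas_pos_of_disjoint_iUnion (fun x => measurableSet_singleton x)
    fun x y h => by simpa using h

theorem HasCompactSupport.integral_deriv_eq_zero' {φ : ℝ → ℂ} (h : ContDiff ℝ (⊤ : ℕ∞) φ)
    (hc : HasCompactSupport φ) : ∫ t, deriv φ t = 0 :=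
  integral_eq_zero_of_hasDerivAt_of_integrable
    (fun t => ((h.differentiable (by simp)) t).hasDerivAt)
    ((h.continuous_deriv (by simp)).integrable_of_hasCompactSupport hc.deriv)
    (h.continuous.integrable_of_hasCompactSupport hc)

/-! ### Equivalence of the distributional and the integrated equation -/

section

variable {μ : Measure ℝ} [IsLocallyFiniteMeasure μ] {A : ℝ → Matrix (Fin 2) (Fin 2) ℂ}
  {u v : ℝ → Fin 2 → ℂ}

/-- Integrated solutions solve the equation in the sense of distributions. -/
theorem IntSol.neg_integral_mul_deriv (hA : IsTracelessCoeff A) (h : IntSol μ A u v) {φ : ℝ → ℂ}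
    (hφ : IsTestFunction φ) (j : Fin 2) :
    -∫ t, u t j * deriv φ t = ∫ t, (A t *ᵥ u t) j * φ t ∂μ := by
  obtain ⟨hcd, hc⟩ := hφ
  obtain ⟨R, hR⟩ := hc.isCompact.isBounded.subset_closedBall 0
  rw [Real.closedBall_eq_Icc] at hR
  set a := 0 - R with ha
  set b := 0 + R + 1 with hb
  have hzφ : ∀ t ∉ Ico a b, φ t = 0 := fun t ht =>
    image_eq_zero_of_notMem_tsupport fun h' =>
      ht ⟨(hR h').1, (hR h').2.trans_lt (by rw [hb]; linarith)⟩
  have hzφ' : ∀ t ∉ Ico a b, deriv φ t = 0 := fun t ht =>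
    image_eq_zero_of_notMem_tsupport fun h' => by
      have := hR (tsupport_deriv_subset (𝕜 := ℝ) h')
      exact ht ⟨this.1, this.2.trans_lt (by rw [hb]; linarith)⟩
  have hdi : Integrable (deriv φ) :=
    (hcd.continuous_deriv (by simp)).integrable_of_hasCompactSupport hc.deriv
  -- Integration by parts in the form of Fubini: the inner integral of φ' over (t,∞) is -φ(t), and
  -- the other inner integral is the increment of v.
  obtain ⟨-, i2, e⟩ := integral_mul_integral_Ioi_eq (μ.restrict (Ico a b)) volume
    ((h a b).integrableOn hA j) hdi
  have e1 : ∀ t, ∫ s in Ioi t, deriv φ s = -φ t := fun t =>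
    hc.integral_Ioi_deriv_eq (hcd.of_le (by exact_mod_cast le_top)) t
  have e2 : ∀ s, (∫ t in Iio s, (A t *ᵥ u t) j ∂(μ.restrict (Ico a b))) * deriv φ s
      = (v s j - v a j) * deriv φ s := by
    intro s
    by_cases hs : s ∈ Ico a b
    · have er : (μ.restrict (Ico a b)).restrict (Iio s) = μ.restrict (Ico a s) := by
        rw [Measure.restrict_restrict measurableSet_Iio]
        congr 1
        ext t
        simp only [mem_inter_iff, mem_Iio, mem_Ico]
        exact ⟨fun ht => ⟨ht.2.1, ht.1⟩, fun ht => ⟨ht.2, ht.1, ht.2.trans hs.2⟩⟩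
      rw [er, ← (h a s).eq a s le_rfl hs.1 le_rfl]
    · rw [hzφ' s hs, mul_zero, mul_zero]
  simp only [e1, e2] at e i2
  have i3 : Integrable fun s => v s j * deriv φ s := by
    refine (i2.add (hdi.const_mul (v a j))).congr (ae_of_all _ fun s => ?_)
    simp only [Pi.add_apply]
    ring
  have e3 : ∫ s, (v s j - v a j) * deriv φ s = ∫ s, v s j * deriv φ s := by
    simp only [sub_mul]
    rw [integral_sub i3 (hdi.const_mul _), integral_const_mul,
      HasCompactSupport.integral_deriv_eq_zero' hcd hc, mul_zero, sub_zero]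
  -- u and v differ only at atoms of μ. These are countably many, hence a Lebesgue null set.
  have e4 : ∫ s, u s j * deriv φ s = ∫ s, v s j * deriv φ s := by
    refine integral_congr_ae ?_
    have : ∀ᵐ s : ℝ, s ∉ {x : ℝ | 0 < μ {x}} :=
      ((countable_setOf_measure_singleton_pos μ).ae_notMem volume)
    filter_upwards [this] with s hs
    have hs0 : μ.real {s} = 0 := by
      have hs' : μ {s} = 0 := nonpos_iff_eq_zero.1 (not_lt.1 hs)
      simp [Measure.real, hs']
    have := (h s (s + 1)).bal s ⟨le_rfl, by linarith⟩ j
    rw [hs0] at this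
    rw [this]
    simp
  have e5 : ∫ t in Ico a b, (A t *ᵥ u t) j * -φ t ∂μ = -∫ t, (A t *ᵥ u t) j * φ t ∂μ := by
    rw [setIntegral_eq_integral_of_forall_compl_eq_zero fun t ht => by rw [hzφ t ht]; simp]
    simp only [mul_neg, integral_neg]
  rw [e4, ← e3, ← e, e5, neg_neg]

end

namespace PeriodicSystem

/-- The matrix `l w - q` on the level of densities. -/
noncomputable def hMat (Q W : ℝ → Matrix (Fin 2) (Fin 2) ℝ) (l : ℂ) (t : ℝ) :
    Matrix (Fin 2) (Fin 2) ℂ := Matrix.of fun i j => l * W t i j - Q t i j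

/-- The matrix `J⁻¹ (l w - q)` on the level of densities, for `J = !![0, -c; c, 0]`. -/
noncomputable def aMat (c : ℝ) (Q W : ℝ → Matrix (Fin 2) (Fin 2) ℝ) (l : ℂ) (t : ℝ) :
    Matrix (Fin 2) (Fin 2) ℂ :=
  !![hMat Q W l t 1 0 / c, hMat Q W l t 1 1 / c; -hMat Q W l t 0 0 / c, -hMat Q W l t 0 1 / c]

/-- A system presented by densities with respect to a locally finite measure. -/
structure IsModel (c : ℝ) (J : Matrix (Fin 2) (Fin 2) ℝ) (q w : Coeff) (μ : Measure ℝ)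
    (Q W : ℝ → Matrix (Fin 2) (Fin 2) ℝ) : Prop where
  J_eq : J = !![0, -c; c, 0]
  c_ne : c ≠ 0
  dq : IsDensity μ Q q
  dw : IsDensity μ W w
  Q_symm : ∀ t, Q t 1 0 = Q t 0 1
  W_psd : ∀ t, IsPSD (W t)

theorem IsAdmissible.exists_isModel {ω : ℝ} {J : Matrix (Fin 2) (Fin 2) ℝ} {q w : Coeff}
    (hyp : IsAdmissible ω J q w) :
    ∃ (c : ℝ) (μ : Measure ℝ) (Q W : ℝ → Matrix (Fin 2) (Fin 2) ℝ), IsLocallyFiniteMeasure μ ∧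
      IsModel c J q w μ Q W := by
  obtain ⟨μ, Q, W, hμ, hq, hw, hs, hp⟩ := hyp.exists_density
  have h00 := congrFun (congrFun hyp.skew 0) 0
  have h01 := congrFun (congrFun hyp.skew 1) 0
  have h11 := congrFun (congrFun hyp.skew 1) 1
  simp only [Matrix.transpose_apply, Matrix.neg_apply] at h00 h01 h11
  have hJ : J = !![0, -(J 1 0); J 1 0, 0] := by
    ext i j
    fin_cases i <;> fin_cases j <;> simp <;> linarith
  refine ⟨J 1 0, μ, Q, W, hμ, hJ, fun hc => ?_, hq, hw, hs, hp⟩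
  have hd := (Matrix.isUnit_iff_isUnit_det J).1 hyp.invertible
  rw [Matrix.det_fin_two, hc, show J 0 0 = 0 by linarith] at hd
  simp at hd

variable {c : ℝ} {J : Matrix (Fin 2) (Fin 2) ℝ} {q w : Coeff} {μ : Measure ℝ}
  {Q W : ℝ → Matrix (Fin 2) (Fin 2) ℝ}

namespace IsModel

theorem measurable_hMat (h : IsModel c J q w μ Q W) (l : ℂ) (i j : Fin 2) :
    Measurable fun t => hMat Q W l t i j :=
  ((Complex.measurable_ofReal.comp (h.dw.meas i j)).const_mul l).sub
    (Complex.measurable_ofReal.comp (h.dq.meas i j))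

theorem norm_hMat_le (h : IsModel c J q w μ Q W) (l : ℂ) (t : ℝ) (i j : Fin 2) :
    ‖hMat Q W l t i j‖ ≤ ‖l‖ + 1 := by
  refine (norm_sub_le _ _).trans ?_
  rw [norm_mul, Complex.norm_real, Complex.norm_real, Real.norm_eq_abs, Real.norm_eq_abs]
  have := mul_le_mul_of_nonneg_left (h.dw.bdd t i j) (norm_nonneg l)
  linarith [h.dq.bdd t i j]

theorem hMat_symm (h : IsModel c J q w μ Q W) (l : ℂ) (t : ℝ) :
    hMat Q W l t 1 0 = hMat Q W l t 0 1 := by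
  simp only [hMat, Matrix.of_apply, h.Q_symm t, (h.W_psd t).symm]

theorem isTracelessCoeff (h : IsModel c J q w μ Q W) (l : ℂ) : IsTracelessCoeff (aMat c Q W l) where
  meas i j := by
    fin_cases i <;> fin_cases j
    · exact (h.measurable_hMat l 1 0).div_const _
    · exact (h.measurable_hMat l 1 1).div_const _
    · exact (h.measurable_hMat l 0 0).neg.div_const _
    · exact (h.measurable_hMat l 0 1).neg.div_const _
  bdd := by
    refine ⟨(‖l‖ + 1) / ‖(c : ℂ)‖, fun t i j => ?_⟩
    fin_cases i <;> fin_cases j <;> simp only [aMat, Matrix.of_apply, Fin.zero_eta, Fin.mk_one,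
      Matrix.cons_val', Matrix.cons_val_zero, Matrix.cons_val_one, Matrix.cons_val_fin_one,
      norm_div, norm_neg] <;> gcongr <;> exact h.norm_hMat_le l t _ _
  trace t := by
    simp only [aMat, Matrix.of_apply, Matrix.cons_val', Matrix.cons_val_zero, Matrix.cons_val_one,
      Matrix.cons_val_fin_one, h.hMat_symm l t]
    ring

theorem aMat_mulVec_zero (c : ℝ) (Q W : ℝ → Matrix (Fin 2) (Fin 2) ℝ) (l : ℂ) (t : ℝ)
    (z : Fin 2 → ℂ) : (aMat c Q W l t *ᵥ z) 0 = (hMat Q W l t *ᵥ z) 1 / c := by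
  simp only [aMat, Matrix.mulVec, dotProduct, Fin.sum_univ_two, Matrix.of_apply, Matrix.cons_val',
    Matrix.cons_val_zero, Matrix.cons_val_one, Matrix.cons_val_fin_one]
  ring

theorem aMat_mulVec_one (c : ℝ) (Q W : ℝ → Matrix (Fin 2) (Fin 2) ℝ) (l : ℂ) (t : ℝ)
    (z : Fin 2 → ℂ) : (aMat c Q W l t *ᵥ z) 1 = -(hMat Q W l t *ᵥ z) 0 / c := by
  simp only [aMat, Matrix.mulVec, dotProduct, Fin.sum_univ_two, Matrix.of_apply, Matrix.cons_val',
    Matrix.cons_val_zero, Matrix.cons_val_one, Matrix.cons_val_fin_one]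
  ring

variable [IsLocallyFiniteMeasure μ] {u v : ℝ → Fin 2 → ℂ} {l : ℂ}

omit [IsLocallyFiniteMeasure μ] in
theorem mulApply_eq {r : Coeff} {R : ℝ → Matrix (Fin 2) (Fin 2) ℝ} (hR : IsDensity μ R r)
    {φ : ℝ → ℂ} (hi : ∀ j, Integrable (fun t => u t j * φ t) μ) (i : Fin 2) :
    mulApply r u φ i = ∑ j, ∫ t, (R t i j : ℂ) * (u t j * φ t) ∂μ :=
  Finset.sum_congr rfl fun j _ => hR.pair i j _ (hi j)

omit [IsLocallyFiniteMeasure μ] in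
theorem _root_.PeriodicSystem.IsDensity.integrable_mul {r : Coeff}
    {R : ℝ → Matrix (Fin 2) (Fin 2) ℝ} (hR : IsDensity μ R r) {ν : Measure ℝ} {f : ℝ → ℂ}
    (hf : Integrable f ν) (i j : Fin 2) : Integrable (fun t => (R t i j : ℂ) * f t) ν :=
  hf.bdd_mul (c := 1) (Complex.measurable_ofReal.comp (hR.meas i j)).aestronglyMeasurable
    (ae_of_all _ fun t => by rw [Complex.norm_real]; exact hR.bdd t i j)

omit [IsLocallyFiniteMeasure μ] in
theorem integral_hMat_mul (h : IsModel c J q w μ Q W) (l : ℂ) {ν : Measure ℝ}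
    {f : Fin 2 → ℝ → ℂ} (hf : ∀ j, Integrable (f j) ν) (i : Fin 2) :
    ∫ t, ∑ j, hMat Q W l t i j * f j t ∂ν
      = l * ∑ j, ∫ t, (W t i j : ℂ) * f j t ∂ν - ∑ j, ∫ t, (Q t i j : ℂ) * f j t ∂ν := by
  have iW := fun j => (h.dw.integrable_mul (hf j) i j).const_mul l
  have iQ := fun j => h.dq.integrable_mul (hf j) i j
  have e : ∀ t j, hMat Q W l t i j * f j t
      = l * ((W t i j : ℂ) * f j t) - (Q t i j : ℂ) * f j t := fun t j => by
    simp only [hMat, Matrix.of_apply]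
    ring
  have iS : ∀ j, Integrable (fun t => l * ((W t i j : ℂ) * f j t) - (Q t i j : ℂ) * f j t) ν :=
    fun j => (iW j).sub (iQ j)
  simp only [e]
  rw [integral_finsetSum _ fun j _ => iS j]
  simp only [integral_sub (iW _) (iQ _), integral_const_mul, Finset.sum_sub_distrib, Finset.mul_sum]

/-- Integrated solutions of bounded variation are solutions in the sense of distributions. -/
theorem isSolution (h : IsModel c J q w μ Q W) (hs : IntSol μ (aMat c Q W l) u v) :
    IsSolution J q w l u := by
  have hA := h.isTracelessCoeff l
  have hbv := hs.isBalancedBV hA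
  refine ⟨hbv, fun φ hφ i => ?_⟩
  have hi : ∀ j, Integrable (fun t => u t j * φ t) μ := fun j =>
    hbv.1.isLocallyBdd.integrable_mul hbv.1.measurable_of_pi j hφ.1.continuous hφ.2
  have hd := fun j => hs.neg_integral_mul_deriv hA hφ j
  have hc : (c : ℂ) ≠ 0 := by exact_mod_cast h.c_ne
  have hH : ∀ i, ∫ t, (hMat Q W l t *ᵥ u t) i * φ t ∂μ
      = l * mulApply w u φ i - mulApply q u φ i := by
    intro i
    rw [mulApply_eq h.dw hi, mulApply_eq h.dq hi, ← h.integral_hMat_mul l hi i]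
    refine integral_congr_ae (ae_of_all _ fun t => ?_)
    simp only [Matrix.mulVec, dotProduct, Finset.sum_mul, mul_assoc]
  have h0 := hd 0
  have h1 := hd 1
  have q0 : ∫ t, (aMat c Q W l t *ᵥ u t) 0 * φ t ∂μ
      = (l * mulApply w u φ 1 - mulApply q u φ 1) / c := by
    rw [← hH, ← integral_div]
    simp only [aMat_mulVec_zero]
    exact integral_congr_ae (ae_of_all _ fun t => by ring)
  have q1 : ∫ t, (aMat c Q W l t *ᵥ u t) 1 * φ t ∂μ
      = -(l * mulApply w u φ 0 - mulApply q u φ 0) / c := by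
    rw [← hH, ← integral_neg, ← integral_div]
    simp only [aMat_mulVec_one]
    exact integral_congr_ae (ae_of_all _ fun t => by ring)
  rw [q0] at h0
  rw [q1] at h1
  fin_cases i
  · simp only [derivApply, Fin.sum_univ_two, h.J_eq, Fin.zero_eta, Matrix.of_apply,
      Matrix.cons_val', Matrix.cons_val_zero, Matrix.cons_val_one, Matrix.cons_val_fin_one, h0, h1]
    push_cast
    field_simp
    ring
  · simp only [derivApply, Fin.sum_univ_two, h.J_eq, Fin.mk_one, Matrix.of_apply,
      Matrix.cons_val', Matrix.cons_val_zero, Matrix.cons_val_one, Matrix.cons_val_fin_one, h0, h1]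
    push_cast
    field_simp
    ring

/-- Solutions in the sense of distributions satisfy the integrated equation. -/
theorem leftLim_sub_eq (h : IsModel c J q w μ Q W) (hs : IsSolution J q w l u) {x y : ℝ}
    (hxy : x ≤ y) (i : Fin 2) : Function.leftLim u y i - Function.leftLim u x i
      = ∫ t in Ico x y, (aMat c Q W l t *ᵥ u t) i ∂μ := by
  obtain ⟨⟨hbv, -⟩, heq⟩ := hs
  have hm := hbv.measurable_of_pi
  have hb := hbv.isLocallyBdd
  have hc : (c : ℂ) ≠ 0 := by exact_mod_cast h.c_ne
  have hφ : ∀ n, IsTestFunction fun t => (stepTest n x y t : ℂ) := fun n =>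
    isTestFunction_ofReal (isTestFunction_stepTest n hxy)
  have hi : ∀ n j, Integrable (fun t => u t j * (stepTest n x y t : ℂ)) μ := fun n j =>
    hb.integrable_mul hm j (hφ n).1.continuous (hφ n).2
  have hd : ∀ j, Tendsto (fun n => -∫ t, u t j * deriv (fun t => (stepTest n x y t : ℂ)) t) atTop
      (𝓝 (Function.leftLim u y j - Function.leftLim u x j)) := fun j =>
    tendsto_neg_integral_mul_deriv_stepTest (measurable_pi_iff.1 hm j)
      (fun a b => let ⟨K, hK⟩ := hb a b; ⟨K, fun t ht => (norm_le_pi_norm _ j).trans (hK t ht)⟩)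
      (((continuous_apply j).tendsto _).comp (hbv.tendsto_leftLim' x))
      (((continuous_apply j).tendsto _).comp (hbv.tendsto_leftLim' y))
  have hR : ∀ {r : Coeff} {R : ℝ → Matrix (Fin 2) (Fin 2) ℝ}, IsDensity μ R r → ∀ i,
      Tendsto (fun n => mulApply r u (fun t => (stepTest n x y t : ℂ)) i) atTop
        (𝓝 (∑ j, ∫ t in Ico x y, (R t i j : ℂ) * u t j ∂μ)) := by
    intro r R hR i
    refine Tendsto.congr (fun n => (mulApply_eq hR (hi n) i).symm) ?_
    refine tendsto_finsetSum _ fun j _ => ?_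
    have := tendsto_integral_stepTest μ hxy (f := fun t => (R t i j : ℂ) * u t j)
      (hR.integrable_mul (hb.integrableOn hm j _ _) i j)
    simpa only [mul_assoc] using this
  have hlim : ∀ i, ∑ j, (J i j : ℂ) * (Function.leftLim u y j - Function.leftLim u x j)
      + ∑ j, ∫ t in Ico x y, (Q t i j : ℂ) * u t j ∂μ
      = l * ∑ j, ∫ t in Ico x y, (W t i j : ℂ) * u t j ∂μ := by
    intro i
    have h1 := (tendsto_finsetSum (Finset.univ : Finset (Fin 2))
      fun j _ => (hd j).const_mul (J i j : ℂ)).add (hR h.dq i)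
    have h2 := (hR h.dw i).const_mul l
    exact tendsto_nhds_unique h1 (h2.congr fun n => (heq _ (hφ n) i).symm)
  have hio : ∀ j, IntegrableOn (fun t => u t j) (Ico x y) μ := fun j =>
    (hb.integrableOn hm j x y).mono_set Ico_subset_Icc_self
  have hH : ∀ i, ∫ t in Ico x y, (hMat Q W l t *ᵥ u t) i ∂μ
      = ∑ j, (J i j : ℂ) * (Function.leftLim u y j - Function.leftLim u x j) := by
    intro i
    rw [eq_sub_of_add_eq (hlim i), ← h.integral_hMat_mul l hio i]
    rfl
  have h0 := hH 0
  have h1 := hH 1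
  simp only [Fin.sum_univ_two, h.J_eq, Matrix.of_apply, Matrix.cons_val', Matrix.cons_val_zero,
    Matrix.cons_val_one, Matrix.cons_val_fin_one] at h0 h1
  push_cast at h0 h1
  fin_cases i
  · simp only [Fin.zero_eta, aMat_mulVec_zero]
    rw [integral_div, h1]
    field_simp
    ring
  · simp only [Fin.mk_one, aMat_mulVec_one]
    rw [integral_div, integral_neg, h0]
    field_simp
    ring

theorem intSol (h : IsModel c J q w μ Q W) (hs : IsSolution J q w l u) :
    IntSol μ (aMat c Q W l) u (Function.leftLim u) := by
  intro a b
  have hbv := hs.1.1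
  have hm := hbv.measurable_of_pi
  obtain ⟨K, hK⟩ := hbv.isLocallyBdd a b
  refine ⟨hm, ⟨K, fun t ht => hK t ⟨ht.1, ht.2.le⟩⟩, fun x y _ hxy _ i => h.leftLim_sub_eq hs hxy i,
    fun x _ i => ?_⟩
  obtain ⟨C, hC⟩ := (h.isTracelessCoeff l).bdd
  obtain ⟨K', hK'⟩ := hbv.isLocallyBdd x (x + 1)
  have hC0 : 0 ≤ C := (norm_nonneg _).trans (hC 0 0 0)
  have hbd : ∀ t ∈ Icc x (x + 1), ∀ i, ‖(aMat c Q W l t *ᵥ u t) i‖ ≤ 2 * C * K' := fun t ht i =>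
    (norm_mulVec_le (hC t) _ _).trans (by gcongr; exact hK' t ht)
  -- The left-limit function, approached from the right of x, has picked up the full atom at x. This
  -- limit is also the right limit of u, so averaging with the left limit leaves the half-atom of
  -- the balance condition.
  have hlim : Tendsto (Function.leftLim u) (𝓝[>] x)
      (𝓝 fun i => Function.leftLim u x i + μ.real {x} * (aMat c Q W l x *ᵥ u x) i) := by
    rw [tendsto_pi_nhds]
    intro i
    rw [tendsto_iff_norm_sub_tendsto_zero]
    have hz : Tendsto (fun y => 2 * C * K' * μ.real (Ioc x y)) (𝓝[>] x) (𝓝 0) := by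
      simpa using (tendsto_measureReal_Ioc_right μ x).const_mul (2 * C * K')
    refine squeeze_zero' (Eventually.of_forall fun y => norm_nonneg _) ?_ hz
    filter_upwards [Ioo_mem_nhdsGT (show x < x + 1 by linarith)] with y hy
    have hion : IntegrableOn (fun t => (aMat c Q W l t *ᵥ u t) i) (Ico x y) μ := by
      have hfin : IsFiniteMeasure (μ.restrict (Ico x y)) :=
        ⟨by rw [Measure.restrict_apply_univ]; exact measure_Ico_lt_top⟩
      refine Integrable.of_bound (measurable_mulVec (h.isTracelessCoeff l).meas
        hm i).aestronglyMeasurable (2 * C * K') ?_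
      exact (ae_restrict_iff' measurableSet_Ico).2 (ae_of_all _ fun t ht =>
        hbd t ⟨ht.1, ht.2.le.trans hy.2.le⟩ i)
    have e1 := h.leftLim_sub_eq hs hy.1.le i
    rw [setIntegral_Ico_eq_add_Ioo hy.1 hion] at e1
    have e2 : Function.leftLim u y i - (Function.leftLim u x i
        + μ.real {x} * (aMat c Q W l x *ᵥ u x) i)
        = ∫ t in Ioo x y, (aMat c Q W l t *ᵥ u t) i ∂μ := by linear_combination e1
    rw [e2]
    refine (norm_setIntegral_le_of_norm_le_const measure_Ioo_lt_top
      fun t ht => hbd t ⟨ht.1.le, ht.2.le.trans hy.2.le⟩ i).trans ?_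
    have : 0 ≤ K' := (norm_nonneg _).trans (hK' x ⟨le_rfl, by linarith⟩)
    gcongr
    · exact measure_Ioc_lt_top.ne
    · exact Ioo_subset_Ioc_self
  have hr := rightLim_eq_of_tendsto hlim
  rw [rightLim_leftLim (hbv.tendsto_rightLim' x)] at hr
  have hb := congrFun (hs.1.2 x) i
  rw [hr] at hb
  simp only [Pi.smul_apply, Pi.add_apply, smul_eq_mul] at hb
  rw [hb]
  ring

end IsModel

end PeriodicSystem

/-! ### Inverting the jump condition at atoms -/

/-- The determinant of `1 - (μ{t} / 2) A(t)` for trace-free `A`. -/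
noncomputable def jumpDet (μ : Measure ℝ) (A : ℝ → Matrix (Fin 2) (Fin 2) ℂ) (t : ℝ) : ℂ :=
  1 + (μ.real {t} / 2) ^ 2 * (A t 0 0 * A t 1 1 - A t 0 1 * A t 1 0)

section JumpDet

variable {μ : Measure ℝ} [IsLocallyFiniteMeasure μ] {A : ℝ → Matrix (Fin 2) (Fin 2) ℂ}

theorem measurable_measureReal_singleton (μ : Measure ℝ) [IsLocallyFiniteMeasure μ] :
    Measurable fun t => μ.real {t} := by
  refine (measurable_const (a := (0 : ℝ))).measurable_of_countable_ne
    ((countable_setOf_measure_singleton_pos μ).mono fun t ht => ?_)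
  by_contra h
  have hs : μ {t} = 0 := nonpos_iff_eq_zero.1 (not_lt.1 h)
  exact ht (by simp [Measure.real, hs])

theorem finite_setOf_le_measureReal_singleton (μ : Measure ℝ) [IsLocallyFiniteMeasure μ] (a b : ℝ)
    {δ : ℝ} (hδ : 0 < δ) : {t | t ∈ Icc a b ∧ δ ≤ μ.real {t}}.Finite := by
  by_contra hinf
  have h := Set.Infinite.meas_eq_top (μ := μ) hinf ⟨ENNReal.ofReal δ, by simpa using hδ, fun t ht => by
    rw [← ofReal_measureReal isCompact_singleton.measure_lt_top.ne]
    exact ENNReal.ofReal_le_ofReal ht.2⟩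
  have := (measure_mono (fun t ht => ht.1 : {t | t ∈ Icc a b ∧ δ ≤ μ.real {t}} ⊆ Icc a b)).trans_lt
    (measure_Icc_lt_top (μ := μ) (a := a) (b := b))
  exact absurd h this.ne

theorem norm_det_le {M : Matrix (Fin 2) (Fin 2) ℂ} {C : ℝ} (hC : ∀ i j, ‖M i j‖ ≤ C) :
    ‖M 0 0 * M 1 1 - M 0 1 * M 1 0‖ ≤ 2 * C ^ 2 := by
  have hC0 : 0 ≤ C := (norm_nonneg _).trans (hC 0 0)
  refine (norm_sub_le _ _).trans ?_
  rw [norm_mul, norm_mul]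
  have h1 := mul_le_mul (hC 0 0) (hC 1 1) (norm_nonneg _) hC0
  have h2 := mul_le_mul (hC 0 1) (hC 1 0) (norm_nonneg _) hC0
  linarith

omit [IsLocallyFiniteMeasure μ] in
theorem norm_half_measureReal_sq (t : ℝ) : ‖((μ.real {t} : ℂ) / 2) ^ 2‖ = (μ.real {t} / 2) ^ 2 := by
  rw [norm_pow, norm_div, Complex.norm_real, Real.norm_of_nonneg measureReal_nonneg]
  norm_num

/-- A compact interval contains only finitely many atoms of mass at least δ, and all other points
have a determinant within 1/2 of 1. If the determinant vanishes at an atom, its inverse is 0 by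
convention, so no nonvanishing is needed. -/
theorem exists_norm_inv_jumpDet_le (hA : IsTracelessCoeff A) (a b : ℝ) : ∃ K, ∀ t ∈ Icc a b, ‖(jumpDet μ A t)⁻¹‖ ≤ K := by
  obtain ⟨C, hC⟩ := hA.bdd
  have hC0 : 0 ≤ C := (norm_nonneg _).trans (hC 0 0 0)
  -- For mass m < δ one has mC ≤ 1, so the perturbation is at most (m/2)²·2C² ≤ 1/2.
  set δ : ℝ := 1 / (C + 1) with hδ
  have hδ0 : 0 < δ := by positivity
  obtain ⟨K, hK⟩ := ((finite_setOf_le_measureReal_singleton μ a b hδ0).image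
    fun t => ‖(jumpDet μ A t)⁻¹‖).bddAbove
  refine ⟨max K 2, fun t ht => ?_⟩
  rcases le_or_gt δ (μ.real {t}) with hm | hm
  · exact (hK ⟨t, ⟨ht, hm⟩, rfl⟩).trans (le_max_left _ _)
  · refine le_trans ?_ (le_max_right _ _)
    have h1 : μ.real {t} * C ≤ 1 := by
      have : μ.real {t} * (C + 1) ≤ 1 := by
        rw [hδ, lt_div_iff₀ (by positivity)] at hm
        exact hm.le
      nlinarith [measureReal_nonneg (μ := μ) (s := {t})]
    have h2 : ‖(μ.real {t} / 2 : ℂ) ^ 2 * (A t 0 0 * A t 1 1 - A t 0 1 * A t 1 0)‖ ≤ 1 / 2 := by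
      rw [norm_mul, norm_half_measureReal_sq]
      have h3 := mul_le_mul_of_nonneg_left (norm_det_le (hC t)) (sq_nonneg (μ.real {t} / 2))
      have h4 : 0 ≤ μ.real {t} * C := mul_nonneg measureReal_nonneg hC0
      nlinarith
    have h5 : 1 / 2 ≤ ‖jumpDet μ A t‖ := by
      have := norm_sub_norm_le (1 : ℂ) (-((μ.real {t} / 2 : ℂ) ^ 2 *
        (A t 0 0 * A t 1 1 - A t 0 1 * A t 1 0)))
      rw [sub_neg_eq_add, norm_one, norm_neg] at this
      rw [jumpDet]
      linarith
    rw [norm_inv]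
    exact inv_le_of_inv_le₀ (by norm_num) (by linarith)

/-- The inverse of `1 - (μ{t} / 2) A(t)`. -/
noncomputable def jumpInv (μ : Measure ℝ) (A : ℝ → Matrix (Fin 2) (Fin 2) ℂ) (t : ℝ) :
    Matrix (Fin 2) (Fin 2) ℂ := (jumpDet μ A t)⁻¹ • (1 + ((μ.real {t} / 2 : ℝ) : ℂ) • A t)

omit [IsLocallyFiniteMeasure μ] in
-- Cayley–Hamilton for a trace-free matrix gives A² = -det A, so (1-sA)(1+sA) = 1 + s² det A. In
-- particular the jump conditions with either sign are invertible simultaneously.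
theorem one_sub_mul_one_add (hA : IsTracelessCoeff A) (t : ℝ) :
    (1 - ((μ.real {t} / 2 : ℝ) : ℂ) • A t) * (1 + ((μ.real {t} / 2 : ℝ) : ℂ) • A t)
      = jumpDet μ A t • (1 : Matrix (Fin 2) (Fin 2) ℂ) := by
  have ht : A t 1 1 = -A t 0 0 := by linear_combination hA.trace t
  ext i j
  fin_cases i <;> fin_cases j <;>
    simp [Matrix.mul_apply, Fin.sum_univ_two, jumpDet, ht] <;> ring

omit [IsLocallyFiniteMeasure μ] in
theorem one_sub_mul_jumpInv (hA : IsTracelessCoeff A) {t : ℝ} (h0 : jumpDet μ A t ≠ 0) :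
    (1 - ((μ.real {t} / 2 : ℝ) : ℂ) • A t) * jumpInv μ A t = 1 := by
  rw [jumpInv, Matrix.mul_smul, one_sub_mul_one_add hA, smul_smul, inv_mul_cancel₀ h0, one_smul]

theorem measurable_jumpInv (hA : IsTracelessCoeff A) (i j : Fin 2) :
    Measurable fun t => jumpInv μ A t i j := by
  have hm : Measurable fun t => (μ.real {t} : ℂ) :=
    Complex.measurable_ofReal.comp (measurable_measureReal_singleton μ)
  have hd : Measurable (jumpDet μ A) :=
    (((hm.div_const 2).pow_const 2).mul (((hA.meas 0 0).mul (hA.meas 1 1)).sub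
      ((hA.meas 0 1).mul (hA.meas 1 0)))).const_add 1
  have e : (fun t => jumpInv μ A t i j) = fun t => (jumpDet μ A t)⁻¹ *
      ((1 : Matrix (Fin 2) (Fin 2) ℂ) i j + (μ.real {t} : ℂ) / 2 * A t i j) := by
    funext t
    simp [jumpInv]
  rw [e]
  exact hd.inv.mul (((hm.div_const 2).mul (hA.meas i j)).const_add _)

theorem exists_norm_jumpInv_le (hA : IsTracelessCoeff A) (a b : ℝ) : ∃ K, ∀ t ∈ Ico a b, ∀ i j, ‖jumpInv μ A t i j‖ ≤ K := by
  obtain ⟨K, hK⟩ := exists_norm_inv_jumpDet_le (μ := μ) hA a b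
  obtain ⟨C, hC⟩ := hA.bdd
  have hC0 : 0 ≤ C := (norm_nonneg _).trans (hC 0 0 0)
  refine ⟨K * (1 + μ.real (Icc a b) / 2 * C), fun t ht i j => ?_⟩
  have hm : μ.real {t} ≤ μ.real (Icc a b) :=
    measureReal_mono (singleton_subset_iff.2 ⟨ht.1, ht.2.le⟩) measure_Icc_lt_top.ne
  have h1 : ‖(1 : Matrix (Fin 2) (Fin 2) ℂ) i j‖ ≤ 1 := by
    rw [Matrix.one_apply]; split_ifs <;> simp
  have hKt := hK t ⟨ht.1, ht.2.le⟩
  rw [jumpInv, Matrix.smul_apply, smul_eq_mul, norm_mul, Matrix.add_apply, Matrix.smul_apply,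
    smul_eq_mul]
  have hK0 : 0 ≤ K := (norm_nonneg _).trans hKt
  gcongr
  refine (norm_add_le _ _).trans (add_le_add h1 ?_)
  rw [norm_mul, Complex.norm_real, Real.norm_of_nonneg (by positivity)]
  gcongr
  exact hC t i j

theorem exists_intSolOn_of_jumpDet (hA : IsTracelessCoeff A) (h0 : ∀ t, jumpDet μ A t ≠ 0)
    (a b : ℝ) (c : Fin 2 → ℂ) : ∃ u v, IntSolOn μ A a b u v ∧ v a = c := by
  obtain ⟨K, hK⟩ := exists_norm_jumpInv_le (μ := μ) hA a b
  exact exists_intSolOn hA (measurable_jumpInv hA) hK (fun t _ => one_sub_mul_jumpInv hA (h0 t)) c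

omit [IsLocallyFiniteMeasure μ] in
theorem eq_zero_of_eq_half_mulVec (hA : IsTracelessCoeff A) (h0 : ∀ t, jumpDet μ A t ≠ 0) (t : ℝ)
    (z : Fin 2 → ℂ) (hz : ∀ i, z i = μ.real {t} / 2 * (A t *ᵥ z) i) : z = 0 := by
  have ht : A t 1 1 = -A t 0 0 := by linear_combination hA.trace t
  have z0 := hz 0
  have z1 := hz 1
  simp only [Matrix.mulVec, dotProduct, Fin.sum_univ_two, ht] at z0 z1
  ext i
  refine (mul_eq_zero.1 (?_ : jumpDet μ A t * z i = 0)).resolve_left (h0 t)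
  fin_cases i
  · simp only [Fin.zero_eta, jumpDet, ht]
    linear_combination (1 + μ.real {t} / 2 * A t 0 0) * z0 + μ.real {t} / 2 * A t 0 1 * z1
  · simp only [Fin.mk_one, jumpDet, ht]
    linear_combination (1 - μ.real {t} / 2 * A t 0 0) * z1 + μ.real {t} / 2 * A t 1 0 * z0

end JumpDet

/-! ### Solvability at real parameters and near them -/

namespace PeriodicSystem

variable {c : ℝ} {J : Matrix (Fin 2) (Fin 2) ℝ} {q w : Coeff} {μ : Measure ℝ}
  {Q W : ℝ → Matrix (Fin 2) (Fin 2) ℝ} {ω : ℝ} {u u' : ℝ → Fin 2 → ℂ} {l : ℂ}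

/-- `J ± (Δ_q - l Δ_w) / 2` are invertible everywhere. -/
def IsGood (c : ℝ) (μ : Measure ℝ) (Q W : ℝ → Matrix (Fin 2) (Fin 2) ℝ) (l : ℂ) : Prop :=
  ∀ t, jumpDet μ (aMat c Q W l) t ≠ 0

namespace IsModel

theorem exists_isSolution [IsLocallyFiniteMeasure μ] (h : IsModel c J q w μ Q W)
    (hl : IsGood c μ Q W l) (z : Fin 2 → ℂ) :
    ∃ u, IsSolution J q w l u ∧ Function.leftLim u 0 = z := by
  have hA := h.isTracelessCoeff l
  obtain ⟨u, v, huv, hv⟩ := exists_intSol hA (exists_intSolOn_of_jumpDet hA hl)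
    (eq_zero_of_eq_half_mulVec hA hl) z
  exact ⟨u, h.isSolution huv, by rw [huv.leftLim_eq hA, hv]⟩

theorem eq_of_leftLim_eq [IsLocallyFiniteMeasure μ] (h : IsModel c J q w μ Q W)
    (hl : IsGood c μ Q W l) (hu : IsSolution J q w l u) (hu' : IsSolution J q w l u') {t₀ : ℝ}
    (h0 : Function.leftLim u t₀ = Function.leftLim u' t₀) : u = u' := by
  have hA := h.isTracelessCoeff l
  exact IntSol.eq_of_left hA (exists_intSolOn_of_jumpDet hA hl)
    (eq_zero_of_eq_half_mulVec hA hl) (h.intSol hu) (h.intSol hu') h0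

/-- After multiplication by c² = det J this is the determinant of J ± (Δ_q - lΔ_w)/2. It depends on
the distributions only, so it is periodic even though μ, Q and W need not be. -/
theorem jumpDet_eq [IsLocallyFiniteMeasure μ] (h : IsModel c J q w μ Q W) (l : ℂ) (t : ℝ) :
    (c : ℂ) ^ 2 * jumpDet μ (aMat c Q W l) t = (c : ℂ) ^ 2 +
      ((l * jump w t 0 0 - jump q t 0 0) * (l * jump w t 1 1 - jump q t 1 1)
        - (l * jump w t 0 1 - jump q t 0 1) ^ 2) / 4 := by
  have hc : (c : ℂ) ≠ 0 := by exact_mod_cast h.c_ne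
  simp only [jumpDet, aMat, Matrix.of_apply, Matrix.cons_val', Matrix.cons_val_zero,
    Matrix.cons_val_one, Matrix.cons_val_fin_one, (h.W_psd t).symm, h.Q_symm t, h.dq.jump_eq, h.dw.jump_eq, hMat]
  push_cast
  field_simp
  ring

theorem isGood_ofReal [IsLocallyFiniteMeasure μ] (h : IsModel c J q w μ Q W)
    (hyp : IsAdmissible ω J q w) (l : ℝ) : IsGood c μ Q W (l : ℂ) := by
  intro t ht
  have h1 := h.jumpDet_eq l t
  rw [ht, mul_zero] at h1
  have h2 := ((Matrix.isUnit_iff_isUnit_det _).1 (hyp.isUnit_plus l t)).ne_zero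
  have hq : jump q t 1 0 = jump q t 0 1 := by rw [h.dq.jump_eq, h.dq.jump_eq, h.Q_symm]
  have hw : jump w t 1 0 = jump w t 0 1 := by rw [h.dw.jump_eq, h.dw.jump_eq, (h.W_psd t).symm]
  refine h2 ?_
  rw [Matrix.det_fin_two]
  simp only [h.J_eq, Matrix.add_apply, Matrix.smul_apply, Matrix.sub_apply, smul_eq_mul,
    Matrix.of_apply, Matrix.cons_val', Matrix.cons_val_zero, Matrix.cons_val_one,
    Matrix.cons_val_fin_one, hq, hw]
  have h3 : (0 : ℝ) = c ^ 2 +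
      ((l * jump w t 0 0 - jump q t 0 0) * (l * jump w t 1 1 - jump q t 1 1)
        - (l * jump w t 0 1 - jump q t 0 1) ^ 2) / 4 := by exact_mod_cast h1
  linear_combination -h3

theorem _root_.OrderZeroDistribution.HasPeriod.jump_add {r : OrderZeroDistribution}
    (h : r.HasPeriod ω) (x : ℝ) : r.jump (x + ω) = r.jump x := by
  have hm : Measurable fun x : ℝ => x - ω := measurable_id.sub_const ω
  have hpre : (fun x : ℝ => x - ω) ⁻¹' {x} = {x + ω} := by
    ext t
    simp only [mem_preimage, mem_singleton_iff]
    exact sub_eq_iff_eq_add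
  have key : ∀ ν : Measure ℝ, ν.map (fun x => x - ω) = ν → ν.real {x + ω} = ν.real {x} := by
    intro ν hν
    conv_rhs => rw [← hν]
    rw [Measure.real, Measure.real, Measure.map_apply hm (measurableSet_singleton x), hpre]
  rw [OrderZeroDistribution.jump, OrderZeroDistribution.jump, key _ h.map_eq.1, key _ h.map_eq.2]

theorem jumpDet_add [IsLocallyFiniteMeasure μ] (h : IsModel c J q w μ Q W)
    (hyp : IsAdmissible ω J q w) (l : ℂ) (t : ℝ) :
    jumpDet μ (aMat c Q W l) (t + ω) = jumpDet μ (aMat c Q W l) t := by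
  have hc : (c : ℂ) ^ 2 ≠ 0 := pow_ne_zero 2 (by exact_mod_cast h.c_ne)
  have e : ∀ {r : Coeff}, (∀ i j, (r i j).HasPeriod ω) → ∀ i j, jump r (t + ω) i j = jump r t i j :=
    fun hr i j => (hr i j).jump_add t
  refine mul_left_cancel₀ hc ?_
  rw [h.jumpDet_eq, h.jumpDet_eq]
  simp only [e hyp.q_periodic, e hyp.w_periodic]

theorem isGood_of_Ico [IsLocallyFiniteMeasure μ] (h : IsModel c J q w μ Q W)
    (hyp : IsAdmissible ω J q w) (hl : ∀ t ∈ Ico 0 ω, jumpDet μ (aMat c Q W l) t ≠ 0) :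
    IsGood c μ Q W l := by
  intro t
  have hper : Function.Periodic (jumpDet μ (aMat c Q W l)) ω := fun t => h.jumpDet_add hyp l t
  obtain ⟨s, hs, e⟩ := hper.exists_mem_Ico₀ hyp.period_pos t
  rw [e]
  exact hl s hs

/-- The determinant is quadratic in l with coefficients bounded uniformly in t, and at l₀ it stays
away from zero over one period. A single neighbourhood of l₀ thus serves all t in that period, and
periodicity does the rest. -/
theorem eventually_isGood [IsLocallyFiniteMeasure μ] (h : IsModel c J q w μ Q W)
    (hyp : IsAdmissible ω J q w) (l₀ : ℝ) : ∀ᶠ l in 𝓝 (l₀ : ℂ), IsGood c μ Q W l := by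
  obtain ⟨K, hK⟩ := exists_norm_inv_jumpDet_le (μ := μ) (h.isTracelessCoeff l₀) 0 ω
  have hc : (0 : ℝ) < c ^ 2 := by have := h.c_ne; positivity
  set m := μ.real (Icc 0 ω) with hm
  -- If the determinant vanished at l, its modulus at l₀ would be at most this expression without
  -- the factor K. The 2 and the 4 count products of density entries, each bounded by 1. Since K
  -- bounds the inverse at l₀, the expression would be at least 1.
  have hlim : Tendsto (fun l : ℂ => (m / 2) ^ 2 * (‖l - l₀‖ * (2 * ‖l + l₀‖ + 4) / c ^ 2) * K)
      (𝓝 (l₀ : ℂ)) (𝓝 0) := by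
    have : Continuous fun l : ℂ => (m / 2) ^ 2 * (‖l - l₀‖ * (2 * ‖l + l₀‖ + 4) / c ^ 2) * K := by
      fun_prop
    simpa using this.tendsto (l₀ : ℂ)
  filter_upwards [hlim.eventually_lt_const one_pos] with l hl
  refine h.isGood_of_Ico hyp fun t ht h0 => ?_
  have htI : t ∈ Icc 0 ω := ⟨ht.1, ht.2.le⟩
  have hcC : (c : ℂ) ≠ 0 := by exact_mod_cast h.c_ne
  have e : jumpDet μ (aMat c Q W l₀) t = -((μ.real {t} / 2 : ℂ) ^ 2 * ((l - l₀) * ((l + l₀) *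
      (W t 0 0 * W t 1 1 - W t 0 1 * W t 0 1)
      - (W t 0 0 * Q t 1 1 + W t 1 1 * Q t 0 0 - W t 0 1 * Q t 0 1 - W t 0 1 * Q t 0 1))
        / (c : ℂ) ^ 2)) := by
    rw [← sub_zero (jumpDet μ (aMat c Q W l₀) t), ← h0]
    simp only [jumpDet, aMat, Matrix.of_apply, Matrix.cons_val', Matrix.cons_val_zero,
      Matrix.cons_val_one, Matrix.cons_val_fin_one, (h.W_psd t).symm, h.Q_symm t, hMat]
    field_simp
    ring
  have hb : ∀ {R : ℝ → Matrix (Fin 2) (Fin 2) ℝ} {r : Coeff}, IsDensity μ R r → ∀ i j,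
      ‖(R t i j : ℂ)‖ ≤ 1 := fun hR i j => by rw [Complex.norm_real]; exact hR.bdd t i j
  have hbb : ∀ {R S : ℝ → Matrix (Fin 2) (Fin 2) ℝ} {r s : Coeff}, IsDensity μ R r →
      IsDensity μ S s → ∀ i j k l, ‖(R t i j : ℂ) * S t k l‖ ≤ 1 := fun hR hS i j k l => by
    rw [norm_mul]
    exact mul_le_one₀ (hb hR i j) (norm_nonneg _) (hb hS k l)
  have h1 : ‖(W t 0 0 * W t 1 1 - W t 0 1 * W t 0 1 : ℂ)‖ ≤ 2 :=
    (norm_sub_le _ _).trans (by linarith [hbb h.dw h.dw 0 0 1 1, hbb h.dw h.dw 0 1 0 1])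
  have h2 : ‖(W t 0 0 * Q t 1 1 + W t 1 1 * Q t 0 0 - W t 0 1 * Q t 0 1 - W t 0 1 * Q t 0 1 : ℂ)‖
      ≤ 4 := by
    refine (norm_sub_le _ _).trans ?_
    have := norm_sub_le (W t 0 0 * Q t 1 1 + W t 1 1 * Q t 0 0 : ℂ) (W t 0 1 * Q t 0 1)
    have := norm_add_le (W t 0 0 * Q t 1 1 : ℂ) (W t 1 1 * Q t 0 0)
    linarith [hbb h.dw h.dq 0 0 1 1, hbb h.dw h.dq 1 1 0 0, hbb h.dw h.dq 0 1 0 1]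
  have hmt : μ.real {t} ≤ m :=
    measureReal_mono (singleton_subset_iff.2 htI) measure_Icc_lt_top.ne
  have hle : ‖jumpDet μ (aMat c Q W l₀) t‖
      ≤ (m / 2) ^ 2 * (‖l - l₀‖ * (2 * ‖l + l₀‖ + 4) / c ^ 2) := by
    rw [e, norm_neg, norm_mul, norm_half_measureReal_sq, norm_div, norm_mul, norm_pow,
      Complex.norm_real, Real.norm_eq_abs, sq_abs]
    gcongr
    refine (norm_sub_le _ _).trans ?_
    rw [norm_mul, mul_comm]
    gcongr
  have hg := h.isGood_ofReal hyp l₀ t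
  have hKt := hK t htI
  rw [norm_inv] at hKt
  have hpos : 0 < ‖jumpDet μ (aMat c Q W l₀) t‖ := norm_pos_iff.2 hg
  have h5 : 1 ≤ ‖jumpDet μ (aMat c Q W l₀) t‖ * K := by
    rw [inv_le_iff_one_le_mul₀ hpos] at hKt
    linarith
  have hK0 : 0 ≤ K := (inv_nonneg.2 hpos.le).trans hKt
  have := mul_le_mul_of_nonneg_right hle hK0
  linarith

end IsModel

end PeriodicSystem

/-! ### Translation, cut-off and conjugation of solutions -/

theorem LocallyBoundedVariationOn.comp_add_const {u : ℝ → Fin 2 → ℂ}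
    (hu : LocallyBoundedVariationOn u univ) (τ : ℝ) :
    LocallyBoundedVariationOn (fun x => u (x + τ)) univ := by
  intro a b _ _
  rw [univ_inter]
  have h := hu (a + τ) (b + τ) (mem_univ _) (mem_univ _)
  rw [univ_inter] at h
  refine ne_top_of_le_ne_top h ?_
  exact eVariationOn.comp_le_of_monotoneOn u (fun x => x + τ)
    (fun x _ y _ hxy => by simpa using hxy) fun x hx => ⟨by linarith [hx.1], by linarith [hx.2]⟩

theorem tendsto_add_const_Iio (x τ : ℝ) : Tendsto (fun t => t + τ) (𝓝[<] x) (𝓝[<] (x + τ)) :=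
  tendsto_nhdsWithin_of_tendsto_nhds_of_eventually_within _
    (((continuous_add_const τ).tendsto x).mono_left nhdsWithin_le_nhds)
    (eventually_nhdsWithin_of_forall fun t ht => by simpa using ht)

theorem tendsto_add_const_Ioi (x τ : ℝ) : Tendsto (fun t => t + τ) (𝓝[>] x) (𝓝[>] (x + τ)) :=
  tendsto_nhdsWithin_of_tendsto_nhds_of_eventually_within _
    (((continuous_add_const τ).tendsto x).mono_left nhdsWithin_le_nhds)
    (eventually_nhdsWithin_of_forall fun t ht => by simpa using ht)

theorem LocallyBoundedVariationOn.leftLim_comp_add {u : ℝ → Fin 2 → ℂ}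
    (hu : LocallyBoundedVariationOn u univ) (τ x : ℝ) :
    Function.leftLim (fun x => u (x + τ)) x = Function.leftLim u (x + τ) :=
  leftLim_eq_of_tendsto ((hu.tendsto_leftLim' (x + τ)).comp (tendsto_add_const_Iio x τ))

theorem LocallyBoundedVariationOn.rightLim_comp_add {u : ℝ → Fin 2 → ℂ}
    (hu : LocallyBoundedVariationOn u univ) (τ x : ℝ) :
    Function.rightLim (fun x => u (x + τ)) x = Function.rightLim u (x + τ) :=
  rightLim_eq_of_tendsto ((hu.tendsto_rightLim' (x + τ)).comp (tendsto_add_const_Ioi x τ))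

theorem OrderZeroDistribution.HasPeriod.pair_comp_add_int {r : OrderZeroDistribution} {ω : ℝ}
    (h : r.HasPeriod ω) (n : ℤ) (f : ℝ → ℂ) : r.pair (fun x => f (x + n * ω)) = r.pair f := by
  have hp : Function.Periodic (fun t : ℝ => r.pair fun x => f (x + t)) ω := fun t => by
    have := h.pair_comp_add fun x => f (x + t)
    simp only at this ⊢
    rw [← this]
    congr 1
    funext x
    congr 1
    ring
  simpa using hp.int_mul n 0

theorem isTestFunction_comp_add {φ : ℝ → ℂ} (hφ : IsTestFunction φ) (τ : ℝ) :
    IsTestFunction fun x => φ (x + τ) :=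
  ⟨hφ.1.comp (contDiff_id.add contDiff_const), hφ.2.comp_homeomorph (Homeomorph.addRight τ)⟩

section Cutoff

variable {μ : Measure ℝ} {A : ℝ → Matrix (Fin 2) (Fin 2) ℂ} {u v : ℝ → Fin 2 → ℂ}

/-- A solution whose left limit at `0` vanishes may be replaced by zero to the left of `0`. -/
theorem IntSol.indicator_Ici (h : IntSol μ A u v) (h0 : v 0 = 0) :
    IntSol μ A ((Ici 0).indicator u) ((Ici 0).indicator v) := by
  intro a b
  have hAz : ∀ t i, (A t *ᵥ (Ici (0 : ℝ)).indicator u t) i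
      = (Ici (0 : ℝ)).indicator (fun t => (A t *ᵥ u t) i) t := fun t i => by
    by_cases ht : t ∈ Ici (0 : ℝ) <;> simp [ht]
  refine ⟨(h a b).meas.indicator measurableSet_Ici, ?_, fun x y hx hxy hy i => ?_,
    fun x hx i => ?_⟩
  · obtain ⟨K, hK⟩ := (h a b).bdd
    exact ⟨K, fun t ht => (norm_indicator_le_norm_self u t).trans (hK t ht)⟩
  · simp only [hAz]
    rw [setIntegral_indicator measurableSet_Ici]
    rcases le_or_gt y 0 with hy0 | hy0
    · have e : Ico x y ∩ Ici 0 = ∅ := by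
        ext t
        simp only [mem_inter_iff, mem_Ico, mem_Ici, mem_empty_iff_false, iff_false]
        rintro ⟨⟨-, h1⟩, h2⟩
        linarith
      have hv : ∀ z ≤ (0 : ℝ), (Ici (0 : ℝ)).indicator v z = 0 := fun z hz => by
        rcases hz.lt_or_eq with hz | rfl
        · simp [hz]
        · simp [h0]
      rw [e, hv y hy0, hv x (hxy.trans hy0)]
      simp
    · have e : Ico x y ∩ Ici 0 = Ico (max x 0) y := by
        ext t
        simp only [mem_inter_iff, mem_Ico, mem_Ici, max_le_iff]
        tauto
      have hvx : (Ici (0 : ℝ)).indicator v x = v (max x 0) := by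
        rcases le_or_gt 0 x with hx0 | hx0
        · simp [hx0]
        · simp [hx0, hx0.le, h0]
      rw [e, hvx, indicator_of_mem (mem_Ici.2 hy0.le)]
      exact (h a b).eq _ _ (hx.trans (le_max_left _ _)) (max_le hxy hy0.le) hy i
  · rw [hAz]
    by_cases hx0 : x ∈ Ici (0 : ℝ)
    · simp only [indicator_of_mem hx0]
      exact (h a b).bal x hx i
    · simp [indicator_of_notMem hx0]

theorem IntSol.star {A' : ℝ → Matrix (Fin 2) (Fin 2) ℂ} (h : IntSol μ A u v)
    (hA : ∀ t i j, A' t i j = star (A t i j)) :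
    IntSol μ A' (fun t => star (u t)) (fun t => star (v t)) := by
  intro a b
  have e : ∀ t i, (A' t *ᵥ Star.star (u t)) i = (starRingEnd ℂ) ((A t *ᵥ u t) i) := fun t i => by
    simp [Matrix.mulVec, dotProduct, hA]
  refine ⟨continuous_star.measurable.comp (h a b).meas, ?_, fun x y hx hxy hy i => ?_, fun x hx i => ?_⟩
  · obtain ⟨K, hK⟩ := (h a b).bdd
    exact ⟨K, fun t ht => by rw [norm_star]; exact hK t ht⟩
  · simp only [e, integral_conj, ← (h a b).eq x y hx hxy hy i]
    simp
  · have := congrArg (starRingEnd ℂ) ((h a b).bal x hx i)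
    simp only [map_add, map_mul, map_div₀, Complex.conj_ofReal, map_ofNat] at this
    rw [e]
    exact this

end Cutoff

namespace PeriodicSystem

variable {c : ℝ} {J : Matrix (Fin 2) (Fin 2) ℝ} {q w : Coeff} {μ : Measure ℝ}
  {Q W : ℝ → Matrix (Fin 2) (Fin 2) ℝ} {ω : ℝ} {u u' : ℝ → Fin 2 → ℂ} {l : ℂ}

theorem IsBalancedBV.comp_add (h : IsBalancedBV u) (τ : ℝ) : IsBalancedBV fun x => u (x + τ) :=
  ⟨h.1.comp_add_const τ, fun x => by rw [h.1.rightLim_comp_add, h.1.leftLim_comp_add]; exact h.2 _⟩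

theorem IsSolution.comp_add (h : IsSolution J q w l u) {τ : ℝ}
    (hq : ∀ i j (f : ℝ → ℂ), (q i j).pair (fun x => f (x + τ)) = (q i j).pair f)
    (hw : ∀ i j (f : ℝ → ℂ), (w i j).pair (fun x => f (x + τ)) = (w i j).pair f) :
    IsSolution J q w l fun x => u (x + τ) := by
  refine ⟨h.1.comp_add τ, fun φ hφ i => ?_⟩
  have key := h.2 (fun x => φ (x + -τ)) (isTestFunction_comp_add hφ (-τ)) i
  have e : ∀ r : Coeff, (∀ i j (f : ℝ → ℂ), (r i j).pair (fun x => f (x + τ)) = (r i j).pair f) →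
      mulApply r u (fun x => φ (x + -τ)) i = mulApply r (fun x => u (x + τ)) φ i := fun r hr => by
    refine Finset.sum_congr rfl fun j _ => ?_
    rw [← hr i j fun x => u x j * φ (x + -τ)]
    simp
  have ed : derivApply J u (fun x => φ (x + -τ)) i = derivApply J (fun x => u (x + τ)) φ i := by
    refine Finset.sum_congr rfl fun j _ => ?_
    rw [← integral_add_right_eq_self (fun x => u x j * deriv (fun x => φ (x + -τ)) x) τ]
    simp [deriv_comp_add_const]
  rw [← ed, ← e q hq, ← e w hw]
  exact key

theorem IsSolution.comp_add_int (hyp : IsAdmissible ω J q w) (h : IsSolution J q w l u) (n : ℤ) :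
    IsSolution J q w l fun x => u (x + n * ω) :=
  h.comp_add (fun i j => (hyp.q_periodic i j).pair_comp_add_int n)
    fun i j => (hyp.w_periodic i j).pair_comp_add_int n

theorem IsSolution.comp_add_period (hyp : IsAdmissible ω J q w) (h : IsSolution J q w l u) :
    IsSolution J q w l fun x => u (x + ω) := by
  simpa using h.comp_add_int hyp 1

theorem IsSolution.comp_sub_period (hyp : IsAdmissible ω J q w) (h : IsSolution J q w l u) :
    IsSolution J q w l fun x => u (x - ω) := by
  simpa [sub_eq_add_neg] using h.comp_add_int hyp (-1)

namespace IsModel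

variable [IsLocallyFiniteMeasure μ]

theorem isSolution_lin (h : IsModel c J q w μ Q W) (hu : IsSolution J q w l u)
    (hu' : IsSolution J q w l u') (α β : ℂ) :
    IsSolution J q w l fun t => α • u t + β • u' t :=
  h.isSolution ((h.intSol hu).lin (h.isTracelessCoeff l) (h.intSol hu') α β)

theorem leftLim_lin (h : IsModel c J q w μ Q W) (hu : IsSolution J q w l u)
    (hu' : IsSolution J q w l u') (α β : ℂ) (x : ℝ) :
    Function.leftLim (fun t => α • u t + β • u' t) x
      = α • Function.leftLim u x + β • Function.leftLim u' x :=
  ((h.intSol hu).lin (h.isTracelessCoeff l) (h.intSol hu') α β).leftLim_eq (h.isTracelessCoeff l) x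

theorem aMat_star (c : ℝ) (Q W : ℝ → Matrix (Fin 2) (Fin 2) ℝ) (l : ℂ) (t : ℝ) (i j : Fin 2) :
    aMat c Q W (star l) t i j = star (aMat c Q W l t i j) := by
  fin_cases i <;> fin_cases j <;> simp [aMat, hMat]

theorem isSolution_star (h : IsModel c J q w μ Q W) (hu : IsSolution J q w l u) :
    IsSolution J q w (star l) fun t => star (u t) :=
  h.isSolution ((h.intSol hu).star (aMat_star c Q W l))

theorem leftLim_star (h : IsModel c J q w μ Q W) (hu : IsSolution J q w l u) (x : ℝ) :
    Function.leftLim (fun t => star (u t)) x = star (Function.leftLim u x) :=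
  ((h.intSol hu).star (aMat_star c Q W l)).leftLim_eq (h.isTracelessCoeff (star l)) x

theorem wronskian_leftLim_eq (h : IsModel c J q w μ Q W) (hu : IsSolution J q w l u)
    (hu' : IsSolution J q w l u') (x y : ℝ) :
    wronskian (Function.leftLim u x) (Function.leftLim u' x)
      = wronskian (Function.leftLim u y) (Function.leftLim u' y) :=
  (h.intSol hu (min x y) (max x y)).wronskian_eq (h.isTracelessCoeff l)
    (h.intSol hu' (min x y) (max x y)) ⟨min_le_left _ _, le_max_left _ _⟩
    ⟨min_le_right _ _, le_max_right _ _⟩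

theorem isSolution_indicator_Ici (h : IsModel c J q w μ Q W) (hu : IsSolution J q w l u)
    (h0 : Function.leftLim u 0 = 0) : IsSolution J q w l ((Ici 0).indicator u) :=
  h.isSolution ((h.intSol hu).indicator_Ici h0)

end IsModel

/-! ### Monodromy matrices at arbitrary complex parameters -/

section Monodromy

variable {U V : ℝ → Matrix (Fin 2) (Fin 2) ℂ} {M N : Matrix (Fin 2) (Fin 2) ℂ}

theorem IsFundamentalMatrix.mulVec_injective (hU : IsFundamentalMatrix J q w l U)
    {z z' : Fin 2 → ℂ} (h : ∀ x, U x *ᵥ z = U x *ᵥ z') : z = z' := by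
  obtain ⟨d, -, hd⟩ := hU.2 _ (hU.1 z)
  exact (hd z rfl).trans (hd z' (funext h)).symm

theorem matrix_ext_mulVec (h : ∀ z : Fin 2 → ℂ, M *ᵥ z = N *ᵥ z) : M = N :=
  Matrix.toLin'.injective (LinearMap.ext fun z => by simpa using h z)

/-- A family of solutions depending linearly on a vector is expressed by a fundamental matrix. -/
theorem IsFundamentalMatrix.exists_eq_mul (hU : IsFundamentalMatrix J q w l U)
    (hV : ∀ z : Fin 2 → ℂ, IsSolution J q w l fun x => V x *ᵥ z) : ∃ M, ∀ x, V x = U x * M := by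
  have key : ∀ j, ∃ d : Fin 2 → ℂ, ∀ x, V x *ᵥ Pi.single j 1 = U x *ᵥ d := fun j => by
    obtain ⟨d, hd, -⟩ := hU.2 _ (hV (Pi.single j 1))
    exact ⟨d, congrFun hd⟩
  choose d hd using key
  refine ⟨Matrix.of fun i j => d j i, fun x => ?_⟩
  ext i j
  have := congrFun (hd j x) i
  rw [Matrix.mulVec_single_one] at this
  exact this

theorem IsMonodromyMatrix.similar (hM : IsMonodromyMatrix ω J q w l M)
    (hN : IsMonodromyMatrix ω J q w l N) :
    ∃ C C' : Matrix (Fin 2) (Fin 2) ℂ, C * C' = 1 ∧ C' * C = 1 ∧ N = C' * M * C := by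
  obtain ⟨U, hU, hUM⟩ := hM
  obtain ⟨V, hV, hVN⟩ := hN
  obtain ⟨C, hC⟩ := hU.exists_eq_mul hV.1
  obtain ⟨C', hC'⟩ := hV.exists_eq_mul hU.1
  have h1 : C * C' = 1 := matrix_ext_mulVec fun z => hU.mulVec_injective fun x => by
    rw [Matrix.mulVec_mulVec, ← Matrix.mul_assoc, ← hC, ← hC', Matrix.one_mulVec]
  have h2 : C' * C = 1 := mul_eq_one_comm.1 h1
  have h3 : C * N = M * C := matrix_ext_mulVec fun z => hU.mulVec_injective fun x => by
    rw [Matrix.mulVec_mulVec, Matrix.mulVec_mulVec, ← Matrix.mul_assoc, ← Matrix.mul_assoc, ← hC,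
      ← hVN, ← hUM, hC]
  refine ⟨C, C', h1, h2, ?_⟩
  rw [Matrix.mul_assoc, ← h3, ← Matrix.mul_assoc, h2, Matrix.one_mul]

theorem discriminant_eq_trace (hM : IsMonodromyMatrix ω J q w l M) :
    discriminant ω J q w l = M.trace := by
  have hex : ∃ M, IsMonodromyMatrix ω J q w l M := ⟨M, hM⟩
  rw [discriminant, dif_pos hex]
  obtain ⟨C, C', h1, -, e⟩ := hM.similar hex.choose_spec
  rw [e, Matrix.trace_mul_cycle, h1, Matrix.one_mul]

theorem IsMonodromyMatrix.eq_smul_one_iff (hM : IsMonodromyMatrix ω J q w l M)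
    (hN : IsMonodromyMatrix ω J q w l N) (σ : ℂ) : M = σ • 1 ↔ N = σ • 1 := by
  have key : ∀ {M N}, IsMonodromyMatrix ω J q w l M → IsMonodromyMatrix ω J q w l N →
      M = σ • 1 → N = σ • 1 := by
    intro M N hM hN h
    obtain ⟨C, C', -, h2, e⟩ := hM.similar hN
    rw [e, h, Matrix.mul_smul, Matrix.mul_one, Matrix.smul_mul, h2]
  exact ⟨key hM hN, key hN hM⟩

theorem cayley_hamilton_mulVec (M : Matrix (Fin 2) (Fin 2) ℂ) (z : Fin 2 → ℂ) :
    M *ᵥ (M *ᵥ z) = M.trace • M *ᵥ z - M.det • z := by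
  ext i
  fin_cases i <;>
    simp [Matrix.mulVec, dotProduct, Fin.sum_univ_two, Matrix.trace_fin_two, Matrix.det_fin_two] <;>
    ring

theorem exists_eigenvector_of_det_eq_one {σ : ℂ} (hσ : σ ^ 2 = 1) (hd : M.det = 1)
    (ht : M.trace = 2 * σ) : ∃ z ≠ 0, M *ᵥ z = σ • z := by
  have h0 : (M - σ • 1).det = 0 := by
    rw [Matrix.det_fin_two] at hd ⊢
    rw [Matrix.trace_fin_two] at ht
    simp only [Matrix.sub_apply, Matrix.smul_apply, Matrix.one_apply_eq, ne_eq, zero_ne_one,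
      one_ne_zero, not_false_eq_true, Matrix.one_apply_ne, smul_eq_mul]
    linear_combination hd - σ * ht - hσ
  obtain ⟨z, hz, e⟩ := Matrix.exists_mulVec_eq_zero_iff.2 h0
  refine ⟨z, hz, ?_⟩
  rwa [Matrix.sub_mulVec, sub_eq_zero, Matrix.smul_mulVec, Matrix.one_mulVec] at e

/-- Solutions that vanish on a half-line vanish, by periodicity. -/
theorem eq_zero_of_eq_zero_left (hω : 0 < ω) (hper : ∀ x, U (x + ω) = U x * M) {z : Fin 2 → ℂ}
    (h0 : ∀ x < 0, U x *ᵥ z = 0) (x : ℝ) : U x *ᵥ z = 0 := by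
  have key : ∀ n : ℕ, ∀ x < n * ω, U x *ᵥ z = 0 := by
    intro n
    induction n with
    | zero => simpa using h0
    | succ n ih =>
      intro x hx
      push_cast at hx
      have e1 := ih (x - ω) (by linarith)
      have e2 := ih (x - ω - ω) (by linarith)
      have h1 : U x = U (x - ω) * M := by rw [← hper]; simp
      have h2 : U (x - ω) = U (x - ω - ω) * M := by rw [← hper]; simp
      rw [h2, ← Matrix.mulVec_mulVec] at e1
      -- By Cayley–Hamilton, M²z is a combination of Mz and z, so zeros at two consecutive
      -- translates propagate to the next one.
      rw [h1, h2, ← Matrix.mulVec_mulVec, ← Matrix.mulVec_mulVec, cayley_hamilton_mulVec,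
        Matrix.mulVec_sub, Matrix.mulVec_smul, Matrix.mulVec_smul, e1, e2]
      simp
  obtain ⟨n, hn⟩ := exists_nat_gt (x / ω)
  exact key n x (by rwa [div_lt_iff₀ hω] at hn)

/-- The same two-term recursion is run backwards. There the determinant is the leading coefficient,
so it must not vanish. -/
theorem eq_zero_of_eq_zero_right (hω : 0 < ω) (hper : ∀ x, U (x + ω) = U x * M) (hd : M.det ≠ 0)
    {z : Fin 2 → ℂ} (h0 : ∀ x, 0 ≤ x → U x *ᵥ z = 0) (x : ℝ) : U x *ᵥ z = 0 := by
  have key : ∀ n : ℕ, ∀ x, -(n * ω) ≤ x → U x *ᵥ z = 0 := by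
    intro n
    induction n with
    | zero => simpa using h0
    | succ n ih =>
      intro x hx
      push_cast at hx
      have e1 := ih (x + ω) (by linarith)
      have e2 := ih (x + ω + ω) (by linarith)
      rw [hper, ← Matrix.mulVec_mulVec] at e1
      rw [hper, hper, ← Matrix.mulVec_mulVec, ← Matrix.mulVec_mulVec, cayley_hamilton_mulVec,
        Matrix.mulVec_sub, Matrix.mulVec_smul, Matrix.mulVec_smul, e1, smul_zero, zero_sub,
        neg_eq_zero, smul_eq_zero] at e2
      exact e2.resolve_left hd
  obtain ⟨n, hn⟩ := exists_nat_gt (-x / ω)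
  refine key n x ?_
  rw [div_lt_iff₀ hω] at hn
  linarith

/-- Translation by -ω also preserves solutions, and the matrix describing it is inverse to M. -/
theorem IsFundamentalMatrix.det_ne_zero (hyp : IsAdmissible ω J q w)
    (hU : IsFundamentalMatrix J q w l U) (hper : ∀ x, U (x + ω) = U x * M) : M.det ≠ 0 := by
  have hV : ∀ z : Fin 2 → ℂ, IsSolution J q w l fun x => U (x - ω) *ᵥ z := fun z =>
    IsSolution.comp_sub_period (u := fun x => U x *ᵥ z) hyp (hU.1 z)
  obtain ⟨N, hN⟩ := IsFundamentalMatrix.exists_eq_mul (V := fun x => U (x - ω)) hU hV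
  have h1 : N * M = 1 := matrix_ext_mulVec fun z => hU.mulVec_injective fun x => by
    rw [Matrix.mulVec_mulVec, ← Matrix.mul_assoc, ← hN, ← hper, sub_add_cancel, Matrix.one_mulVec]
  intro h0
  have := congrArg Matrix.det h1
  rw [Matrix.det_mul, h0] at this
  simp at this

/-- This replaces uniqueness where the jump condition may be singular. Cutting the solution off to
the left of 0 gives a solution again, hence one represented by U. It vanishes on the left half-line
and so everywhere, which means that the original solution vanishes on the right half-line and so
everywhere. -/
theorem IsModel.leftLim_eq_zero [IsLocallyFiniteMeasure μ] (h : IsModel c J q w μ Q W)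
    (hyp : IsAdmissible ω J q w) (hU : IsFundamentalMatrix J q w l U)
    (hper : ∀ x, U (x + ω) = U x * M) {z : Fin 2 → ℂ}
    (h0 : Function.leftLim (fun x => U x *ᵥ z) 0 = 0) : z = 0 := by
  obtain ⟨d, hd, -⟩ := hU.2 _ (h.isSolution_indicator_Ici (hU.1 z) h0)
  have hd' : ∀ x, (Ici 0).indicator (fun x => U x *ᵥ z) x = U x *ᵥ d := congrFun hd
  have d0 : d = 0 := hU.mulVec_injective fun x => by
    rw [Matrix.mulVec_zero]
    refine eq_zero_of_eq_zero_left hyp.period_pos hper (fun x hx => ?_) x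
    rw [← hd', indicator_of_notMem (by simpa using hx)]
  refine hU.mulVec_injective fun x => ?_
  rw [Matrix.mulVec_zero]
  refine eq_zero_of_eq_zero_right hyp.period_pos hper (hU.det_ne_zero hyp hper) (fun x hx => ?_) x
  have := hd' x
  rwa [d0, Matrix.mulVec_zero, indicator_of_mem (mem_Ici.2 hx)] at this

theorem IsModel.leftLim_mulVec [IsLocallyFiniteMeasure μ] (h : IsModel c J q w μ Q W)
    (hU : ∀ z : Fin 2 → ℂ, IsSolution J q w l fun x => U x *ᵥ z) (z : Fin 2 → ℂ) (x : ℝ) :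
    Function.leftLim (fun x => U x *ᵥ z) x
      = z 0 • Function.leftLim (fun x => U x *ᵥ ![1, 0]) x
        + z 1 • Function.leftLim (fun x => U x *ᵥ ![0, 1]) x := by
  rw [← h.leftLim_lin (hU _) (hU _)]
  congr 1
  funext x
  rw [← Matrix.mulVec_smul, ← Matrix.mulVec_smul, ← Matrix.mulVec_add]
  congr 1
  ext i
  fin_cases i <;> simp

/-- Translation by ω multiplies the Wronskian of the columns by det M, while the Wronskian is
constant and, by the previous injectivity, nonzero. -/
theorem IsModel.det_eq_one [IsLocallyFiniteMeasure μ] (h : IsModel c J q w μ Q W)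
    (hyp : IsAdmissible ω J q w) (hU : IsFundamentalMatrix J q w l U)
    (hper : ∀ x, U (x + ω) = U x * M) : M.det = 1 := by
  set p := Function.leftLim (fun x => U x *ᵥ ![1, 0]) 0 with hp
  set r := Function.leftLim (fun x => U x *ᵥ ![0, 1]) 0 with hr
  have hκ : wronskian p r ≠ 0 := by
    intro hκ
    -- A vanishing Wronskian means rᵢp - pᵢr = 0 for each i. These combinations have zero left limit
    -- at 0, so their coefficients vanish and p = 0, which contradicts injectivity on the first unit
    -- vector.
    have hz : ∀ i, (![r i, -p i] : Fin 2 → ℂ) = 0 := fun i => h.leftLim_eq_zero hyp hU hper (by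
      rw [h.leftLim_mulVec hU.1, ← hp, ← hr]
      rw [wronskian] at hκ
      have hκ' : r 0 * p 1 = p 0 * r 1 := by linear_combination -hκ
      ext j
      fin_cases i <;> fin_cases j <;> simp [hκ', mul_comm])
    have hp0 : p = 0 := funext fun i => by simpa using congrFun (hz i) 1
    have := congrFun (h.leftLim_eq_zero hyp hU hper (z := ![1, 0]) (by rw [← hp, hp0])) 0
    simp at this
  have e : ∀ z : Fin 2 → ℂ, Function.leftLim (fun x => U x *ᵥ z) ω
      = (M *ᵥ z) 0 • p + (M *ᵥ z) 1 • r := fun z => by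
    rw [hp, hr, ← h.leftLim_mulVec hU.1]
    have := (hU.1 z).1.1.leftLim_comp_add ω 0
    rw [zero_add] at this
    rw [← this]
    simp only [hper, ← Matrix.mulVec_mulVec]
  have hw := h.wronskian_leftLim_eq (hU.1 ![1, 0]) (hU.1 ![0, 1]) ω 0
  rw [e, e, ← hp, ← hr] at hw
  refine mul_right_cancel₀ hκ ?_
  rw [one_mul]
  refine Eq.trans ?_ hw
  simp [wronskian, Matrix.det_fin_two, Matrix.mulVec, dotProduct, Fin.sum_univ_two]
  ring

end Monodromy

end PeriodicSystem

/-! ### The energy form, Lagrange's identity and the role of `L0` -/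

/-- Measurable and bounded on bounded intervals. -/
structure IsBddMeasurable (u : ℝ → Fin 2 → ℂ) : Prop where
  meas : Measurable u
  bdd : IsLocallyBdd u

namespace IsBddMeasurable

variable {u u' : ℝ → Fin 2 → ℂ} {μ : Measure ℝ} [IsLocallyFiniteMeasure μ]

theorem conj (hu : IsBddMeasurable u) : IsBddMeasurable fun t => star (u t) :=
  ⟨continuous_star.measurable.comp hu.meas, fun a b => by simpa only [norm_star] using hu.bdd a b⟩

theorem lin (hu : IsBddMeasurable u) (hu' : IsBddMeasurable u') (α β : ℂ) :
    IsBddMeasurable fun t => α • u t + β • u' t := by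
  refine ⟨(hu.meas.const_smul α).add (hu'.meas.const_smul β), fun a b => ?_⟩
  obtain ⟨K, hK⟩ := hu.bdd a b
  obtain ⟨K', hK'⟩ := hu'.bdd a b
  refine ⟨‖α‖ * K + ‖β‖ * K', fun t ht => (norm_add_le _ _).trans ?_⟩
  rw [norm_smul, norm_smul]
  gcongr
  · exact hK t ht
  · exact hK' t ht

theorem integrableOn_mul (hu : IsBddMeasurable u) (hu' : IsBddMeasurable u') (i j : Fin 2) (a b : ℝ) :
    IntegrableOn (fun t => u t i * u' t j) (Ico a b) μ := by
  obtain ⟨K, hK⟩ := hu'.bdd a b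
  refine ((hu.bdd.integrableOn hu.meas i a b).mono_set Ico_subset_Icc_self).mul_bdd (c := K)
    (measurable_pi_iff.1 hu'.meas j).aestronglyMeasurable ?_
  filter_upwards [ae_restrict_mem measurableSet_Ico] with t ht
  exact (norm_le_pi_norm _ _).trans (hK t ⟨ht.1, ht.2.le⟩)

end IsBddMeasurable

namespace PeriodicSystem

variable {c : ℝ} {J : Matrix (Fin 2) (Fin 2) ℝ} {q w : Coeff} {μ : Measure ℝ}
  {Q W : ℝ → Matrix (Fin 2) (Fin 2) ℝ} {ω : ℝ} {u u' u'' : ℝ → Fin 2 → ℂ} {l l' : ℂ} {a b : ℝ}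

theorem IsSolution.isBddMeasurable (h : IsSolution J q w l u) : IsBddMeasurable u :=
  ⟨h.1.1.measurable_of_pi, h.1.1.isLocallyBdd⟩

/-- The bilinear form `∫ uᵀ w u'` over `[a, b)`. -/
noncomputable def energy (μ : Measure ℝ) (W : ℝ → Matrix (Fin 2) (Fin 2) ℝ)
    (u u' : ℝ → Fin 2 → ℂ) (a b : ℝ) : ℂ :=
  ∫ t in Ico a b, ∑ i, ∑ j, (W t i j : ℂ) * (u t i * u' t j) ∂μ

theorem IsPSD.re_nonneg {M : Matrix (Fin 2) (Fin 2) ℝ} (h : IsPSD M) (z : Fin 2 → ℂ) :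
    ∃ r : ℝ, 0 ≤ r ∧ ∑ i, ∑ j, (M i j : ℂ) * (star z i * z j) = r := by
  obtain ⟨hs, h0, h1, hd⟩ := h
  have key : ∀ x y : ℝ, 0 ≤ M 0 0 * x ^ 2 + 2 * M 0 1 * x * y + M 1 1 * y ^ 2 := by
    intro x y
    rcases h0.eq_or_lt with h00 | h00
    · have : M 0 1 = 0 := by
        rw [← h00, zero_mul] at hd
        exact (pow_eq_zero_iff two_ne_zero).1 (le_antisymm hd (sq_nonneg _))
      rw [this, ← h00]
      nlinarith [mul_nonneg h1 (sq_nonneg y)]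
    · have h2 : 0 ≤ M 0 0 * (M 0 0 * x ^ 2 + 2 * M 0 1 * x * y + M 1 1 * y ^ 2) := by
        nlinarith [sq_nonneg (M 0 0 * x + M 0 1 * y), mul_nonneg (sub_nonneg.2 hd) (sq_nonneg y)]
      exact nonneg_of_mul_nonneg_right h2 h00
  refine ⟨_, add_nonneg (key (z 0).re (z 1).re) (key (z 0).im (z 1).im), ?_⟩
  apply Complex.ext <;> simp [Fin.sum_univ_two, hs, -Complex.ofReal_pow] <;> ring

namespace IsModel

variable [IsLocallyFiniteMeasure μ]

theorem integrableOn_energy (h : IsModel c J q w μ Q W) (hu : IsBddMeasurable u) (hu' : IsBddMeasurable u')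
    (a b : ℝ) :
    IntegrableOn (fun t => ∑ i, ∑ j, (W t i j : ℂ) * (u t i * u' t j)) (Ico a b) μ :=
  integrable_finsetSum _ fun i _ => integrable_finsetSum _ fun j _ =>
    h.dw.integrable_mul (hu.integrableOn_mul hu' i j a b) i j

/-- Only the distribution w is known to be periodic, not μ or W separately. Rewriting the energy
through w is what allows it to be translated by periods. -/
theorem energy_eq_sum_pair (h : IsModel c J q w μ Q W) (hu : IsBddMeasurable u) (hu' : IsBddMeasurable u')
    (a b : ℝ) : energy μ W u u' a b
      = ∑ i, ∑ j, (w i j).pair ((Ico a b).indicator fun t => u t i * u' t j) := by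
  have hi := fun i j => hu.integrableOn_mul (μ := μ) hu' i j a b
  rw [energy, integral_finsetSum _ fun i _ => integrable_finsetSum _ fun j _ =>
    h.dw.integrable_mul (hi i j) i j]
  refine Finset.sum_congr rfl fun i _ => ?_
  rw [integral_finsetSum _ fun j _ => h.dw.integrable_mul (hi i j) i j]
  refine Finset.sum_congr rfl fun j _ => ?_
  rw [h.dw.pair i j _ ((integrable_indicator_iff measurableSet_Ico).2 (hi i j)),
    ← integral_indicator measurableSet_Ico]
  refine integral_congr_ae (ae_of_all _ fun t => ?_)
  by_cases ht : t ∈ Ico a b <;> simp [ht]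

omit [IsLocallyFiniteMeasure μ] in
theorem energy_comm (h : IsModel c J q w μ Q W) (u u' : ℝ → Fin 2 → ℂ) (a b : ℝ) :
    energy μ W u u' a b = energy μ W u' u a b := by
  refine integral_congr_ae (ae_of_all _ fun t => ?_)
  simp only [Fin.sum_univ_two, (h.W_psd t).symm]
  ring

theorem energy_lin_right (h : IsModel c J q w μ Q W) (hu : IsBddMeasurable u) (hu' : IsBddMeasurable u')
    (hu'' : IsBddMeasurable u'') (α β : ℂ) (a b : ℝ) :
    energy μ W u (fun t => α • u' t + β • u'' t) a b
      = α * energy μ W u u' a b + β * energy μ W u u'' a b := by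
  rw [energy, energy, energy, ← integral_const_mul, ← integral_const_mul,
    ← integral_add ((h.integrableOn_energy hu hu' a b).const_mul α)
      ((h.integrableOn_energy hu hu'' a b).const_mul β)]
  refine integral_congr_ae (ae_of_all _ fun t => ?_)
  simp only [Fin.sum_univ_two, Pi.add_apply, Pi.smul_apply, smul_eq_mul]
  ring

theorem energy_lin_left (h : IsModel c J q w μ Q W) (hu : IsBddMeasurable u) (hu' : IsBddMeasurable u')
    (hu'' : IsBddMeasurable u'') (α β : ℂ) (a b : ℝ) :
    energy μ W (fun t => α • u' t + β • u'' t) u a b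
      = α * energy μ W u' u a b + β * energy μ W u'' u a b := by
  rw [h.energy_comm, h.energy_lin_right hu hu' hu'', h.energy_comm u, h.energy_comm u]

theorem norm_energy_le (h : IsModel c J q w μ Q W) {B B' : ℝ} (hu : ∀ t ∈ Ico a b, ‖u t‖ ≤ B)
    (hu' : ∀ t ∈ Ico a b, ‖u' t‖ ≤ B') :
    ‖energy μ W u u' a b‖ ≤ 4 * B * B' * μ.real (Ico a b) := by
  refine norm_setIntegral_le_of_norm_le_const measure_Ico_lt_top fun t ht => ?_
  have hB : 0 ≤ B := (norm_nonneg _).trans (hu t ht)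
  have key : ∀ i j, ‖(W t i j : ℂ) * (u t i * u' t j)‖ ≤ B * B' := fun i j => by
    rw [norm_mul, norm_mul, Complex.norm_real, ← one_mul (B * B')]
    have h1 := (norm_le_pi_norm (u t) i).trans (hu t ht)
    have h2 := (norm_le_pi_norm (u' t) j).trans (hu' t ht)
    have h3 : ‖W t i j‖ ≤ 1 := h.dw.bdd t i j
    gcongr
  refine (norm_sum_le _ _).trans ((Finset.sum_le_sum fun i _ => (norm_sum_le _ _).trans
    (Finset.sum_le_sum fun j _ => key i j)).trans (le_of_eq ?_))
  simp only [Fin.sum_univ_two]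
  ring

omit [IsLocallyFiniteMeasure μ] in
theorem energy_star (μ : Measure ℝ) (W : ℝ → Matrix (Fin 2) (Fin 2) ℝ) (u u' : ℝ → Fin 2 → ℂ)
    (a b : ℝ) : energy μ W (fun t => star (u t)) (fun t => star (u' t)) a b
      = star (energy μ W u u' a b) := by
  rw [energy, energy, ← starRingEnd_apply, ← integral_conj]
  refine integral_congr_ae (ae_of_all _ fun t => ?_)
  simp [Fin.sum_univ_two]

theorem exists_energy_star_self_eq (h : IsModel c J q w μ Q W) (hu : IsBddMeasurable u) (a b : ℝ) :
    ∃ r : ℝ, 0 ≤ r ∧ energy μ W (fun t => star (u t)) u a b = r ∧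
      (r = 0 → ∀ᵐ t ∂μ.restrict (Ico a b), ∀ i, ∑ j, (W t i j : ℂ) * u t j = 0) := by
  choose r hr0 hr using fun t => (h.W_psd t).re_nonneg (u t)
  have e : (fun t => ∑ i, ∑ j, (W t i j : ℂ) * (star (u t) i * u t j)) = fun t => (r t : ℂ) :=
    funext hr
  have hi : IntegrableOn (fun t => (r t : ℂ)) (Ico a b) μ := e ▸ h.integrableOn_energy hu.conj hu a b
  have hi' : IntegrableOn r (Ico a b) μ := by
    have := hi.re
    simpa [IntegrableOn] using this
  refine ⟨∫ t in Ico a b, r t ∂μ, integral_nonneg hr0, ?_, fun h0 => ?_⟩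
  · rw [energy, e, integral_complex_ofReal]
  · filter_upwards [(integral_eq_zero_iff_of_nonneg hr0 hi').1 h0] with t ht i
    refine (h.W_psd t).mulVec_eq_zero ?_ i
    have := hr t
    rw [ht] at this
    simpa using this

/-- Lagrange's identity. -/
theorem wronskian_sub_wronskian (h : IsModel c J q w μ Q W) (hu : IsSolution J q w l u)
    (hu' : IsSolution J q w l' u') (hab : a ≤ b) :
    wronskian (Function.leftLim u b) (Function.leftLim u' b)
      - wronskian (Function.leftLim u a) (Function.leftLim u' a)
      = (l - l') / c * energy μ W u u' a b := by
  rw [(h.intSol hu a b).wronskian_sub_wronskian (h.isTracelessCoeff l) (h.isTracelessCoeff l') hab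
    (h.intSol hu' a b), energy, ← integral_const_mul]
  refine integral_congr_ae (ae_of_all _ fun t => ?_)
  have hc : (c : ℂ) ≠ 0 := by exact_mod_cast h.c_ne
  simp only [wronskian, aMat_mulVec_zero, aMat_mulVec_one]
  simp only [Matrix.mulVec, dotProduct, Fin.sum_univ_two, hMat, Matrix.of_apply, (h.W_psd t).symm,
    h.Q_symm t]
  ring

theorem energy_comp_add_int (h : IsModel c J q w μ Q W) (hyp : IsAdmissible ω J q w)
    (hu : IsSolution J q w l u) (hu' : IsSolution J q w l' u') (n : ℤ) (a b : ℝ) :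
    energy μ W (fun t => u (t + n * ω)) (fun t => u' (t + n * ω)) a b
      = energy μ W u u' (a + n * ω) (b + n * ω) := by
  rw [h.energy_eq_sum_pair (hu.comp_add_int hyp n).isBddMeasurable (hu'.comp_add_int hyp n).isBddMeasurable,
    h.energy_eq_sum_pair hu.isBddMeasurable hu'.isBddMeasurable]
  refine Finset.sum_congr rfl fun i _ => Finset.sum_congr rfl fun j _ => ?_
  rw [← (hyp.w_periodic i j).pair_comp_add_int n
    ((Ico (a + n * ω) (b + n * ω)).indicator fun t => u t i * u' t j)]
  congr 1
  funext t
  simp [indicator, mem_Ico]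

/-- A solution without energy belongs to `ℒ₀`. -/
theorem mem_L0 (h : IsModel c J q w μ Q W) (hyp : IsAdmissible ω J q w)
    (hu : IsSolution J q w l u)
    (h0 : ∀ n : ℤ, energy μ W (fun t => star (u (t + n * ω))) (fun t => u (t + n * ω)) 0 ω = 0) :
    u ∈ L0 J q w := by
  have hcell : ∀ n : ℤ, ∀ᵐ t ∂μ.restrict (Ico ((0 : ℝ) + n • ω) (0 + (n + 1) • ω)),
      ∀ i, ∑ j, (W t i j : ℂ) * u t j = 0 := by
    intro n
    obtain ⟨r, -, hr, hz⟩ := h.exists_energy_star_self_eq hu.isBddMeasurable (0 + n • ω) (0 + (n + 1) • ω)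
    refine hz ?_
    have e := h.energy_comp_add_int hyp (h.isSolution_star hu) hu n 0 ω
    rw [h0 n] at e
    have e2 : (0 : ℝ) + (n + 1) • ω = ω + n * ω := by
      rw [zsmul_eq_mul]; push_cast; ring
    rw [e2, zsmul_eq_mul, ← e] at hr
    exact_mod_cast hr.symm
  have hae : ∀ᵐ t ∂μ, ∀ i, ∑ j, (W t i j : ℂ) * u t j = 0 := by
    have := (ae_restrict_iUnion_iff (μ := μ) (fun n : ℤ => Ico ((0 : ℝ) + n • ω) (0 + (n + 1) • ω))
      fun t => ∀ i, ∑ j, (W t i j : ℂ) * u t j = 0).2 hcell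
    rwa [iUnion_Ico_add_zsmul hyp.period_pos, Measure.restrict_univ] at this
  have hwz : ∀ φ : ℝ → ℂ, IsTestFunction φ → ∀ i, mulApply w u φ i = 0 := by
    intro φ hφ i
    have hi : ∀ j, Integrable (fun t => u t j * φ t) μ := fun j =>
      hu.isBddMeasurable.bdd.integrable_mul hu.isBddMeasurable.meas j hφ.1.continuous hφ.2
    rw [mulApply_eq h.dw hi, ← integral_finsetSum _ fun j _ => h.dw.integrable_mul (hi j) i j]
    refine integral_eq_zero_of_ae ?_
    filter_upwards [hae] with t ht
    simp only [← mul_assoc, ← Finset.sum_mul, ht i, zero_mul, Pi.zero_apply]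
  -- Once wu = 0, the right-hand side disappears whatever l is, and the equation becomes that of ℒ₀.
  refine ⟨hu.1, fun φ hφ i => ⟨?_, hwz φ hφ i⟩⟩
  rw [hu.2 φ hφ i, hwz φ hφ i, mul_zero]

/-- The multiplier has modulus 1, so the products of a conjugated component with a component are
periodic. Zero energy over one period is therefore zero energy over all of them. -/
theorem eq_zero_of_multiplier (h : IsModel c J q w μ Q W) (hyp : IsAdmissible ω J q w)
    (hL0 : ∀ u ∈ L0 J q w, u = 0) (hu : IsSolution J q w l u) {σ : ℂ} (hσ : star σ * σ = 1)
    (hper : ∀ x, u (x + ω) = σ • u x)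
    (h0 : energy μ W (fun t => star (u t)) u 0 ω = 0) : u = 0 := by
  refine hL0 u (h.mem_L0 hyp hu fun n => ?_)
  rw [← h0]
  have hp : ∀ i j, Function.Periodic (fun x => star (u x) i * u x j) ω := fun i j x => by
    simp only [hper, star_smul, Pi.smul_apply, smul_eq_mul]
    linear_combination (star (u x) i * u x j) * hσ
  refine integral_congr_ae (ae_of_all _ fun t => ?_)
  refine Finset.sum_congr rfl fun i _ => Finset.sum_congr rfl fun j _ => ?_
  exact congrArg ((W t i j : ℂ) * ·) ((hp i j).int_mul n t)

theorem eq_zero_of_forall_energy (h : IsModel c J q w μ Q W) (hyp : IsAdmissible ω J q w)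
    (hL0 : ∀ u ∈ L0 J q w, u = 0) (hu : IsSolution J q w l u)
    (h0 : ∀ v, IsSolution J q w l v → energy μ W (fun t => star (v t)) v 0 ω = 0) : u = 0 :=
  hL0 u (h.mem_L0 hyp hu fun n => h0 _ (hu.comp_add_int hyp n))

/-- The multipliers `±1` occur at real spectral parameters only. -/
theorem im_eq_zero_of_trace (h : IsModel c J q w μ Q W) (hyp : IsAdmissible ω J q w)
    (hL0 : ∀ u ∈ L0 J q w, u = 0) {M : Matrix (Fin 2) (Fin 2) ℂ}
    (hM : IsMonodromyMatrix ω J q w l M) {σ : ℂ} (hσ : σ ^ 2 = 1) (hσ' : star σ = σ)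
    (ht : M.trace = 2 * σ) : star l = l := by
  obtain ⟨U, hU, hper⟩ := hM
  obtain ⟨z, hz, e⟩ := exists_eigenvector_of_det_eq_one hσ (h.det_eq_one hyp hU hper) ht
  have hu := hU.1 z
  by_contra hne
  have hc : (c : ℂ) ≠ 0 := by exact_mod_cast h.c_ne
  have hper' : ∀ x, U (x + ω) *ᵥ z = σ • U x *ᵥ z := fun x => by
    rw [hper, ← Matrix.mulVec_mulVec, e, Matrix.mulVec_smul]
  have hlim : Function.leftLim (fun x => U x *ᵥ z) ω
      = σ • Function.leftLim (fun x => U x *ᵥ z) 0 := by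
    have h1 := hu.1.1.leftLim_comp_add ω 0
    have h2 := h.leftLim_lin hu hu σ 0 0
    simp only [zero_smul, add_zero, zero_add, hper'] at h1 h2
    rw [← h1, h2]
  -- Lagrange's identity for the conjugate of u, at parameter `star l`, and u. The boundary terms
  -- agree because σ is real with σ² = 1, so non-real l would make the energy vanish.
  have hs := h.wronskian_sub_wronskian (h.isSolution_star hu) hu hyp.period_pos.le
  rw [h.leftLim_star hu, h.leftLim_star hu, hlim] at hs
  have e0 : energy μ W (fun t => star (U t *ᵥ z)) (fun x => U x *ᵥ z) 0 ω = 0 := by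
    refine (mul_eq_zero.1 (hs.symm.trans ?_)).resolve_left
      (div_ne_zero (sub_ne_zero.2 hne) hc)
    simp only [wronskian, star_smul, hσ', Pi.smul_apply, smul_eq_mul]
    linear_combination (star (Function.leftLim (fun x => U x *ᵥ z) 0) 0
      * Function.leftLim (fun x => U x *ᵥ z) 0 1 - star (Function.leftLim (fun x => U x *ᵥ z) 0) 1
      * Function.leftLim (fun x => U x *ᵥ z) 0 0) * hσ
  have hz0 := h.eq_zero_of_multiplier hyp hL0 hu (by rw [hσ', ← sq, hσ]) hper' e0
  exact hz (hU.mulVec_injective fun x => by rw [Matrix.mulVec_zero]; exact congrFun hz0 x)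

end IsModel

end PeriodicSystem

/-! ### Canonical solutions and their dependence on the spectral parameter -/

/-- Left limits at points slightly to the right of t approximate the right limit at t, so a bound on
left limits passes to right limits. -/
theorem norm_right_limit_le {f g : ℝ → Fin 2 → ℂ} {r : Fin 2 → ℂ} {t b B : ℝ} (htb : t < b)
    (hr : Tendsto f (𝓝[>] t) (𝓝 r)) (hg : ∀ y, Tendsto f (𝓝[<] y) (𝓝 (g y)))
    (hB : ∀ y ∈ Ioo t b, ‖g y‖ ≤ B) : ‖r‖ ≤ B := by
  by_contra! h
  obtain ⟨B', hB', hr'⟩ := exists_between h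
  obtain ⟨d, hd, hs⟩ := mem_nhdsGT_iff_exists_Ioo_subset.1 (hr.norm.eventually_const_lt hr')
  have hd : t < d := hd
  obtain ⟨y, hy⟩ := exists_between (lt_min hd htb)
  have hyd := hy.2.trans_le (min_le_left _ _)
  have : B' ≤ ‖g y‖ := by
    refine ge_of_tendsto (hg y).norm ?_
    filter_upwards [Ioo_mem_nhdsLT hy.1] with s hs'
    exact (hs ⟨hs'.1, hs'.2.trans hyd⟩ : B' < ‖f s‖).le
  linarith [hB y ⟨hy.1, hy.2.trans_le (min_le_right _ _)⟩]

theorem LocallyBoundedVariationOn.exists_norm_leftLim_le {u : ℝ → Fin 2 → ℂ}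
    (hu : LocallyBoundedVariationOn u univ) (a b : ℝ) :
    ∃ K, ∀ x ∈ Icc a b, ‖Function.leftLim u x‖ ≤ K := by
  obtain ⟨K, hK⟩ := hu.isLocallyBdd (a - 1) b
  refine ⟨K, fun x hx => le_of_tendsto (hu.tendsto_leftLim' x).norm ?_⟩
  filter_upwards [Ioo_mem_nhdsLT (show a - 1 < x by linarith [hx.1])] with s hs
  exact hK s ⟨hs.1.le, hs.2.le.trans hx.2⟩

namespace PeriodicSystem

variable {c : ℝ} {J : Matrix (Fin 2) (Fin 2) ℝ} {q w : Coeff} {μ : Measure ℝ}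
  {Q W : ℝ → Matrix (Fin 2) (Fin 2) ℝ} {ω : ℝ} {u u' : ℝ → Fin 2 → ℂ} {l l₀ : ℂ} {a b : ℝ}

/-- The balanced value is the mean of both one-sided limits, so control of left limits suffices.
Combinations are allowed because differences of solutions for distinct parameters must be estimated.
-/
theorem IsBalancedBV.norm_lin_le (hu : IsBalancedBV u) (hu' : IsBalancedBV u') {α β : ℂ} {B : ℝ}
    (hB : ∀ x ∈ Icc a b, ‖α • Function.leftLim u x + β • Function.leftLim u' x‖ ≤ B) {t : ℝ}
    (ht : t ∈ Ico a b) : ‖α • u t + β • u' t‖ ≤ B := by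
  have hr := norm_right_limit_le (f := fun t => α • u t + β • u' t) ht.2
    (((hu.1.tendsto_rightLim' t).const_smul α).add ((hu'.1.tendsto_rightLim' t).const_smul β))
    (fun y => ((hu.1.tendsto_leftLim' y).const_smul α).add
      ((hu'.1.tendsto_leftLim' y).const_smul β))
    fun y hy => hB y ⟨ht.1.trans hy.1.le, hy.2.le⟩
  have hl := hB t ⟨ht.1, ht.2.le⟩
  have e : α • u t + β • u' t = (1 / 2 : ℂ) •
      ((α • Function.rightLim u t + β • Function.rightLim u' t)
        + (α • Function.leftLim u t + β • Function.leftLim u' t)) := by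
    rw [hu.2 t, hu'.2 t]
    module
  rw [e, norm_smul]
  have := norm_add_le (α • Function.rightLim u t + β • Function.rightLim u' t)
    (α • Function.leftLim u t + β • Function.leftLim u' t)
  have h2 : ‖(1 / 2 : ℂ)‖ = 1 / 2 := by norm_num
  rw [h2]
  linarith

theorem IsBalancedBV.norm_le (hu : IsBalancedBV u) {B : ℝ}
    (hB : ∀ x ∈ Icc a b, ‖Function.leftLim u x‖ ≤ B) {t : ℝ} (ht : t ∈ Ico a b) : ‖u t‖ ≤ B := by
  simpa using hu.norm_lin_le hu (α := 1) (β := 0) (by simpa using hB) ht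

open Classical in
/-- The solution of `J u' + q u = l w u` with left limit `z` at `0`. -/
noncomputable def sol (J : Matrix (Fin 2) (Fin 2) ℝ) (q w : Coeff) (l : ℂ) (z : Fin 2 → ℂ) :
    ℝ → Fin 2 → ℂ :=
  if h : ∃ u, IsSolution J q w l u ∧ Function.leftLim u 0 = z then h.choose else 0

/-- The monodromy matrix with respect to the fundamental matrix whose left limit at `0` is `1`. -/
noncomputable def monodromy (ω : ℝ) (J : Matrix (Fin 2) (Fin 2) ℝ) (q w : Coeff) (l : ℂ) :
    Matrix (Fin 2) (Fin 2) ℂ :=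
  !![Function.leftLim (sol J q w l ![1, 0]) ω 0, Function.leftLim (sol J q w l ![0, 1]) ω 0;
    Function.leftLim (sol J q w l ![1, 0]) ω 1, Function.leftLim (sol J q w l ![0, 1]) ω 1]

namespace IsModel

variable [IsLocallyFiniteMeasure μ]

theorem isSolution_sol (h : IsModel c J q w μ Q W) (hl : IsGood c μ Q W l) (z : Fin 2 → ℂ) :
    IsSolution J q w l (sol J q w l z) := by
  rw [sol, dif_pos (h.exists_isSolution hl z)]
  exact (h.exists_isSolution hl z).choose_spec.1

theorem leftLim_sol (h : IsModel c J q w μ Q W) (hl : IsGood c μ Q W l) (z : Fin 2 → ℂ) :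
    Function.leftLim (sol J q w l z) 0 = z := by
  rw [sol, dif_pos (h.exists_isSolution hl z)]
  exact (h.exists_isSolution hl z).choose_spec.2

theorem eq_sol (h : IsModel c J q w μ Q W) (hl : IsGood c μ Q W l) (hu : IsSolution J q w l u) :
    u = sol J q w l (Function.leftLim u 0) :=
  h.eq_of_leftLim_eq hl hu (h.isSolution_sol hl _) (h.leftLim_sol hl _).symm

theorem sol_lin (h : IsModel c J q w μ Q W) (hl : IsGood c μ Q W l) (α β : ℂ)
    (z z' : Fin 2 → ℂ) :
    sol J q w l (α • z + β • z') = fun t => α • sol J q w l z t + β • sol J q w l z' t := by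
  rw [h.eq_sol hl (h.isSolution_lin (h.isSolution_sol hl z) (h.isSolution_sol hl z') α β),
    h.leftLim_lin (h.isSolution_sol hl z) (h.isSolution_sol hl z'), h.leftLim_sol hl,
    h.leftLim_sol hl]

theorem sol_eq (h : IsModel c J q w μ Q W) (hl : IsGood c μ Q W l) (z : Fin 2 → ℂ) :
    sol J q w l z = fun t => z 0 • sol J q w l ![1, 0] t + z 1 • sol J q w l ![0, 1] t := by
  rw [← h.sol_lin hl]
  congr 1
  ext i
  fin_cases i <;> simp

theorem leftLim_sol_eq (h : IsModel c J q w μ Q W) (hl : IsGood c μ Q W l) (z : Fin 2 → ℂ)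
    (x : ℝ) : Function.leftLim (sol J q w l z) x = z 0 • Function.leftLim (sol J q w l ![1, 0]) x
      + z 1 • Function.leftLim (sol J q w l ![0, 1]) x := by
  rw [h.sol_eq hl, h.leftLim_lin (h.isSolution_sol hl _) (h.isSolution_sol hl _)]

theorem leftLim_sol_period (h : IsModel c J q w μ Q W) (hl : IsGood c μ Q W l) (z : Fin 2 → ℂ) :
    Function.leftLim (sol J q w l z) ω = monodromy ω J q w l *ᵥ z := by
  rw [h.leftLim_sol_eq hl]
  ext i
  fin_cases i <;> simp [monodromy, Matrix.mulVec, dotProduct, Fin.sum_univ_two] <;> ring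

theorem sol_add_period (h : IsModel c J q w μ Q W) (hyp : IsAdmissible ω J q w)
    (hl : IsGood c μ Q W l) (z : Fin 2 → ℂ) (x : ℝ) :
    sol J q w l z (x + ω) = sol J q w l (monodromy ω J q w l *ᵥ z) x := by
  have h1 := h.isSolution_sol hl z
  have h2 := h.eq_sol hl (h1.comp_add_period hyp)
  rw [h1.1.1.leftLim_comp_add, zero_add, h.leftLim_sol_period hl] at h2
  exact congrFun h2 x

theorem isMonodromyMatrix_monodromy (h : IsModel c J q w μ Q W) (hyp : IsAdmissible ω J q w)
    (hl : IsGood c μ Q W l) : IsMonodromyMatrix ω J q w l (monodromy ω J q w l) := by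
  set U : ℝ → Matrix (Fin 2) (Fin 2) ℂ := fun x =>
    !![sol J q w l ![1, 0] x 0, sol J q w l ![0, 1] x 0;
      sol J q w l ![1, 0] x 1, sol J q w l ![0, 1] x 1] with hU
  have e : ∀ z x, U x *ᵥ z = sol J q w l z x := fun z x => by
    rw [h.sol_eq hl z]
    ext i
    fin_cases i <;> simp [hU, Matrix.mulVec, dotProduct, Fin.sum_univ_two] <;> ring
  refine ⟨U, ⟨fun z => ?_, fun u hu => ⟨Function.leftLim u 0, ?_, fun d hd => ?_⟩⟩, fun x => ?_⟩
  · simp only [e]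
    exact h.isSolution_sol hl z
  · change u = fun x => U x *ᵥ Function.leftLim u 0
    simp only [e]
    exact h.eq_sol hl hu
  · have hd' : u = fun x => U x *ᵥ d := hd
    simp only [e] at hd'
    rw [hd']
    exact (h.leftLim_sol hl d).symm
  · exact matrix_ext_mulVec fun z => by rw [← Matrix.mulVec_mulVec, e, e, h.sol_add_period hyp hl]

theorem discriminant_eq (h : IsModel c J q w μ Q W) (hyp : IsAdmissible ω J q w)
    (hl : IsGood c μ Q W l) : discriminant ω J q w l = (monodromy ω J q w l).trace :=
  discriminant_eq_trace (h.isMonodromyMatrix_monodromy hyp hl)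

theorem wronskian_sol (h : IsModel c J q w μ Q W) (hl : IsGood c μ Q W l) (x : ℝ) :
    wronskian (Function.leftLim (sol J q w l ![1, 0]) x)
      (Function.leftLim (sol J q w l ![0, 1]) x) = 1 := by
  rw [h.wronskian_leftLim_eq (h.isSolution_sol hl _) (h.isSolution_sol hl _) x 0, h.leftLim_sol hl,
    h.leftLim_sol hl]
  simp [wronskian]

theorem det_monodromy (h : IsModel c J q w μ Q W) (hl : IsGood c μ Q W l) :
    (monodromy ω J q w l).det = 1 := by
  rw [← h.wronskian_sol hl ω, Matrix.det_fin_two, wronskian]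
  simp only [monodromy, Matrix.of_apply, Matrix.cons_val', Matrix.cons_val_zero,
    Matrix.cons_val_one, Matrix.cons_val_fin_one]
  ring

theorem star_sol (h : IsModel c J q w μ Q W) (hl : IsGood c μ Q W l) (hr : star l = l)
    (z : Fin 2 → ℂ) : (fun t => star (sol J q w l z t)) = sol J q w l (star z) := by
  have hs := h.isSolution_star (h.isSolution_sol hl z)
  rw [hr] at hs
  rw [h.eq_sol hl hs, h.leftLim_star (h.isSolution_sol hl z), h.leftLim_sol hl]

theorem star_monodromy (h : IsModel c J q w μ Q W) (hl : IsGood c μ Q W l) (hr : star l = l)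
    (i j : Fin 2) : star (monodromy ω J q w l i j) = monodromy ω J q w l i j := by
  have key : ∀ z : Fin 2 → ℂ, star z = z → ∀ i,
      (starRingEnd ℂ) (Function.leftLim (sol J q w l z) ω i)
        = Function.leftLim (sol J q w l z) ω i := fun z hz i => by
    have := h.leftLim_star (h.isSolution_sol hl z) ω
    rw [h.star_sol hl hr, hz] at this
    exact (congrFun this i).symm
  have h0 := key ![1, 0] (by ext i; fin_cases i <;> simp)
  have h1 := key ![0, 1] (by ext i; fin_cases i <;> simp)
  fin_cases i <;> fin_cases j <;> simp [monodromy, h0, h1]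

/-- Variation of the spectral parameter. -/
theorem leftLim_sol_sub (h : IsModel c J q w μ Q W) (hl₀ : IsGood c μ Q W l₀)
    (hl : IsGood c μ Q W l) (z : Fin 2 → ℂ) {x : ℝ} (hx : 0 ≤ x) :
    Function.leftLim (sol J q w l z) x - Function.leftLim (sol J q w l₀ z) x
      = ((l - l₀) / c) •
        (energy μ W (sol J q w l₀ ![0, 1]) (sol J q w l z) 0 x
          • Function.leftLim (sol J q w l₀ ![1, 0]) x
        - energy μ W (sol J q w l₀ ![1, 0]) (sol J q w l z) 0 x
          • Function.leftLim (sol J q w l₀ ![0, 1]) x) := by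
  have hp := h.wronskian_sub_wronskian (h.isSolution_sol hl₀ ![1, 0]) (h.isSolution_sol hl z) hx
  have hq := h.wronskian_sub_wronskian (h.isSolution_sol hl z) (h.isSolution_sol hl₀ ![0, 1]) hx
  rw [h.energy_comm] at hq
  rw [h.leftLim_sol hl₀, h.leftLim_sol hl] at hp hq
  have hw := h.wronskian_sol hl₀ x
  rw [h.leftLim_sol_eq hl₀ z]
  set p := Function.leftLim (sol J q w l₀ ![1, 0]) x
  set r := Function.leftLim (sol J q w l₀ ![0, 1]) x
  set v := Function.leftLim (sol J q w l z) x
  -- In the basis p, r of Wronskian 1 the coordinates of v are Wronskians with r and p. Lagrange's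
  -- identity evaluates them as their initial values plus energies.
  have hcr := wronskian_cramer p r v
  rw [hw, one_smul] at hcr
  rw [eq_add_of_sub_eq hp, eq_add_of_sub_eq hq] at hcr
  rw [← hcr]
  ext i
  simp [wronskian]
  ring

/-- In the variation formula there are two terms, each an energy of size at most 4KSμ times a vector
of norm at most K. This gives the factor 8K². -/
theorem norm_leftLim_sol_sub_le (h : IsModel c J q w μ Q W) (hl₀ : IsGood c μ Q W l₀)
    (hl : IsGood c μ Q W l) (z : Fin 2 → ℂ) {K S : ℝ}
    (hp : ∀ x ∈ Icc 0 b, ‖Function.leftLim (sol J q w l₀ ![1, 0]) x‖ ≤ K)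
    (hq : ∀ x ∈ Icc 0 b, ‖Function.leftLim (sol J q w l₀ ![0, 1]) x‖ ≤ K)
    (hS : ∀ x ∈ Icc 0 b, ‖Function.leftLim (sol J q w l z) x‖ ≤ S) {x : ℝ} (hx : x ∈ Icc 0 b) :
    ‖Function.leftLim (sol J q w l z) x - Function.leftLim (sol J q w l₀ z) x‖
      ≤ ‖l - l₀‖ * (8 * K ^ 2 * μ.real (Icc 0 b) / |c| * S) := by
  have hsub : Icc 0 x ⊆ Icc 0 b := Icc_subset_Icc_right hx.2
  have hm : μ.real (Ico 0 x) ≤ μ.real (Icc 0 b) :=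
    measureReal_mono (Ico_subset_Icc_self.trans hsub) measure_Icc_lt_top.ne
  have hK : 0 ≤ K := (norm_nonneg _).trans (hp x hx)
  have hS0 : 0 ≤ S := (norm_nonneg _).trans (hS x hx)
  have hE : ∀ {z'}, (∀ x ∈ Icc 0 b, ‖Function.leftLim (sol J q w l₀ z') x‖ ≤ K) →
      ‖energy μ W (sol J q w l₀ z') (sol J q w l z) 0 x‖ ≤ 4 * K * S * μ.real (Icc 0 b) := by
    intro z' hz'
    refine (h.norm_energy_le
      (fun t ht => (h.isSolution_sol hl₀ z').1.norm_le (fun y hy => hz' y (hsub hy)) ht)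
      fun t ht => (h.isSolution_sol hl z).1.norm_le (fun y hy => hS y (hsub hy)) ht).trans ?_
    gcongr
  rw [h.leftLim_sol_sub hl₀ hl z hx.1, norm_smul, norm_div, Complex.norm_real, Real.norm_eq_abs,
    div_mul_eq_mul_div, mul_div_assoc]
  refine mul_le_mul_of_nonneg_left ?_ (norm_nonneg _)
  rw [div_mul_eq_mul_div]
  refine div_le_div_of_nonneg_right ?_ (abs_nonneg _)
  refine (norm_sub_le _ _).trans ?_
  rw [norm_smul, norm_smul]
  have h1 := mul_le_mul (hE hq) (hp x hx) (norm_nonneg _) (by positivity)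
  have h2 := mul_le_mul (hE hp) (hq x hx) (norm_nonneg _) (by positivity)
  linarith

/-- The a priori bound involves the supremum S of the unknown solution itself. For l close to l₀ its
coefficient is below 1/2, so S can be absorbed, giving S ≤ 2K₃ and a Lipschitz bound at l₀. -/
theorem exists_norm_leftLim_sol_sub_le (h : IsModel c J q w μ Q W) (hyp : IsAdmissible ω J q w)
    (l₀ : ℝ) (z : Fin 2 → ℂ) : ∃ C, ∀ᶠ l in 𝓝 (l₀ : ℂ), ∀ x ∈ Icc 0 ω,
      ‖Function.leftLim (sol J q w l z) x - Function.leftLim (sol J q w l₀ z) x‖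
        ≤ ‖l - l₀‖ * C := by
  have hl₀ := h.isGood_ofReal hyp l₀
  obtain ⟨K₁, hK₁⟩ := (h.isSolution_sol hl₀ ![1, 0]).1.1.exists_norm_leftLim_le 0 ω
  obtain ⟨K₂, hK₂⟩ := (h.isSolution_sol hl₀ ![0, 1]).1.1.exists_norm_leftLim_le 0 ω
  obtain ⟨K₃, hK₃⟩ := (h.isSolution_sol hl₀ z).1.1.exists_norm_leftLim_le 0 ω
  set K := max K₁ K₂
  set B := 8 * K ^ 2 * μ.real (Icc 0 ω) / |c| with hB
  have hlim : Tendsto (fun l : ℂ => ‖l - l₀‖ * B) (𝓝 (l₀ : ℂ)) (𝓝 0) := by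
    have : Continuous fun l : ℂ => ‖l - l₀‖ * B := by fun_prop
    simpa using this.tendsto (l₀ : ℂ)
  refine ⟨B * (2 * K₃), ?_⟩
  filter_upwards [h.eventually_isGood hyp l₀, hlim.eventually_lt_const (show (0 : ℝ) < 1 / 2 by
    norm_num)] with l hl hsmall
  have key : ∀ {S}, (∀ x ∈ Icc 0 ω, ‖Function.leftLim (sol J q w l z) x‖ ≤ S) → ∀ x ∈ Icc 0 ω,
      ‖Function.leftLim (sol J q w l z) x - Function.leftLim (sol J q w l₀ z) x‖
        ≤ ‖l - l₀‖ * (B * S) := fun hS x hx =>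
    h.norm_leftLim_sol_sub_le hl₀ hl z (fun y hy => (hK₁ y hy).trans (le_max_left _ _))
      (fun y hy => (hK₂ y hy).trans (le_max_right _ _)) hS hx
  refine key ?_
  have h0 : (0 : ℝ) ∈ Icc 0 ω := ⟨le_rfl, hyp.period_pos.le⟩
  obtain ⟨S₀, hS₀⟩ := (h.isSolution_sol hl z).1.1.exists_norm_leftLim_le 0 ω
  set T := (fun x => ‖Function.leftLim (sol J q w l z) x‖) '' Icc 0 ω with hT
  have hbdd : BddAbove T := ⟨S₀, by rintro _ ⟨x, hx, rfl⟩; exact hS₀ x hx⟩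
  have hle : ∀ x ∈ Icc 0 ω, ‖Function.leftLim (sol J q w l z) x‖ ≤ sSup T := fun x hx =>
    le_csSup hbdd ⟨x, hx, rfl⟩
  have hS0 : 0 ≤ sSup T := (norm_nonneg _).trans (hle 0 h0)
  have hsup : sSup T ≤ K₃ + 1 / 2 * sSup T := by
    refine csSup_le ⟨_, 0, h0, rfl⟩ ?_
    rintro _ ⟨x, hx, rfl⟩
    have h1 := key hle x hx
    rw [← mul_assoc] at h1
    have h2 := mul_le_mul_of_nonneg_right hsmall.le hS0
    have h3 := norm_sub_norm_le (Function.leftLim (sol J q w l z) x)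
      (Function.leftLim (sol J q w l₀ z) x)
    linarith [hK₃ x hx]
  exact fun x hx => (hle x hx).trans (by linarith)

theorem tendsto_energy_sol (h : IsModel c J q w μ Q W) (hyp : IsAdmissible ω J q w)
    (l₀ : ℝ) (z z' : Fin 2 → ℂ) :
    Tendsto (fun l => energy μ W (sol J q w l₀ z') (sol J q w l z) 0 ω) (𝓝 (l₀ : ℂ))
      (𝓝 (energy μ W (sol J q w l₀ z') (sol J q w l₀ z) 0 ω)) := by
  have hl₀ := h.isGood_ofReal hyp l₀
  obtain ⟨C, hC⟩ := h.exists_norm_leftLim_sol_sub_le hyp l₀ z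
  obtain ⟨K, hK⟩ := (h.isSolution_sol hl₀ z').1.1.exists_norm_leftLim_le 0 ω
  rw [tendsto_iff_norm_sub_tendsto_zero]
  have hlim : Tendsto (fun l : ℂ => 4 * K * (‖l - l₀‖ * C) * μ.real (Ico 0 ω)) (𝓝 (l₀ : ℂ))
      (𝓝 0) := by
    have : Continuous fun l : ℂ => 4 * K * (‖l - l₀‖ * C) * μ.real (Ico 0 ω) := by fun_prop
    simpa using this.tendsto (l₀ : ℂ)
  refine squeeze_zero' (Eventually.of_forall fun _ => norm_nonneg _) ?_ hlim
  filter_upwards [hC, h.eventually_isGood hyp l₀] with l hlC hl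
  have e := h.energy_lin_right (h.isSolution_sol hl₀ z').isBddMeasurable
    (h.isSolution_sol hl z).isBddMeasurable (h.isSolution_sol hl₀ z).isBddMeasurable 1 (-1) 0 ω
  have e' : energy μ W (sol J q w l₀ z') (sol J q w l z) 0 ω
      - energy μ W (sol J q w l₀ z') (sol J q w l₀ z) 0 ω = energy μ W (sol J q w l₀ z')
        (fun t => (1 : ℂ) • sol J q w l z t + (-1 : ℂ) • sol J q w l₀ z t) 0 ω := by
    rw [e]; ring
  rw [e']
  refine h.norm_energy_le (fun t ht => (h.isSolution_sol hl₀ z').1.norm_le hK ht) fun t ht => ?_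
  refine (h.isSolution_sol hl z).1.norm_lin_le (h.isSolution_sol hl₀ z).1 (fun x hx => ?_) ht
  rw [one_smul, neg_one_smul, ← sub_eq_add_neg]
  exact hlC x hx

end IsModel

end PeriodicSystem

/-! ### The derivative of the discriminant and the assertions of the theorem -/

namespace PeriodicSystem

variable {c : ℝ} {J : Matrix (Fin 2) (Fin 2) ℝ} {q w : Coeff} {μ : Measure ℝ}
  {Q W : ℝ → Matrix (Fin 2) (Fin 2) ℝ} {ω : ℝ} {u : ℝ → Fin 2 → ℂ} {l l₀ : ℂ}

theorem sq_le_of_forall_nonneg {g₁ g₂ g₃ : ℝ}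
    (h : ∀ x y : ℝ, 0 ≤ x ^ 2 * g₁ + 2 * (x * y) * g₂ + y ^ 2 * g₃) : g₂ ^ 2 ≤ g₁ * g₃ := by
  have := discrim_le_zero (a := g₁) (b := 2 * g₂) (c := g₃) fun x => by
    have := h x 1
    linarith
  rw [discrim] at this
  linarith

/-- A semidefinite form orthogonal to an elliptic traceless matrix vanishes. -/
theorem eq_zero_of_elliptic {m₁ m₂ m₃ m₄ g₁ g₂ g₃ : ℝ} (hd : m₁ * m₄ - m₂ * m₃ = 1)
    (ht : (m₁ + m₄) ^ 2 < 4)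
    (h : ∀ x y : ℝ, 0 ≤ x ^ 2 * g₁ + 2 * (x * y) * g₂ + y ^ 2 * g₃)
    (h0 : -m₂ * g₁ + (m₁ - m₄) * g₂ + m₃ * g₃ = 0) : g₁ = 0 ∧ g₂ = 0 ∧ g₃ = 0 := by
  have hneg : (m₁ - m₄) ^ 2 + 4 * (m₂ * m₃) < 0 := by nlinarith
  have h3 : 0 ≤ g₃ := by simpa using h 0 1
  have h23 := sq_le_of_forall_nonneg h
  have e3 : g₃ = 0 := by
    -- At this vector h0 reduces the form to g₃ times a quarter of (m₁-m₄)² + 4m₂m₃, the squared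
    -- trace minus 4, which is negative. Hence g₃ ≤ 0.
    have := h m₂ (-((m₁ - m₄) / 2))
    have : 0 ≤ ((m₁ - m₄) ^ 2 + 4 * (m₂ * m₃)) * g₃ := by
      have e : m₂ ^ 2 * g₁ + 2 * (m₂ * -((m₁ - m₄) / 2)) * g₂ + (-((m₁ - m₄) / 2)) ^ 2 * g₃
          = ((m₁ - m₄) ^ 2 + 4 * (m₂ * m₃)) * g₃ / 4 := by linear_combination -m₂ * h0
      linarith
    nlinarith
  have e2 : g₂ = 0 := by
    rw [e3, mul_zero] at h23
    exact (pow_eq_zero_iff two_ne_zero).1 (le_antisymm h23 (sq_nonneg _))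
  refine ⟨?_, e2, e3⟩
  rw [e2, e3, mul_zero, mul_zero, add_zero, add_zero, neg_mul, neg_eq_zero, mul_eq_zero] at h0
  refine h0.resolve_left fun hz => ?_
  rw [hz] at hneg
  nlinarith [sq_nonneg (m₁ - m₄)]

namespace IsModel

variable [IsLocallyFiniteMeasure μ]

theorem eq_zero_of_sol_eq_zero (h : IsModel c J q w μ Q W) (hl : IsGood c μ Q W l)
    {z : Fin 2 → ℂ} (hz : sol J q w l z = 0) : z = 0 := by
  rw [← h.leftLim_sol hl z, hz]
  exact leftLim_eq_of_tendsto tendsto_const_nhds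

theorem monodromy_mulVec_sub (h : IsModel c J q w μ Q W) (hyp : IsAdmissible ω J q w)
    (hl₀ : IsGood c μ Q W l₀) (hl : IsGood c μ Q W l) (z : Fin 2 → ℂ) (i : Fin 2) :
    (monodromy ω J q w l *ᵥ z) i = (monodromy ω J q w l₀ *ᵥ z) i + (l - l₀) / c *
      (energy μ W (sol J q w l₀ ![0, 1]) (sol J q w l z) 0 ω * monodromy ω J q w l₀ i 0
      - energy μ W (sol J q w l₀ ![1, 0]) (sol J q w l z) 0 ω * monodromy ω J q w l₀ i 1) := by
  have e := congrFun (h.leftLim_sol_sub hl₀ hl z hyp.period_pos.le) i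
  rw [h.leftLim_sol_period hl, h.leftLim_sol_period hl₀, h.leftLim_sol_period hl₀,
    h.leftLim_sol_period hl₀] at e
  have e0 : (monodromy ω J q w l₀ *ᵥ ![1, 0]) i = monodromy ω J q w l₀ i 0 := by
    simp [Matrix.mulVec, dotProduct, Fin.sum_univ_two]
  have e1 : (monodromy ω J q w l₀ *ᵥ ![0, 1]) i = monodromy ω J q w l₀ i 1 := by
    simp [Matrix.mulVec, dotProduct, Fin.sum_univ_two]
  simp only [Pi.sub_apply, Pi.smul_apply, smul_eq_mul, e0, e1] at e
  linear_combination e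

theorem monodromy_apply_zero (h : IsModel c J q w μ Q W) (hyp : IsAdmissible ω J q w)
    (hl₀ : IsGood c μ Q W l₀) (hl : IsGood c μ Q W l) (i : Fin 2) :
    monodromy ω J q w l i 0 = monodromy ω J q w l₀ i 0 + (l - l₀) / c *
      (energy μ W (sol J q w l₀ ![0, 1]) (sol J q w l ![1, 0]) 0 ω * monodromy ω J q w l₀ i 0
      - energy μ W (sol J q w l₀ ![1, 0]) (sol J q w l ![1, 0]) 0 ω
        * monodromy ω J q w l₀ i 1) := by
  simpa [Matrix.mulVec, dotProduct, Fin.sum_univ_two] using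
    h.monodromy_mulVec_sub hyp hl₀ hl ![1, 0] i

theorem monodromy_apply_one (h : IsModel c J q w μ Q W) (hyp : IsAdmissible ω J q w)
    (hl₀ : IsGood c μ Q W l₀) (hl : IsGood c μ Q W l) (i : Fin 2) :
    monodromy ω J q w l i 1 = monodromy ω J q w l₀ i 1 + (l - l₀) / c *
      (energy μ W (sol J q w l₀ ![0, 1]) (sol J q w l ![0, 1]) 0 ω * monodromy ω J q w l₀ i 0
      - energy μ W (sol J q w l₀ ![1, 0]) (sol J q w l ![0, 1]) 0 ω
        * monodromy ω J q w l₀ i 1) := by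
  simpa [Matrix.mulVec, dotProduct, Fin.sum_univ_two] using
    h.monodromy_mulVec_sub hyp hl₀ hl ![0, 1] i

/-- The variation formula makes the difference quotient an exact combination of energies between
solutions at l₀ and at l. Only continuity of these energies is needed; the solutions are never
differentiated in l. -/
theorem hasDerivAt_discriminant (h : IsModel c J q w μ Q W) (hyp : IsAdmissible ω J q w) (l₀ : ℝ) :
    HasDerivAt (discriminant ω J q w)
      ((-monodromy ω J q w l₀ 0 1
          * energy μ W (sol J q w l₀ ![1, 0]) (sol J q w l₀ ![1, 0]) 0 ω
        + (monodromy ω J q w l₀ 0 0 - monodromy ω J q w l₀ 1 1)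
          * energy μ W (sol J q w l₀ ![1, 0]) (sol J q w l₀ ![0, 1]) 0 ω
        + monodromy ω J q w l₀ 1 0
          * energy μ W (sol J q w l₀ ![0, 1]) (sol J q w l₀ ![0, 1]) 0 ω) / c) (l₀ : ℂ) := by
  have hl₀ := h.isGood_ofReal hyp l₀
  have t := fun z z' => h.tendsto_energy_sol hyp l₀ z z'
  have hF := (((((t ![1, 0] ![0, 1]).mul_const (monodromy ω J q w l₀ 0 0)).sub
    ((t ![1, 0] ![1, 0]).mul_const (monodromy ω J q w l₀ 0 1))).add
    ((t ![0, 1] ![0, 1]).mul_const (monodromy ω J q w l₀ 1 0))).sub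
    ((t ![0, 1] ![1, 0]).mul_const (monodromy ω J q w l₀ 1 1))).div_const (c : ℂ)
  rw [hasDerivAt_iff_tendsto_slope]
  refine ((hF.mono_left nhdsWithin_le_nhds).congr' ?_).trans (le_of_eq (congrArg 𝓝 ?_))
  · filter_upwards [(h.eventually_isGood hyp l₀).filter_mono nhdsWithin_le_nhds,
      self_mem_nhdsWithin] with l hl hne
    rw [slope_def_field, h.discriminant_eq hyp hl, h.discriminant_eq hyp hl₀,
      Matrix.trace_fin_two, Matrix.trace_fin_two, h.monodromy_apply_zero hyp hl₀ hl,
      h.monodromy_apply_one hyp hl₀ hl, eq_div_iff (sub_ne_zero.2 hne)]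
    ring
  · rw [h.energy_comm (sol J q w l₀ ![0, 1]) (sol J q w l₀ ![1, 0])]
    ring

/-- The Gram matrix of the energy form at a real spectral parameter. -/
theorem exists_gram (h : IsModel c J q w μ Q W) (hl : IsGood c μ Q W l) (hr : star l = l) :
    ∃ g₁ g₂ g₃ : ℝ,
      energy μ W (sol J q w l ![1, 0]) (sol J q w l ![1, 0]) 0 ω = g₁ ∧
      energy μ W (sol J q w l ![1, 0]) (sol J q w l ![0, 1]) 0 ω = g₂ ∧
      energy μ W (sol J q w l ![0, 1]) (sol J q w l ![0, 1]) 0 ω = g₃ ∧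
      (∀ z, energy μ W (fun t => star (sol J q w l z t)) (sol J q w l z) 0 ω
        = star (z 0) * z 0 * g₁ + (star (z 0) * z 1 + star (z 1) * z 0) * g₂
          + star (z 1) * z 1 * g₃) ∧
      ∀ x y : ℝ, 0 ≤ x ^ 2 * g₁ + 2 * (x * y) * g₂ + y ^ 2 * g₃ := by
  have hreal : ∀ z z' : Fin 2 → ℂ, star z = z → star z' = z' → ∃ g : ℝ,
      energy μ W (sol J q w l z) (sol J q w l z') 0 ω = g := fun z z' hz hz' => by
    have e := energy_star μ W (sol J q w l z) (sol J q w l z') 0 ω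
    rw [h.star_sol hl hr, h.star_sol hl hr, hz, hz'] at e
    exact ⟨_, (Complex.conj_eq_iff_re.1 e.symm).symm⟩
  have s0 : star (![1, 0] : Fin 2 → ℂ) = ![1, 0] := by ext i; fin_cases i <;> simp
  have s1 : star (![0, 1] : Fin 2 → ℂ) = ![0, 1] := by ext i; fin_cases i <;> simp
  obtain ⟨g₁, e₁⟩ := hreal _ _ s0 s0
  obtain ⟨g₂, e₂⟩ := hreal _ _ s0 s1
  obtain ⟨g₃, e₃⟩ := hreal _ _ s1 s1
  have hp := (h.isSolution_sol hl ![1, 0]).isBddMeasurable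
  have hq := (h.isSolution_sol hl ![0, 1]).isBddMeasurable
  have key : ∀ z, energy μ W (fun t => star (sol J q w l z t)) (sol J q w l z) 0 ω
        = star (z 0) * z 0 * g₁ + (star (z 0) * z 1 + star (z 1) * z 0) * g₂
          + star (z 1) * z 1 * g₃ := fun z => by
    rw [h.star_sol hl hr, h.sol_eq hl z, h.sol_eq hl (star z),
      h.energy_lin_left (hp.lin hq _ _) hp hq, h.energy_lin_right hp hp hq,
      h.energy_lin_right hq hp hq, h.energy_comm (sol J q w l ![0, 1]) (sol J q w l ![1, 0]), e₁, e₂, e₃]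
    simp only [Pi.star_apply]
    ring
  refine ⟨g₁, g₂, g₃, e₁, e₂, e₃, key, fun x y => ?_⟩
  obtain ⟨r, hr0, hr, -⟩ := h.exists_energy_star_self_eq
    (h.isSolution_sol hl ![(x : ℂ), (y : ℂ)]).isBddMeasurable 0 ω
  rw [key] at hr
  simp only [Matrix.cons_val_zero, Matrix.cons_val_one, ← starRingEnd_apply,
    Complex.conj_ofReal] at hr
  have hr' : x * x * g₁ + (x * y + y * x) * g₂ + y * y * g₃ = r := by exact_mod_cast hr
  linarith

theorem exists_real_monodromy (h : IsModel c J q w μ Q W) (hl : IsGood c μ Q W l)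
    (hr : star l = l) : ∃ m₁ m₂ m₃ m₄ : ℝ, monodromy ω J q w l 0 0 = m₁ ∧
      monodromy ω J q w l 0 1 = m₂ ∧ monodromy ω J q w l 1 0 = m₃ ∧
      monodromy ω J q w l 1 1 = m₄ ∧ m₁ * m₄ - m₂ * m₃ = 1 := by
  have key : ∀ i j, monodromy ω J q w l i j = ((monodromy ω J q w l i j).re : ℂ) := fun i j =>
    (Complex.conj_eq_iff_re.1 (h.star_monodromy hl hr i j)).symm
  refine ⟨_, _, _, _, key 0 0, key 0 1, key 1 0, key 1 1, ?_⟩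
  have := h.det_monodromy (ω := ω) hl
  rw [Matrix.det_fin_two, key 0 0, key 0 1, key 1 0, key 1 1] at this
  exact_mod_cast this

theorem exists_discriminant_eq_ofReal (h : IsModel c J q w μ Q W) (hyp : IsAdmissible ω J q w) :
    ∃ D : ℝ → ℝ, ∀ l : ℝ, discriminant ω J q w l = D l := by
  refine ⟨fun l => (discriminant ω J q w l).re, fun l => ?_⟩
  have hl := h.isGood_ofReal hyp l
  obtain ⟨m₁, m₂, m₃, m₄, e₁, -, -, e₄, -⟩ :=
    h.exists_real_monodromy (ω := ω) hl (Complex.conj_ofReal l)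
  change _ = ((discriminant ω J q w l).re : ℂ)
  rw [h.discriminant_eq hyp hl, Matrix.trace_fin_two, e₁, e₄, ← Complex.ofReal_add,
    Complex.ofReal_re]

theorem deriv_discriminant_eq_ofReal (h : IsModel c J q w μ Q W) (hyp : IsAdmissible ω J q w)
    (l : ℝ) : deriv (discriminant ω J q w) l = ((deriv (discriminant ω J q w) l).re : ℂ) := by
  have hl := h.isGood_ofReal hyp l
  obtain ⟨m₁, m₂, m₃, m₄, e₁, e₂, e₃, e₄, -⟩ :=
    h.exists_real_monodromy (ω := ω) hl (Complex.conj_ofReal l)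
  obtain ⟨g₁, g₂, g₃, k₁, k₂, k₃, -, -⟩ := h.exists_gram (ω := ω) hl (Complex.conj_ofReal l)
  have hd := (h.hasDerivAt_discriminant hyp l).deriv
  rw [e₁, e₂, e₃, e₄, k₁, k₂, k₃] at hd
  have hd' : deriv (discriminant ω J q w) l
      = (((-m₂ * g₁ + (m₁ - m₄) * g₂ + m₃ * g₃) / c : ℝ) : ℂ) := by rw [hd]; push_cast; rfl
  rw [hd', Complex.ofReal_re]

/-- Multipliers `±1` with vanishing energy do not occur. -/
theorem eq_zero_of_eigenvector (h : IsModel c J q w μ Q W) (hyp : IsAdmissible ω J q w)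
    (hL0 : ∀ u ∈ L0 J q w, u = 0) (hl : IsGood c μ Q W l) {σ : ℝ} (hσ : σ ^ 2 = 1)
    {z : Fin 2 → ℂ} (hz : monodromy ω J q w l *ᵥ z = (σ : ℂ) • z)
    (h0 : energy μ W (fun t => star (sol J q w l z t)) (sol J q w l z) 0 ω = 0) : z = 0 := by
  refine h.eq_zero_of_sol_eq_zero hl (h.eq_zero_of_multiplier hyp hL0 (h.isSolution_sol hl z)
    (σ := (σ : ℂ)) ?_ (fun x => ?_) h0)
  · rw [← starRingEnd_apply, Complex.conj_ofReal, ← sq]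
    exact_mod_cast hσ
  · rw [h.sol_add_period hyp hl, hz]
    simpa using congrFun (h.sol_lin hl (σ : ℂ) 0 z z) x

/-- If the derivative vanished, the Gram matrix would pair to zero with a definite form and hence
vanish. All solutions would then lie in ℒ₀, although the one with left limit (1,0) is nonzero. -/
theorem deriv_ne_zero_of_sq_lt (h : IsModel c J q w μ Q W) (hyp : IsAdmissible ω J q w)
    (hL0 : ∀ u ∈ L0 J q w, u = 0) {l D : ℝ} (hD : discriminant ω J q w l = D) (hlt : D ^ 2 < 4) :
    deriv (discriminant ω J q w) l ≠ 0 := by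
  have hl := h.isGood_ofReal hyp l
  have hr : star (l : ℂ) = l := Complex.conj_ofReal l
  obtain ⟨m₁, m₂, m₃, m₄, e₁, e₂, e₃, e₄, hd⟩ := h.exists_real_monodromy (ω := ω) hl hr
  obtain ⟨g₁, g₂, g₃, k₁, k₂, k₃, hE, hpos⟩ := h.exists_gram (ω := ω) hl hr
  have hder := (h.hasDerivAt_discriminant hyp l).deriv
  rw [e₁, e₂, e₃, e₄, k₁, k₂, k₃] at hder
  intro h0
  rw [h0, eq_comm, div_eq_zero_iff] at hder
  have h1 : -m₂ * g₁ + (m₁ - m₄) * g₂ + m₃ * g₃ = 0 := by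
    exact_mod_cast hder.resolve_right (by exact_mod_cast h.c_ne)
  rw [h.discriminant_eq hyp hl, Matrix.trace_fin_two, e₁, e₄] at hD
  have ht : m₁ + m₄ = D := by exact_mod_cast hD
  obtain ⟨z₁, z₂, z₃⟩ := eq_zero_of_elliptic hd (by rw [ht]; exact hlt) hpos h1
  have hz : sol J q w (l : ℂ) ![1, 0] = 0 :=
    h.eq_zero_of_forall_energy hyp hL0 (h.isSolution_sol hl _) fun v hv => by
      rw [h.eq_sol hl hv, hE, z₁, z₂, z₃]
      simp
  simpa using congrFun (h.eq_zero_of_sol_eq_zero hl hz) 0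

/-- Here (M-σ)² = 0, so both columns of M - σ are annihilated by M - σ. Their energies are multiples
of the derivative of D; if it vanishes, so do these columns. -/
theorem deriv_eq_zero_iff (h : IsModel c J q w μ Q W) (hyp : IsAdmissible ω J q w)
    (hL0 : ∀ u ∈ L0 J q w, u = 0) {l σ : ℝ} (hσ : σ ^ 2 = 1)
    (hD : discriminant ω J q w l = 2 * σ) :
    deriv (discriminant ω J q w) l = 0 ↔ monodromy ω J q w l = (σ : ℂ) • 1 := by
  have hl := h.isGood_ofReal hyp l
  have hr : star (l : ℂ) = l := Complex.conj_ofReal l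
  obtain ⟨m₁, m₂, m₃, m₄, e₁, e₂, e₃, e₄, hd⟩ := h.exists_real_monodromy (ω := ω) hl hr
  obtain ⟨g₁, g₂, g₃, k₁, k₂, k₃, hE, hpos⟩ := h.exists_gram (ω := ω) hl hr
  have hder := (h.hasDerivAt_discriminant hyp l).deriv
  rw [e₁, e₂, e₃, e₄, k₁, k₂, k₃] at hder
  have hM : monodromy ω J q w l = !![(m₁ : ℂ), (m₂ : ℂ); (m₃ : ℂ), (m₄ : ℂ)] := by
    rw [← e₁, ← e₂, ← e₃, ← e₄]
    exact Matrix.eta_fin_two _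
  rw [h.discriminant_eq hyp hl, Matrix.trace_fin_two, e₁, e₄] at hD
  have ht : m₁ + m₄ = 2 * σ := by exact_mod_cast hD
  constructor
  · intro h0
    rw [h0, eq_comm, div_eq_zero_iff] at hder
    have h1 : -m₂ * g₁ + (m₁ - m₄) * g₂ + m₃ * g₃ = 0 := by
      exact_mod_cast hder.resolve_right (by exact_mod_cast h.c_ne)
    have hm : (m₁ - m₄) ^ 2 + 4 * (m₂ * m₃) = 0 := by
      linear_combination (m₁ + m₄ + 2 * σ) * ht - 4 * hd + 4 * hσ
    have key : ∀ x y : ℝ, m₁ * x + m₂ * y = σ * x → m₃ * x + m₄ * y = σ * y →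
        x ^ 2 * g₁ + 2 * (x * y) * g₂ + y ^ 2 * g₃ = 0 → x = 0 ∧ y = 0 := by
      intro x y hx hy hg
      have hz : monodromy ω J q w l *ᵥ ![(x : ℂ), (y : ℂ)] = (σ : ℂ) • ![(x : ℂ), (y : ℂ)] := by
        rw [hM]
        ext i
        fin_cases i
        · simpa [Matrix.mulVec, dotProduct, Fin.sum_univ_two] using congrArg Complex.ofReal hx
        · simpa [Matrix.mulVec, dotProduct, Fin.sum_univ_two] using congrArg Complex.ofReal hy
      have := h.eq_zero_of_eigenvector hyp hL0 hl hσ hz (by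
        rw [hE]
        simp only [Matrix.cons_val_zero, Matrix.cons_val_one, ← starRingEnd_apply,
          Complex.conj_ofReal]
        have : x * x * g₁ + (x * y + y * x) * g₂ + y * y * g₃ = 0 := by linarith
        exact_mod_cast this)
      exact ⟨by simpa using congrFun this 0, by simpa using congrFun this 1⟩
    -- As σ is half the trace, the vectors used here and next are the second and first columns of M
    -- - σ. Their energies are -m₂ and m₃ times the expression in h1, up to multiples of hm.
    obtain ⟨f₁, f₂⟩ := key m₂ (-((m₁ - m₄) / 2)) (by linear_combination m₂ / 2 * ht)
      (by linear_combination -(m₁ - m₄) / 4 * ht + hm / 4) (by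
        linear_combination -m₂ * h1 + g₃ / 4 * hm)
    obtain ⟨-, f₃⟩ := key ((m₁ - m₄) / 2) m₃ (by
        linear_combination (m₁ - m₄) / 4 * ht + hm / 4)
      (by linear_combination m₃ / 2 * ht) (by linear_combination m₃ * h1 + g₁ / 4 * hm)
    have f1 : m₁ = σ := by linarith
    have f4 : m₄ = σ := by linarith
    rw [hM, f₁, f₃, f1, f4]
    ext i j
    fin_cases i <;> fin_cases j <;> simp
  · intro h1
    rw [hM] at h1
    have a00 := congrFun (congrFun h1 0) 0
    have a01 := congrFun (congrFun h1 0) 1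
    have a10 := congrFun (congrFun h1 1) 0
    have a11 := congrFun (congrFun h1 1) 1
    simp at a00 a01 a10 a11
    rw [hder, a00, a01, a10, a11]
    simp

/-- When M(l₀) = σ every solution has multiplier σ, so the Gram matrix is positive definite. The
condition det M(l) = 1 fixes the first-order part of the trace in terms of a second-order
determinant of energies that tends to det G. No second derivative is involved. -/
theorem eventually_mul_lt_two (h : IsModel c J q w μ Q W) (hyp : IsAdmissible ω J q w)
    (hL0 : ∀ u ∈ L0 J q w, u = 0) {D : ℝ → ℝ} (hD : ∀ l : ℝ, discriminant ω J q w l = D l)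
    {l₀ σ : ℝ} (hσ : σ ^ 2 = 1) (hM : monodromy ω J q w l₀ = (σ : ℂ) • 1) :
    ∀ᶠ l in 𝓝[≠] l₀, σ * D l < 2 := by
  have hl₀ := h.isGood_ofReal hyp l₀
  obtain ⟨g₁, g₂, g₃, k₁, k₂, k₃, hE, hpos⟩ := h.exists_gram (ω := ω) hl₀ (Complex.conj_ofReal l₀)
  have key : ∀ x y : ℝ, x ^ 2 * g₁ + 2 * (x * y) * g₂ + y ^ 2 * g₃ = 0 → x = 0 ∧ y = 0 := by
    intro x y hg
    have := h.eq_zero_of_eigenvector hyp hL0 hl₀ hσ (z := ![(x : ℂ), (y : ℂ)])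
      (by rw [hM, Matrix.smul_mulVec, Matrix.one_mulVec]) (by
        rw [hE]
        simp only [Matrix.cons_val_zero, Matrix.cons_val_one, ← starRingEnd_apply,
          Complex.conj_ofReal]
        have : x * x * g₁ + (x * y + y * x) * g₂ + y * y * g₃ = 0 := by linarith
        exact_mod_cast this)
    exact ⟨by simpa using congrFun this 0, by simpa using congrFun this 1⟩
  -- If the determinant vanished, (-g₂, g₁) would have zero energy. That gives g₁ = 0, and then
  -- (1,0) would have zero energy too.
  have hdet : 0 < g₃ * g₁ - g₂ * g₂ := by
    refine lt_of_le_of_ne (by linarith [sq_le_of_forall_nonneg hpos]) fun he => ?_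
    have h1 := (key (-g₂) g₁ (by linear_combination -g₁ * he)).2
    have := (key 1 0 (by rw [h1]; ring)).1
    exact one_ne_zero this
  have t := fun z z' => h.tendsto_energy_sol hyp l₀ z z'
  have hF := ((t ![0, 1] ![0, 1]).mul (t ![1, 0] ![1, 0])).sub
    ((t ![1, 0] ![0, 1]).mul (t ![0, 1] ![1, 0]))
  rw [h.energy_comm (sol J q w l₀ ![0, 1]) (sol J q w l₀ ![1, 0]), k₁, k₂, k₃] at hF
  have hre := (Complex.continuous_re.tendsto _).comp (hF.comp (Complex.continuous_ofReal.tendsto l₀))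
  have hev := hre.eventually_const_lt (show (0 : ℝ) < _ by
    rw [← Complex.ofReal_mul, ← Complex.ofReal_mul, ← Complex.ofReal_sub, Complex.ofReal_re]
    exact hdet)
  filter_upwards [hev.filter_mono nhdsWithin_le_nhds, self_mem_nhdsWithin] with l hlt hne
  have hl := h.isGood_ofReal hyp l
  simp only [Function.comp_apply] at hlt
  have a := h.monodromy_apply_zero hyp hl₀ hl
  have b := h.monodromy_apply_one hyp hl₀ hl
  have hdet1 := h.det_monodromy (ω := ω) hl
  have htr := hD l
  rw [h.discriminant_eq hyp hl, Matrix.trace_fin_two] at htr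
  rw [Matrix.det_fin_two] at hdet1
  rw [a, b] at htr
  rw [a, a, b, b] at hdet1
  simp only [hM, Matrix.smul_apply, Matrix.one_apply_eq, ne_eq, zero_ne_one, one_ne_zero,
    not_false_eq_true, Matrix.one_apply_ne, smul_eq_mul, mul_zero, mul_one] at htr hdet1
  have hσ' : (σ : ℂ) ^ 2 = 1 := by exact_mod_cast hσ
  set x := energy μ W (sol J q w l₀ ![0, 1]) (sol J q w l ![1, 0]) 0 ω
  set y := energy μ W (sol J q w l₀ ![0, 1]) (sol J q w l ![0, 1]) 0 ω
  set s := energy μ W (sol J q w l₀ ![1, 0]) (sol J q w l ![1, 0]) 0 ω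
  set r := energy μ W (sol J q w l₀ ![1, 0]) (sol J q w l ![0, 1]) 0 ω
  set ε : ℝ := (l - l₀) / c with hε
  have hεC : ((l : ℂ) - l₀) / c = (ε : ℂ) := by rw [hε]; push_cast; rfl
  rw [hεC] at htr hdet1
  -- Here M(l) = σ(1 + εX) with X = ((x,y),(-s,-r)), and det M(l) = 1 says that ε tr X = -ε² det X.
  -- Therefore σD(l) = 2 + ε tr X = 2 - ε² det X.
  have hfin : ((σ * D l : ℝ) : ℂ) = 2 - ((ε ^ 2 : ℝ) : ℂ) * (y * s - x * r) := by
    push_cast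
    rw [← htr]
    linear_combination hdet1 + (1 - ε ^ 2 * (y * s - x * r)) * hσ'
  have hfin' := congrArg Complex.re hfin
  rw [Complex.sub_re, Complex.re_ofReal_mul, Complex.ofReal_re] at hfin'
  rw [hfin']
  have hε0 : 0 < ε ^ 2 := by
    have : ε ≠ 0 := div_ne_zero (sub_ne_zero.2 hne) h.c_ne
    positivity
  have := mul_pos hε0 hlt
  simp only [Complex.re_ofNat]
  linarith

/-- A local extremum forces a zero derivative, hence M = σ, after which σD lies below 2 nearby. The
sign σ treats minima at 2 and maxima at -2 together. -/
theorem not_eventually_lt (h : IsModel c J q w μ Q W) (hyp : IsAdmissible ω J q w)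
    (hL0 : ∀ u ∈ L0 J q w, u = 0) {D : ℝ → ℝ} (hD : ∀ l : ℝ, discriminant ω J q w l = D l)
    {l₀ σ : ℝ} (hσ : σ ^ 2 = 1) (h2 : σ * D l₀ = 2) :
    ¬ ∀ᶠ l in 𝓝[≠] l₀, σ * D l₀ < σ * D l := by
  intro hev
  have hσ0 : σ ≠ 0 := by rintro rfl; norm_num at hσ
  have hD2 : D l₀ = 2 * σ := by linear_combination σ * h2 - D l₀ * hσ
  have hM : monodromy ω J q w l₀ = (σ : ℂ) • 1 := by
    rw [← h.deriv_eq_zero_iff hyp hL0 hσ (by rw [hD, hD2]; push_cast; rfl)]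
    have hder := (h.hasDerivAt_discriminant hyp l₀).differentiableAt.hasDerivAt
    have hderD : HasDerivAt D (deriv (discriminant ω J q w) l₀).re l₀ := by
      have := hder.real_of_complex
      simpa only [hD, Complex.ofReal_re] using this
    have hmin : IsLocalMin (fun l => σ * D l) l₀ := by
      rw [eventually_nhdsWithin_iff] at hev
      filter_upwards [hev] with l hl
      rcases eq_or_ne l l₀ with rfl | hne
      · exact le_rfl
      · exact (hl hne).le
    have h0 := hmin.hasDerivAt_eq_zero (hderD.const_mul σ)
    have hre := (mul_eq_zero.1 h0).resolve_left hσ0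
    rw [h.deriv_discriminant_eq_ofReal hyp, hre, Complex.ofReal_zero]
  have hlt := h.eventually_mul_lt_two hyp hL0 hD hσ hM
  obtain ⟨l, h3, h4⟩ := (hev.and hlt).exists
  linarith

/-- A nowhere vanishing derivative has constant sign on an interval by Darboux's theorem. The
complex derivative is real at real points, so it is also the derivative of the real restriction. -/
theorem strictMonoOn_or_strictAntiOn (h : IsModel c J q w μ Q W) (hyp : IsAdmissible ω J q w)
    (hL0 : ∀ u ∈ L0 J q w, u = 0) {D : ℝ → ℝ} (hD : ∀ l : ℝ, discriminant ω J q w l = D l)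
    {I : Set ℝ} (hI : I.OrdConnected) (hlt : ∀ l ∈ I, D l ^ 2 < 4) :
    StrictMonoOn D I ∨ StrictAntiOn D I := by
  have hder : ∀ l : ℝ, HasDerivAt D (deriv (discriminant ω J q w) l).re l := fun l => by
    have := (h.hasDerivAt_discriminant hyp l).differentiableAt.hasDerivAt.real_of_complex
    simpa only [hD, Complex.ofReal_re] using this
  have hne : ∀ l ∈ I, (deriv (discriminant ω J q w) l).re ≠ 0 := fun l hl h0 => by
    refine h.deriv_ne_zero_of_sq_lt hyp hL0 (hD l) (hlt l hl) ?_
    rw [h.deriv_discriminant_eq_ofReal hyp, h0, Complex.ofReal_zero]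
  have hcont : ContinuousOn D I := fun l _ => (hder l).continuousAt.continuousWithinAt
  rcases hasDerivWithinAt_forall_lt_or_forall_gt_of_forall_ne hI.convex
    (fun l _ => (hder l).hasDerivWithinAt) hne with hs | hs
  · exact Or.inr (strictAntiOn_of_hasDerivWithinAt_neg hI.convex hcont
      (fun l _ => (hder l).hasDerivWithinAt) fun l hl => hs l (interior_subset hl))
  · exact Or.inl (strictMonoOn_of_hasDerivWithinAt_pos hI.convex hcont
      (fun l _ => (hder l).hasDerivWithinAt) fun l hl => hs l (interior_subset hl))

/-- The value ±2 makes σ = ±1 a multiplier, which forces l to be real. There M is similar to the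
canonical monodromy matrix, and being a scalar matrix is invariant under similarity. -/
theorem deriv_eq_zero_iff_of_isMonodromyMatrix (h : IsModel c J q w μ Q W)
    (hyp : IsAdmissible ω J q w) (hL0 : ∀ u ∈ L0 J q w, u = 0) {M : Matrix (Fin 2) (Fin 2) ℂ}
    (hM : IsMonodromyMatrix ω J q w l M) (hD : discriminant ω J q w l ^ 2 = 4) :
    deriv (discriminant ω J q w) l = 0 ↔ M = 1 ∨ M = -1 := by
  obtain ⟨σ, hσ, hσD⟩ : ∃ σ : ℝ, (σ = 1 ∨ σ = -1) ∧ discriminant ω J q w l = 2 * σ := by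
    have : (discriminant ω J q w l - 2) * (discriminant ω J q w l + 2) = 0 := by
      linear_combination hD
    rcases mul_eq_zero.1 this with h1 | h1
    · exact ⟨1, Or.inl rfl, by push_cast; linear_combination h1⟩
    · exact ⟨-1, Or.inr rfl, by push_cast; linear_combination h1⟩
  have hσ2 : σ ^ 2 = 1 := by rcases hσ with rfl | rfl <;> norm_num
  have htr : M.trace = 2 * σ := by rw [← discriminant_eq_trace hM, hσD]
  have hr : star l = l := h.im_eq_zero_of_trace hyp hL0 hM (σ := (σ : ℂ))
    (by exact_mod_cast hσ2) (Complex.conj_ofReal σ) htr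
  obtain ⟨x, rfl⟩ : ∃ x : ℝ, (x : ℂ) = l := ⟨_, Complex.conj_eq_iff_re.1 hr⟩
  have hl := h.isGood_ofReal hyp x
  rw [h.deriv_eq_zero_iff hyp hL0 hσ2 hσD,
    (h.isMonodromyMatrix_monodromy hyp hl).eq_smul_one_iff hM]
  have h1 : (1 : Matrix (Fin 2) (Fin 2) ℂ).trace = 2 := by simp
  constructor
  · rcases hσ with rfl | rfl <;> intro hm
    · left; simpa using hm
    · right; simpa using hm
  -- For M = ±1 the trace 2σ decides which sign occurs.
  · rintro (rfl | rfl)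
    · rw [h1] at htr
      have : (σ : ℂ) = 1 := by linear_combination -htr / 2
      rw [this, one_smul]
    · rw [Matrix.trace_neg, h1] at htr
      have : (σ : ℂ) = -1 := by linear_combination -htr / 2
      rw [this, neg_one_smul]

end IsModel

end PeriodicSystem

theorem mainTheorem6 (ω : ℝ) (J : Matrix (Fin 2) (Fin 2) ℝ) (q w : PeriodicSystem.Coeff)
    (hyp : PeriodicSystem.IsAdmissible ω J q w)
    (hL0 : ∀ u ∈ PeriodicSystem.L0 J q w, u = 0) :
    -- the discriminant is well defined, and differentiable and real-valued on the real line
    (∀ l : ℝ, ∃ M, PeriodicSystem.IsMonodromyMatrix ω J q w (l : ℂ) M) ∧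
    (∀ (l : ℂ) (M : Matrix (Fin 2) (Fin 2) ℂ), PeriodicSystem.IsMonodromyMatrix ω J q w l M →
      PeriodicSystem.discriminant ω J q w l = M.trace) ∧
    (∀ l : ℝ, DifferentiableAt ℂ (PeriodicSystem.discriminant ω J q w) (l : ℂ)) ∧
    ∃ D : ℝ → ℝ, (∀ l : ℝ, PeriodicSystem.discriminant ω J q w (l : ℂ) = (D l : ℂ)) ∧
      -- strict monotonicity on real intervals where `D ^ 2 < 4`
      (∀ I : Set ℝ, I.OrdConnected → (∀ l ∈ I, D l ^ 2 < 4) →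
        StrictMonoOn D I ∨ StrictAntiOn D I) ∧
      -- critical points with `D ^ 2 = 4`
      (∀ (l : ℂ) (M : Matrix (Fin 2) (Fin 2) ℂ), PeriodicSystem.IsMonodromyMatrix ω J q w l M →
        PeriodicSystem.discriminant ω J q w l ^ 2 = 4 →
        (deriv (PeriodicSystem.discriminant ω J q w) l = 0 ↔ M = 1 ∨ M = -1)) ∧
      -- no strict local minimum with value `2`, no strict local maximum with value `-2`
      (∀ l : ℝ, D l = 2 → ¬ ∀ᶠ m in 𝓝[≠] l, D l < D m) ∧
      (∀ l : ℝ, D l = -2 → ¬ ∀ᶠ m in 𝓝[≠] l, D m < D l) := by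
  obtain ⟨c, μ, Q, W, hμ, h⟩ := hyp.exists_isModel
  obtain ⟨D, hD⟩ := h.exists_discriminant_eq_ofReal hyp
  refine ⟨fun l => ⟨_, h.isMonodromyMatrix_monodromy hyp (h.isGood_ofReal hyp l)⟩,
    fun l M hM => PeriodicSystem.discriminant_eq_trace hM,
    fun l => (h.hasDerivAt_discriminant hyp l).differentiableAt, D, hD,
    fun I hI hlt => h.strictMonoOn_or_strictAntiOn hyp hL0 hD hI hlt,
    fun l M hM h4 => h.deriv_eq_zero_iff_of_isMonodromyMatrix hyp hL0 hM h4, fun l hl hev => ?_,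
    fun l hl hev => ?_⟩
  · exact h.not_eventually_lt hyp hL0 hD (σ := 1) (by norm_num) (by linarith)
      (by simpa only [one_mul] using hev)
  · exact h.not_eventually_lt hyp hL0 hD (σ := -1) (by norm_num) (by linarith)
      (by simpa only [neg_one_mul, neg_lt_neg_iff] using hev)
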